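/- Let $1\le k$ and $p$ be integers, $\alpha>0$, $\beta>-\alpha/k$. Let $\overline{\mathcal M}=\mathrm{St}_{p,k}\times\mathcal H^{++}_k$, where $\mathrm{St}_{p,k}=\{U\in\mathbb C^{p\times k}:U^HU=I_k\}$ and $\mathcal H_k^{++}$ is the set of Hermitian positive definite $k\times k$ matrices. Its tangent space at $\bar\theta=(U,\Sigma)$ is $$T_{\bar\theta}\overline{\mathcal M}=\{(\xi_U,\xi_\Sigma)\in\mathbb C^{p\times k}\times\mathbb C^{k\times k}:\ U^H\xi_U+\xi_U^HU=0,\ \xi_\Sigma^H=\xi_\Sigma\},$$ and $\overline{\mathcal M}$ carries the Riemannian metric $$\langle\bar\xi,\bar\eta\rangle_{\bar\theta}=\mathrm{Re}\,\mathrm{tr}\big(\xi_U^H(I_p-\tfrac12UU^H)\eta_U\big)+\alpha\,\mathrm{tr}(\Sigma^{-1}\xi_\Sigma\Sigma^{-1}\eta_\Sigma)+\beta\,\mathrm{tr}(\Sigma^{-1}\xi_\Sigma)\,\mathrm{tr}(\Sigma^{-1}\eta_\Sigma).$$ The unitary group $\mathcal U_k$ acts by $(U,\Sigma)\mapsto(UO,O^H\Sigma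 O)$. Let $\pi:\overline{\mathcal M}\to\mathcal M=\overline{\mathcal M}/\mathcal U_k$ be the projection onto the quotient manifold. The vertical space $\mathcal V_{\bar\theta}=\{(U\Omega,\Sigma\Omega-\Omega\Sigma):\Omega^H=-\Omega\}$ is the tangent space of the orbit of $\bar\theta$, the horizontal space $\mathcal H_{\bar\theta}$ is its orthogonal complement in $T_{\bar\theta}\overline{\mathcal M}$, and $P^{\mathcal H}_{\bar\theta}$ is the orthogonal projection of $T_{\bar\theta}\overline{\mathcal M}$ onto $\mathcal H_{\bar\theta}$. The quotient $\mathcal M$ carries the metric that makes $\pi$ a Riemannian submersion. The representative at $\bar\theta$ of $\xi\in T_{\pi(\bar\theta)}\mathcal M$ is the $\bar\xi\in\mathcal H_{\bar\theta}$ with $D\pi(\bar\theta)[\bar\xi]=\xi$. The Riemannian Hessian of a function $h$ is $\mathrm{Hess}\,h[\xi]=\nabla_\xi\,\mathrm{grad}\,h$, with $\nabla$ the Levi-Civita connection. Let $\bar f:\overline{\mathcal M}\to\mathbb R$ be smooth and $\mathcal U_k$-invariant, and let $f:\mathcal M\to\mathbb R$ be the induced function, $\bar f=f\circ\pi$. Let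 $\bar\theta=(U,\Sigma)\in\overline{\mathcal M}$, $\theta=\pi(\bar\theta)$, and let $F$ be any real function on $\mathbb C^{p\times k}\times\mathbb C^{k\times k}$ which is $C^2$ at $\bar\theta$ and coincides with $\bar f$ on $\overline{\mathcal M}$ near $\bar\theta$. Let $(G_U,G_\Sigma)$ be the Euclidean gradient of $F$ at $\bar\theta$ for $\langle\xi,\eta\rangle^{\mathcal E}=\mathrm{Re}(\mathrm{tr}(\xi_U^H\eta_U)+\mathrm{tr}(\xi_\Sigma^H\eta_\Sigma))$ and, for a direction $\bar\xi$, let $(H_U,H_\Sigma)=D\,\mathrm{grad}_{\mathcal E}F(\bar\theta)[\bar\xi]$ be its Euclidean Hessian. Write $\mathrm{herm}(A)=\frac12(A+A^H)$ and $\mathrm{skewh}(A)=\frac12(A-A^H)$. Then: 1. The Riemannian gradient of $\bar f$ at $\bar\theta$ is $$\mathrm{grad}\,\bar f(\bar\theta)=\Big(G_U-UG_U^HU,\ \frac{\Sigma\,\mathrm{herm}(G_\Sigma)\,\Sigma}{\alpha}-\frac{\beta\,\mathrm{Re}\,\mathrm{tr}(G_\Sigma\Sigma)}{\alpha(\alpha+k\beta)}\Sigma\Big).$$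 It lies in $\mathcal H_{\bar\theta}$ and is the representative in $\mathcal H_{\bar\theta}$ of the Riemannian gradient of $f$ at $\theta$. 2. For every $\bar\xi\in T_{\bar\theta}\overline{\mathcal M}$, the Riemannian Hessian of $\bar f$ at $\bar\theta$ in direction $\bar\xi$ is $$\begin{aligned}\mathrm{Hess}\,\bar f(\bar\theta)[\bar\xi]=\Big(&H_U-UH_U^HU-U\,\mathrm{skewh}(G_U^H\xi_U)+\mathrm{skewh}(G_U\xi_U^H)\,U-\tfrac12(I_p-UU^H)\xi_UU^HG_U,\\&\tfrac1\alpha\big(\Sigma\,\mathrm{herm}(H_\Sigma)\,\Sigma+\mathrm{herm}(\Sigma\,\mathrm{herm}(G_\Sigma)\,\xi_\Sigma)\big)-\frac{\beta\,\mathrm{Re}\,\mathrm{tr}(H_\Sigma\Sigma+G_\Sigma\xi_\Sigma)}{\alpha(\alpha+k\beta)}\Sigma\Big).\end{aligned}$$ 3. For every $\bar\xi\in\mathcal H_{\bar\theta}$ and $\xi=D\pi(\bar\theta)[\bar\xi]$, the representative in $\mathcal H_{\bar\theta}$ of the Riemannian Hessian $\mathrm{Hess}\,f(\theta)[\xi]$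 is $P^{\mathcal H}_{\bar\theta}\big(\mathrm{Hess}\,\bar f(\bar\theta)[\bar\xi]\big)$. -/

import Mathlib

open scoped Matrix ContDiff Topology ComplexOrder

/- Matrices are normed by the Frobenius norm; only the derivatives (which do not depend on the choice
of the norm) of functions on spaces of matrices are used. -/
attribute [local instance] Matrix.frobeniusNormedAddCommGroup Matrix.frobeniusNormedSpace

noncomputable section

/-! ## Riemannian geometry through the algebra of smooth functions

A Riemannian manifold is described by its algebra of smooth real functions, its tangent spaces (whose
elements act on smooth functions as directional derivatives) and its metric.  Smooth vector fields,
affine connections, the Levi-Civita connection, gradients and Hessians are the usual ones.  The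
structure is only ever used for the two spaces constructed below. -/

structure RiemannianSpace (X : Type) where
  smooth : Subalgebra ℝ (X → ℝ)
  tangent : X → Submodule ℝ (smooth → ℝ)
  metric : (x : X) → tangent x → tangent x → ℝ

namespace RiemannianSpace

variable {X : Type} (R : RiemannianSpace X)

/-- Smooth vector fields: choices `V x` of a tangent vector at every point `x` such that `V f` is
smooth for every smooth function `f`. -/
def VectorField : Submodule ℝ ((x : X) → R.tangent x) where
  carrier := {V | ∀ f : R.smooth, (fun x => (V x).1 f) ∈ R.smooth}
  add_mem' := fun hV hW f => R.smooth.add_mem (hV f) (hW f)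
  zero_mem' := fun _ => R.smooth.zero_mem
  smul_mem' := fun c _ hV f => R.smooth.smul_mem (hV f) c

variable {R}

/-- The smooth function `V f : x ↦ V x f`. -/
def applyField (V : R.VectorField) (f : R.smooth) : R.smooth :=
  ⟨fun x => (V.1 x).1 f, V.2 f⟩

/-- The product `h V` of a smooth function and a smooth vector field. -/
def fsmul (h : R.smooth) (V : R.VectorField) : R.VectorField :=
  ⟨fun x => h.1 x • V.1 x, fun f => R.smooth.mul_mem h.2 (V.2 f)⟩

variable (R)

/-- `nabla V W` (the derivative of `W` along `V`) is the Levi-Civita connection: an affine connection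
which is symmetric (torsion-free) and compatible with the metric. -/
structure IsLeviCivita (nabla : R.VectorField → R.VectorField → R.VectorField) : Prop where
  add_left : ∀ V V' W, nabla (V + V') W = nabla V W + nabla V' W
  fsmul_left : ∀ (h : R.smooth) (V W), nabla (fsmul h V) W = fsmul h (nabla V W)
  add_right : ∀ V W W', nabla V (W + W') = nabla V W + nabla V W'
  leibniz : ∀ (h : R.smooth) (V W),
    nabla V (fsmul h W) = fsmul (applyField V h) W + fsmul h (nabla V W)
  symmetric : ∀ V W (f : R.smooth),
    applyField (nabla V W) f - applyField (nabla W V) f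
      = applyField V (applyField W f) - applyField W (applyField V f)
  metric_compat : ∀ V W Z, ∃ h : R.smooth,
    (∀ x, h.1 x = R.metric x (W.1 x) (Z.1 x)) ∧
    ∀ x, (V.1 x).1 h =
      R.metric x ((nabla V W).1 x) (Z.1 x) + R.metric x (W.1 x) ((nabla V Z).1 x)

/-- `v` is the Riemannian gradient of `f` at `x`: the tangent vector with `⟨v, w⟩ₓ = D f(x)[w]` for
all tangent vectors `w`. -/
def IsGradientAt (f : R.smooth) (x : X) (v : R.smooth → ℝ) : Prop :=
  ∃ hv : v ∈ R.tangent x, ∀ w : R.tangent x, R.metric x ⟨v, hv⟩ w = w.1 f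

/-- `ζ` is the Riemannian Hessian of `f` at `x` in the direction of the tangent vector `ξ`: the value
at `x` of `∇_V grad f`, for the Levi-Civita connection `∇` and a vector field `V` with `V x = ξ`. -/
def IsHessianAt (f : R.smooth) (x : X) (ξ ζ : R.smooth → ℝ) : Prop :=
  ∃ (nabla : R.VectorField → R.VectorField → R.VectorField) (V G : R.VectorField),
    R.IsLeviCivita nabla ∧ (∀ y, R.IsGradientAt f y (G.1 y).1) ∧
    (V.1 x).1 = ξ ∧ ((nabla V G).1 x).1 = ζ

end RiemannianSpace

namespace FixedRank

/-! ## The ambient space and its Euclidean structure -/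

/-- The real vector space `ℂ^{p×k} × ℂ^{k×k}`; its elements are pairs `(Z_U, Z_Σ)`. -/
abbrev Ambient (p k : ℕ) : Type := Matrix (Fin p) (Fin k) ℂ × Matrix (Fin k) (Fin k) ℂ

/-- Hermitian part. -/
def herm {n : ℕ} (A : Matrix (Fin n) (Fin n) ℂ) : Matrix (Fin n) (Fin n) ℂ :=
  (1 / 2 : ℂ) • (A + Aᴴ)

/-- Skew-Hermitian part. -/
def skewh {n : ℕ} (A : Matrix (Fin n) (Fin n) ℂ) : Matrix (Fin n) (Fin n) ℂ :=
  (1 / 2 : ℂ) • (A - Aᴴ)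

variable {p k : ℕ}

/-- The Euclidean metric `Re (tr (ξ_Uᴴ η_U) + tr (ξ_Σᴴ η_Σ))`. -/
def euclInner (ξ η : Ambient p k) : ℝ := ((ξ.1ᴴ * η.1).trace + (ξ.2ᴴ * η.2).trace).re

/-- The Euclidean gradient `(G_U, G_Σ)` of a real function on the ambient space, given by its partial
derivatives with respect to the real and imaginary parts of the entries. -/
def euclGrad (F : Ambient p k → ℝ) (θ : Ambient p k) : Ambient p k :=
  (Matrix.of fun i j =>
      ⟨fderiv ℝ F θ (Matrix.single i j 1, 0), fderiv ℝ F θ (Matrix.single i j Complex.I, 0)⟩,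
    Matrix.of fun i j =>
      ⟨fderiv ℝ F θ (0, Matrix.single i j 1), fderiv ℝ F θ (0, Matrix.single i j Complex.I)⟩)

theorem linear_eq_trace {m n : ℕ} (L : Matrix (Fin m) (Fin n) ℂ →ₗ[ℝ] ℝ)
    (A : Matrix (Fin m) (Fin n) ℂ) :
    L A = ((Matrix.of fun i j => (⟨L (Matrix.single i j 1), L (Matrix.single i j Complex.I)⟩ : ℂ))ᴴ
      * A).trace.re := by
  have key : A = ∑ i, ∑ j,
      ((A i j).re • Matrix.single i j (1 : ℂ) + (A i j).im • Matrix.single i j Complex.I) := by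
    conv_lhs => rw [Matrix.matrix_eq_sum_single A]
    refine Finset.sum_congr rfl fun i _ => Finset.sum_congr rfl fun j _ => ?_
    rw [Matrix.smul_single, Matrix.smul_single, ← Matrix.single_add]
    congr 1
    simp [Complex.re_add_im]
  have h : L A = ∑ i, ∑ j, ((A i j).re * L (Matrix.single i j (1 : ℂ))
      + (A i j).im * L (Matrix.single i j Complex.I)) := by
    conv_lhs => rw [key]
    simp only [map_sum, map_add, map_smul, smul_eq_mul]
  rw [h, Finset.sum_comm, Matrix.trace, Complex.re_sum]
  refine Finset.sum_congr rfl fun j _ => ?_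
  rw [Matrix.diag_apply, Matrix.mul_apply, Complex.re_sum]
  refine Finset.sum_congr rfl fun i _ => ?_
  simp [Matrix.conjTranspose_apply, Complex.mul_re]
  ring

/-- `euclGrad` represents the differential with respect to the Euclidean metric. -/
theorem euclInner_euclGrad (F : Ambient p k → ℝ) (θ ξ : Ambient p k) :
    euclInner (euclGrad F θ) ξ = fderiv ℝ F θ ξ := by
  have h1 := linear_eq_trace ((fderiv ℝ F θ).toLinearMap ∘ₗ LinearMap.inl ℝ _ _) ξ.1
  have h2 := linear_eq_trace ((fderiv ℝ F θ).toLinearMap ∘ₗ LinearMap.inr ℝ _ _) ξ.2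
  have h3 : fderiv ℝ F θ ξ = fderiv ℝ F θ (ξ.1, 0) + fderiv ℝ F θ (0, ξ.2) := by
    rw [← map_add]; simp
  rw [h3, euclInner, Complex.add_re]
  exact (congrArg₂ (· + ·) h1 h2).symm

/-- The Euclidean Hessian `D (grad F)(θ)[ξ] = (H_U, H_Σ)`. -/
def euclHess (F : Ambient p k → ℝ) (θ ξ : Ambient p k) : Ambient p k :=
  fderiv ℝ (euclGrad F) θ ξ

/-! ## The product manifold `St_{p,k} × H⁺⁺_k` -/

/-- `St_{p,k} × H⁺⁺_k`. -/
def MBar (p k : ℕ) : Set (Ambient p k) := {θ | θ.1ᴴ * θ.1 = 1 ∧ θ.2.PosDef}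

/-- The tangent space of `St_{p,k} × H⁺⁺_k` at `θ = (U, Σ)`. -/
def TBar (θ : Ambient p k) : Submodule ℝ (Ambient p k) where
  carrier := {ξ | θ.1ᴴ * ξ.1 + ξ.1ᴴ * θ.1 = 0 ∧ ξ.2ᴴ = ξ.2}
  add_mem' := by
    rintro a b ⟨ha, ha'⟩ ⟨hb, hb'⟩
    refine ⟨?_, by simp [ha', hb']⟩
    have : θ.1ᴴ * (a + b).1 + (a + b).1ᴴ * θ.1
        = (θ.1ᴴ * a.1 + a.1ᴴ * θ.1) + (θ.1ᴴ * b.1 + b.1ᴴ * θ.1) := by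
      simp only [Prod.fst_add, Matrix.conjTranspose_add, Matrix.mul_add, Matrix.add_mul]
      abel
    rw [this, ha, hb, add_zero]
  zero_mem' := by simp
  smul_mem' := by
    rintro c a ⟨ha, ha'⟩
    refine ⟨?_, by simp [ha', Matrix.conjTranspose_smul]⟩
    have : θ.1ᴴ * (c • a).1 + (c • a).1ᴴ * θ.1 = c • (θ.1ᴴ * a.1 + a.1ᴴ * θ.1) := by
      simp [Matrix.conjTranspose_smul, smul_add]
    rw [this, ha, smul_zero]

/-- The Riemannian metric with parameters `α`, `β` at `θ = (U, Σ)`.  The traces in the second and the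
third term are real for tangent vectors. -/
def metricBar (α β : ℝ) (θ ξ η : Ambient p k) : ℝ :=
  ((ξ.1ᴴ * (1 - (1 / 2 : ℂ) • (θ.1 * θ.1ᴴ)) * η.1).trace).re
    + α * ((θ.2⁻¹ * ξ.2 * θ.2⁻¹ * η.2).trace).re
    + β * ((θ.2⁻¹ * ξ.2).trace).re * ((θ.2⁻¹ * η.2).trace).re

/-- A function on `St_{p,k} × H⁺⁺_k` is smooth if around every point it is the restriction of a smooth
function on an open set of the ambient space. -/
def smoothBar (p k : ℕ) : Subalgebra ℝ (MBar p k → ℝ) where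
  carrier := {f | ∀ θ : MBar p k, ∃ (F : Ambient p k → ℝ) (W : Set (Ambient p k)),
    IsOpen W ∧ θ.1 ∈ W ∧ ContDiffOn ℝ ∞ F W ∧ ∀ θ' : MBar p k, θ'.1 ∈ W → f θ' = F θ'.1}
  mul_mem' := by
    intro f g hf hg θ
    obtain ⟨F, W, hW, hθ, hF, hFf⟩ := hf θ
    obtain ⟨G, W', hW', hθ', hG, hGg⟩ := hg θ
    refine ⟨fun x => F x * G x, W ∩ W', hW.inter hW', ⟨hθ, hθ'⟩,
      (hF.mono Set.inter_subset_left).mul (hG.mono Set.inter_subset_right), fun θ' h => ?_⟩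
    simp [hFf θ' h.1, hGg θ' h.2]
  add_mem' := by
    intro f g hf hg θ
    obtain ⟨F, W, hW, hθ, hF, hFf⟩ := hf θ
    obtain ⟨G, W', hW', hθ', hG, hGg⟩ := hg θ
    refine ⟨fun x => F x + G x, W ∩ W', hW.inter hW', ⟨hθ, hθ'⟩,
      (hF.mono Set.inter_subset_left).add (hG.mono Set.inter_subset_right), fun θ' h => ?_⟩
    simp [hFf θ' h.1, hGg θ' h.2]
  algebraMap_mem' := fun r _ =>
    ⟨fun _ => r, Set.univ, isOpen_univ, trivial, contDiffOn_const, fun _ _ => rfl⟩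

/-- The tangent vector `f ↦ D f(θ)[ξ]` of `St_{p,k} × H⁺⁺_k` given by the pair of matrices `ξ`: the
derivative in direction `ξ` of a local smooth extension of `f`.  (For `ξ` in `TBar θ` it does not depend
on the chosen extension.) -/
def dirDeriv (θ : MBar p k) : Ambient p k →ₗ[ℝ] (smoothBar p k → ℝ) where
  toFun ξ := fun f => fderiv ℝ (Classical.choose (f.2 θ)) θ.1 ξ
  map_add' := fun ξ η => by funext f; simp
  map_smul' := fun c ξ => by funext f; simp

/-- `St_{p,k} × H⁺⁺_k` as a Riemannian manifold. -/
def riemBar (p k : ℕ) (α β : ℝ) : RiemannianSpace (MBar p k) where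
  smooth := smoothBar p k
  tangent θ := (TBar θ.1).map (dirDeriv θ)
  metric θ v w := metricBar α β θ.1
    (Classical.choose (Submodule.mem_map.1 v.2)) (Classical.choose (Submodule.mem_map.1 w.2))

/-! ## The quotient by the unitary group -/

/-- The action `(U, Σ) ↦ (U O, Oᴴ Σ O)` of a unitary matrix `O`. -/
def act (O : Matrix.unitaryGroup (Fin k) ℂ) (θ : MBar p k) : MBar p k :=
  ⟨(θ.1.1 * O.1, O.1ᴴ * θ.1.2 * O.1), by
    have hO : O.1ᴴ * O.1 = 1 := Matrix.mem_unitaryGroup_iff'.1 O.2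
    refine ⟨?_, ?_⟩
    · have h := θ.2.1
      calc (θ.1.1 * O.1)ᴴ * (θ.1.1 * O.1) = O.1ᴴ * (θ.1.1ᴴ * θ.1.1) * O.1 := by
            simp only [Matrix.conjTranspose_mul, Matrix.mul_assoc]
        _ = 1 := by rw [h, Matrix.mul_one, hO]
    · refine θ.2.2.conjTranspose_mul_mul_same ?_
      intro x y hxy
      have := congrArg (O.1ᴴ *ᵥ ·) hxy
      simpa [Matrix.mulVec_mulVec, hO] using this⟩

/-- Two points are equivalent if they lie in the same orbit of the unitary group. -/
def orbitSetoid (p k : ℕ) : Setoid (MBar p k) where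
  r θ θ' := ∃ O : Matrix.unitaryGroup (Fin k) ℂ, θ' = act O θ
  iseqv := by
    refine ⟨fun θ => ⟨1, ?_⟩, ?_, ?_⟩
    · apply Subtype.ext; simp [act]
    · rintro θ _ ⟨O, rfl⟩
      refine ⟨O⁻¹, ?_⟩
      have hO : O.1 * O.1ᴴ = 1 := Matrix.mem_unitaryGroup_iff.1 O.2
      have hi : (O⁻¹).1 = O.1ᴴ := rfl
      apply Subtype.ext
      refine Prod.ext ?_ ?_
      · simp [act, hi, Matrix.mul_assoc, hO]
      · change θ.1.2 = (O⁻¹).1ᴴ * (O.1ᴴ * θ.1.2 * O.1) * (O⁻¹).1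
        rw [hi, Matrix.conjTranspose_conjTranspose]
        calc θ.1.2 = (O.1 * O.1ᴴ) * θ.1.2 * (O.1 * O.1ᴴ) := by simp [hO]
          _ = _ := by simp only [Matrix.mul_assoc]
    · rintro θ _ _ ⟨O, rfl⟩ ⟨O', rfl⟩
      refine ⟨O * O', ?_⟩
      apply Subtype.ext
      simp [act, Matrix.mul_assoc]

/-- The quotient `M_{p,k} = (St_{p,k} × H⁺⁺_k) / U_k`. -/
def MQuot (p k : ℕ) : Type := Quotient (orbitSetoid p k)

/-- The canonical projection `π`. -/
def proj (θ : MBar p k) : MQuot p k := Quotient.mk (orbitSetoid p k) θ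

/-- The function on the quotient induced by an invariant function. -/
def induced (f : MBar p k → ℝ)
    (hf : ∀ (O : Matrix.unitaryGroup (Fin k) ℂ) (θ : MBar p k), f (act O θ) = f θ) :
    MQuot p k → ℝ :=
  Quotient.lift f (by rintro θ _ ⟨O, rfl⟩; exact (hf O θ).symm)

/-- The smooth functions of the quotient manifold: those for which `f ∘ π` is smooth. -/
def smoothQuot (p k : ℕ) : Subalgebra ℝ (MQuot p k → ℝ) where
  carrier := {f | f ∘ proj ∈ smoothBar p k}
  mul_mem' := fun hf hg => (smoothBar p k).mul_mem hf hg
  add_mem' := fun hf hg => (smoothBar p k).add_mem hf hg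
  algebraMap_mem' := fun r => (smoothBar p k).algebraMap_mem r

/-- `Dπ(θ)[ξ]`, the tangent vector `f ↦ D (f ∘ π)(θ)[ξ]` of the quotient at `π(θ)`. -/
def dproj (θ : MBar p k) : Ambient p k →ₗ[ℝ] (smoothQuot p k → ℝ) where
  toFun ξ := fun f => dirDeriv θ ξ ⟨f.1 ∘ proj, f.2⟩
  map_add' := fun ξ η => by funext f; simp
  map_smul' := fun c ξ => by funext f; simp

/-- The vertical space at `θ = (U, Σ)`: all `(U Ω, Σ Ω - Ω Σ)` with `Ω` skew-Hermitian; this is the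
tangent space of the orbit. -/
def VBar (θ : Ambient p k) : Set (Ambient p k) :=
  {ξ | ∃ Ω : Matrix (Fin k) (Fin k) ℂ, Ωᴴ = -Ω ∧ ξ = (θ.1 * Ω, θ.2 * Ω - Ω * θ.2)}

/-- The horizontal space: the orthogonal complement of the vertical space in the tangent space. -/
def HBar (α β : ℝ) (θ : Ambient p k) : Set (Ambient p k) :=
  {ξ | ξ ∈ TBar θ ∧ ∀ η ∈ VBar θ, metricBar α β θ ξ η = 0}

open Classical in
/-- The orthogonal projection of the tangent space onto the horizontal space. -/
def horProj (α β : ℝ) (θ ξ : Ambient p k) : Ambient p k :=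
  if h : ∃ ζ ∈ HBar α β θ, ∀ η ∈ HBar α β θ, metricBar α β θ (ξ - ζ) η = 0
  then Classical.choose h else 0

open Classical in
/-- The representative in the horizontal space at `θ` of a tangent vector `v` of the quotient at
`π(θ)`: the horizontal `ξ` with `Dπ(θ)[ξ] = v`. -/
def horLift (α β : ℝ) (θ : MBar p k) (v : smoothQuot p k → ℝ) : Ambient p k :=
  if h : ∃ ξ ∈ HBar α β θ.1, dproj θ ξ = v then Classical.choose h else 0

/-- The quotient as a Riemannian manifold: its tangent space at `x` is the image of `Dπ(θ)`, for
any `θ` over `x`, and its metric is the one which turns `π` into a Riemannian submersion, that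
is the metric of horizontal representatives (which do not depend on the point chosen over `x`, as the
metric is invariant). -/
def riemQuot (p k : ℕ) (α β : ℝ) : RiemannianSpace (MQuot p k) where
  smooth := smoothQuot p k
  tangent x := ⨆ θ : {θ : MBar p k // proj θ = x}, (TBar θ.1.1).map (dproj θ.1)
  metric x v w := metricBar α β (Quotient.out x).1
    (horLift α β (Quotient.out x) v.1) (horLift α β (Quotient.out x) w.1)

/-! ## The formulas -/

/-- The formula for the Riemannian gradient at `θ = (U, Σ)`, for the Euclidean gradient `G`. -/
def gradFormula (α β : ℝ) (θ G : Ambient p k) : Ambient p k :=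
  (G.1 - θ.1 * G.1ᴴ * θ.1,
    (1 / α) • (θ.2 * herm G.2 * θ.2)
      - (β * ((G.2 * θ.2).trace).re / (α * (α + k * β))) • θ.2)

/-- The formula for the Riemannian Hessian at `θ = (U, Σ)` in direction `ξ`, for the Euclidean
gradient `G` and the Euclidean Hessian `H` in direction `ξ`. -/
def hessFormula (α β : ℝ) (θ ξ G H : Ambient p k) : Ambient p k :=
  (H.1 - θ.1 * H.1ᴴ * θ.1 - θ.1 * skewh (G.1ᴴ * ξ.1) + skewh (G.1 * ξ.1ᴴ) * θ.1
      - (1 / 2 : ℂ) • ((1 - θ.1 * θ.1ᴴ) * ξ.1 * θ.1ᴴ * G.1),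
    (1 / α) • (θ.2 * herm H.2 * θ.2 + herm (θ.2 * herm G.2 * ξ.2))
      - (β * ((H.2 * θ.2 + G.2 * ξ.2).trace).re / (α * (α + k * β))) • θ.2)

end FixedRank

end

/-! On the product, all derivatives are taken along curves (`HasTDeriv`). Every tangent vector is
the velocity of a curve (`exists_curve`), so these derivatives do not depend on the ambient
extension of a function.

The gradient is determined by its pairings with tangent vectors, because the bounds on α and β make
the metric definite (`metricBar_self_pos`). Pairing the gradient formula with η gives the Euclidean
pairing of G with η: the error in the U-part is the real trace of a Hermitian times a skew-Hermitian
matrix, hence zero, and the coefficient of Σ absorbs the β-term (`metricBar_gradFormula`).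

In ambient coordinates the Levi-Civita connection is ∇_V W = DW[V] + Γ(V, W), with Γ the symmetric
bilinear `christoffel`. The term Γ restores tangency (`add_christoffel_mem`) and accounts for the
derivative of the metric coefficients (`dmetric_eq`); its symmetry, with that of second derivatives,
gives vanishing torsion. Since the connection is unique (`isLeviCivita_unique`), the Hessian is the
derivative of the gradient formula plus Γ(ξ, grad), which simplifies to the stated expression
(`hessFormula_eq`).

On the quotient, the kernel of Dπ is the vertical space: curves inside an orbit give one inclusion,
the invariant pair (U Uᴴ, U Σ Uᴴ) gives the other. Finding the vertical part of a vector means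
solving a linear equation for Ω with injective operator `vertOp`, so horizontal parts depend
smoothly on the point. Vector fields of the quotient therefore lift to smooth equivariant horizontal
fields, and Dπ(∇ of the lifts) satisfies the axioms of the Levi-Civita connection below
(`isLeviCivita_nablaQuot`). An invariant function is constant on orbits, so its gradient is
horizontal and is the lift of the gradient below. Hence the Hessian below is Dπ of the Hessian
above, and horizontal projection only removes a vertical vector, which Dπ kills. -/

namespace FixedRank

noncomputable section

variable {p k : ℕ}

/-! ## Calculus with matrices -/

/-- Matrix multiplication as a continuous real bilinear map. -/
def mulL (l m n : ℕ) : Matrix (Fin l) (Fin m) ℂ →L[ℝ] Matrix (Fin m) (Fin n) ℂ →L[ℝ]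
    Matrix (Fin l) (Fin n) ℂ :=
  LinearMap.toContinuousBilinearMap
    (LinearMap.mk₂ ℝ (fun A B => A * B) Matrix.add_mul (fun c A B => Matrix.smul_mul c A B)
      Matrix.mul_add (fun c A B => Matrix.mul_smul A c B))

/-- The conjugate transpose as a continuous real linear map. -/
def ctL (m n : ℕ) : Matrix (Fin m) (Fin n) ℂ →L[ℝ] Matrix (Fin n) (Fin m) ℂ :=
  LinearMap.toContinuousLinearMap
    { toFun := fun A => Aᴴ
      map_add' := fun A B => Matrix.conjTranspose_add A B
      map_smul' := fun c A => by simp [Matrix.conjTranspose_smul] }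

/-- The real part of the trace as a continuous real linear map. -/
def reTr (n : ℕ) : Matrix (Fin n) (Fin n) ℂ →L[ℝ] ℝ :=
  LinearMap.toContinuousLinearMap
    { toFun := fun A => A.trace.re
      map_add' := fun A B => by simp
      map_smul' := fun c A => by simp }

@[simp]
theorem reTr_apply {n : ℕ} (A : Matrix (Fin n) (Fin n) ℂ) : reTr n A = A.trace.re := rfl

theorem _root_.HasDerivAt.matmul {l m n : ℕ} {f : ℝ → Matrix (Fin l) (Fin m) ℂ}
    {g : ℝ → Matrix (Fin m) (Fin n) ℂ} {f' g'} {t : ℝ} (hf : HasDerivAt f f' t)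
    (hg : HasDerivAt g g' t) : HasDerivAt (fun s => f s * g s) (f' * g t + f t * g') t := by
  have := (mulL l m n).hasDerivAt_of_bilinear (fun _ => hf) (fun _ => hg)
  rw [add_comm]
  exact this

theorem _root_.HasDerivAt.matct {m n : ℕ} {f : ℝ → Matrix (Fin m) (Fin n) ℂ} {f'} {t : ℝ}
    (hf : HasDerivAt f f' t) : HasDerivAt (fun s => (f s)ᴴ) f'ᴴ t :=
  (ctL m n).hasFDerivAt.comp_hasDerivAt t hf

theorem contDiffWithinAt_of_functionals {X E : Type*} [NormedAddCommGroup X] [NormedSpace ℝ X]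
    [NormedAddCommGroup E] [NormedSpace ℝ E] [FiniteDimensional ℝ E] {n : WithTop ℕ∞} {v : X → E}
    {s : Set X} {x : X} (h : ∀ l : E →ₗ[ℝ] ℝ, ContDiffWithinAt ℝ n (fun x => l (v x)) s x) :
    ContDiffWithinAt ℝ n v s x := by
  let b := Module.finBasis ℝ E
  have hv : v = fun x => ∑ i, b.coord i (v x) • b i := by
    funext x
    exact (b.sum_repr (v x)).symm
  rw [hv]
  exact ContDiffWithinAt.sum fun i _ => (h _).smul contDiffWithinAt_const

theorem _root_.ContDiff.bilin {X E E' E'' : Type*} [NormedAddCommGroup X] [NormedSpace ℝ X]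
    [NormedAddCommGroup E] [NormedSpace ℝ E] [NormedAddCommGroup E'] [NormedSpace ℝ E']
    [NormedAddCommGroup E''] [NormedSpace ℝ E''] (B : E →L[ℝ] E' →L[ℝ] E'') {v : X → E}
    {w : X → E'} (hv : ContDiff ℝ ∞ v) (hw : ContDiff ℝ ∞ w) :
    ContDiff ℝ ∞ fun x => B (v x) (w x) :=
  (B.contDiff.comp hv).clm_apply hw

theorem _root_.ContDiff.matmul {X : Type*} [NormedAddCommGroup X] [NormedSpace ℝ X]
    {l m n : ℕ} {f : X → Matrix (Fin l) (Fin m) ℂ} {g : X → Matrix (Fin m) (Fin n) ℂ}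
    (hf : ContDiff ℝ ∞ f) (hg : ContDiff ℝ ∞ g) : ContDiff ℝ ∞ fun x => f x * g x :=
  hf.bilin (mulL l m n) hg

theorem _root_.ContDiff.matct {X : Type*} [NormedAddCommGroup X] [NormedSpace ℝ X]
    {m n : ℕ} {f : X → Matrix (Fin m) (Fin n) ℂ} (hf : ContDiff ℝ ∞ f) :
    ContDiff ℝ ∞ fun x => (f x)ᴴ :=
  (ctL m n).contDiff.comp hf

theorem _root_.HasDerivAt.reTrace {n : ℕ} {f : ℝ → Matrix (Fin n) (Fin n) ℂ} {f'} {t : ℝ}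
    (hf : HasDerivAt f f' t) : HasDerivAt (fun s => ((f s).trace).re) (f'.trace.re) t :=
  (reTr n).hasFDerivAt.comp_hasDerivAt t hf

section Ring

attribute [local instance] Matrix.frobeniusNormedRing Matrix.frobeniusNormedAlgebra

theorem isOpen_isUnit (n : ℕ) : IsOpen {A : Matrix (Fin n) (Fin n) ℂ | IsUnit A} :=
  Units.isOpen

/-- Inversion is smooth at the units of a complete normed algebra. The ring structure enabled in
this section carries the same Frobenius norm as the rest of the file. -/
theorem contDiffOn_matinv (n : ℕ) :
    ContDiffOn ℝ ∞ (fun A : Matrix (Fin n) (Fin n) ℂ => A⁻¹) {A | IsUnit A} := by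
  rintro _ ⟨u, rfl⟩
  have h := contDiffAt_ringInverse ℝ (n := ∞) u
  have he : (fun A : Matrix (Fin n) (Fin n) ℂ => A⁻¹) = Ring.inverse :=
    funext Matrix.nonsing_inv_eq_ringInverse
  rw [he]
  exact h.contDiffWithinAt

theorem hasDerivAt_exp_smul (n : ℕ) (A : Matrix (Fin n) (Fin n) ℂ) :
    HasDerivAt (fun t : ℝ => NormedSpace.exp (t • A)) A 0 := by
  have := hasDerivAt_exp_smul_const (𝕂 := ℝ) A (0 : ℝ)
  rw [zero_smul, NormedSpace.exp_zero, one_mul] at this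
  exact this

end Ring

/-- A derivative exists because inversion is smooth; its value then follows by differentiating f ·
f⁻¹ = 1. -/
theorem _root_.HasDerivAt.matinv {n : ℕ} {f : ℝ → Matrix (Fin n) (Fin n) ℂ} {f'} {t : ℝ}
    (hf : HasDerivAt f f' t) (hu : ∀ s, IsUnit (f s)) :
    HasDerivAt (fun s => (f s)⁻¹) (-((f t)⁻¹ * f' * (f t)⁻¹)) t := by
  have hd : DifferentiableAt ℝ (fun A : Matrix (Fin n) (Fin n) ℂ => A⁻¹) (f t) :=
    ((contDiffOn_matinv n).contDiffAt ((isOpen_isUnit n).mem_nhds (hu t))).differentiableAt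
      (by simp)
  have h1 : HasDerivAt (fun s => (f s)⁻¹) _ t := hd.hasFDerivAt.comp_hasDerivAt t hf
  have hdet : ∀ s, IsUnit (f s).det := fun s => (Matrix.isUnit_iff_isUnit_det _).1 (hu s)
  have h2 := hf.matmul h1
  have h3 : (fun s => f s * (f s)⁻¹) = fun _ => 1 := by
    funext s; exact Matrix.mul_nonsing_inv _ (hdet s)
  rw [h3] at h2
  have h4 := h2.unique (hasDerivAt_const t _)
  have h5 := congrArg ((f t)⁻¹ * ·) h4
  simp only [Matrix.mul_add, ← Matrix.mul_assoc, Matrix.nonsing_inv_mul _ (hdet t),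
    Matrix.one_mul, Matrix.mul_zero] at h5
  rw [← eq_neg_of_add_eq_zero_right h5]
  exact h1

/-! ## Smooth maps on `St_{p,k} × H⁺⁺_k` -/

section Smooth

variable {E E' E'' : Type*} [NormedAddCommGroup E] [NormedSpace ℝ E] [NormedAddCommGroup E']
  [NormedSpace ℝ E'] [NormedAddCommGroup E''] [NormedSpace ℝ E'']

/-- Maps which locally extend to smooth maps on open sets of the ambient space. -/
def SmoothMap (v : MBar p k → E) : Prop :=
  ∀ θ : MBar p k, ∃ (F : Ambient p k → E) (W : Set (Ambient p k)),
    IsOpen W ∧ θ.1 ∈ W ∧ ContDiffOn ℝ ∞ F W ∧ ∀ θ' : MBar p k, θ'.1 ∈ W → v θ' = F θ'.1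

theorem SmoothMap.of_ambient {F : Ambient p k → E} (hF : ContDiff ℝ ∞ F) :
    SmoothMap fun θ : MBar p k => F θ.1 :=
  fun _ => ⟨F, Set.univ, isOpen_univ, trivial, hF.contDiffOn, fun _ _ => rfl⟩

theorem SmoothMap.comp_on {g : E → E'} {O : Set E} (hO : IsOpen O) (hg : ContDiffOn ℝ ∞ g O)
    {v : MBar p k → E} (hv : SmoothMap v) (hvO : ∀ θ, v θ ∈ O) : SmoothMap fun θ => g (v θ) := by
  intro θ
  obtain ⟨F, W, hW, hθ, hF, hFv⟩ := hv θ
  refine ⟨fun x => g (F x), W ∩ F ⁻¹' O, hF.continuousOn.isOpen_inter_preimage hW hO,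
    ⟨hθ, ?_⟩, hg.comp (hF.mono Set.inter_subset_left) fun x hx => hx.2, fun θ' h => ?_⟩
  · rw [Set.mem_preimage, ← hFv θ hθ]; exact hvO θ
  · simp only [hFv θ' h.1]

theorem SmoothMap.comp {g : E → E'} (hg : ContDiff ℝ ∞ g) {v : MBar p k → E} (hv : SmoothMap v) :
    SmoothMap fun θ => g (v θ) :=
  hv.comp_on isOpen_univ hg.contDiffOn fun _ => trivial

theorem SmoothMap.clm (L : E →L[ℝ] E') {v : MBar p k → E} (hv : SmoothMap v) :
    SmoothMap fun θ => L (v θ) :=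
  hv.comp L.contDiff

theorem SmoothMap.prodMk {v : MBar p k → E} {w : MBar p k → E'} (hv : SmoothMap v)
    (hw : SmoothMap w) : SmoothMap fun θ => (v θ, w θ) := by
  intro θ
  obtain ⟨F, W, hW, hθ, hF, hFv⟩ := hv θ
  obtain ⟨F', W', hW', hθ', hF', hFv'⟩ := hw θ
  refine ⟨fun x => (F x, F' x), W ∩ W', hW.inter hW', ⟨hθ, hθ'⟩,
    (hF.mono Set.inter_subset_left).prodMk (hF'.mono Set.inter_subset_right), fun θ' h => ?_⟩
  simp only [hFv θ' h.1, hFv' θ' h.2]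

theorem SmoothMap.const (e : E) : SmoothMap fun _ : MBar p k => e :=
  SmoothMap.of_ambient contDiff_const

theorem SmoothMap.val : SmoothMap fun θ : MBar p k => θ.1 := SmoothMap.of_ambient contDiff_id

theorem SmoothMap.fst {v : MBar p k → E × E'} (hv : SmoothMap v) : SmoothMap fun θ => (v θ).1 :=
  hv.clm (ContinuousLinearMap.fst ℝ E E')

theorem SmoothMap.snd {v : MBar p k → E × E'} (hv : SmoothMap v) : SmoothMap fun θ => (v θ).2 :=
  hv.clm (ContinuousLinearMap.snd ℝ E E')

theorem SmoothMap.add {v w : MBar p k → E} (hv : SmoothMap v) (hw : SmoothMap w) :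
    SmoothMap fun θ => v θ + w θ :=
  (hv.prodMk hw).comp (g := fun x : E × E => x.1 + x.2) contDiff_add

theorem SmoothMap.sub {v w : MBar p k → E} (hv : SmoothMap v) (hw : SmoothMap w) :
    SmoothMap fun θ => v θ - w θ :=
  (hv.prodMk hw).comp (g := fun x : E × E => x.1 - x.2) (contDiff_fst.sub contDiff_snd)

theorem SmoothMap.smul {h : MBar p k → ℝ} {v : MBar p k → E} (hh : SmoothMap h)
    (hv : SmoothMap v) : SmoothMap fun θ => h θ • v θ :=
  (hh.prodMk hv).comp (g := fun x : ℝ × E => x.1 • x.2) contDiff_smul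

theorem SmoothMap.rsmul (c : ℝ) {v : MBar p k → E} (hv : SmoothMap v) :
    SmoothMap fun θ => c • v θ :=
  (SmoothMap.const c).smul hv

theorem SmoothMap.bilin (B : E →L[ℝ] E' →L[ℝ] E'') {v : MBar p k → E} {w : MBar p k → E'}
    (hv : SmoothMap v) (hw : SmoothMap w) : SmoothMap fun θ => B (v θ) (w θ) :=
  (hv.prodMk hw).comp (g := fun x : E × E' => B x.1 x.2) (contDiff_fst.bilin B contDiff_snd)

theorem SmoothMap.mul {l m n : ℕ} {v : MBar p k → Matrix (Fin l) (Fin m) ℂ}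
    {w : MBar p k → Matrix (Fin m) (Fin n) ℂ} (hv : SmoothMap v) (hw : SmoothMap w) :
    SmoothMap fun θ => v θ * w θ :=
  hv.bilin (mulL l m n) hw

theorem SmoothMap.ct {m n : ℕ} {v : MBar p k → Matrix (Fin m) (Fin n) ℂ} (hv : SmoothMap v) :
    SmoothMap fun θ => (v θ)ᴴ :=
  hv.clm (ctL m n)

theorem SmoothMap.inv {n : ℕ} {v : MBar p k → Matrix (Fin n) (Fin n) ℂ} (hv : SmoothMap v)
    (hu : ∀ θ, IsUnit (v θ)) : SmoothMap fun θ => (v θ)⁻¹ :=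
  hv.comp_on (isOpen_isUnit n) (contDiffOn_matinv n) hu

/-- In finite dimension, smoothness can be tested with linear functionals. -/
theorem SmoothMap.of_functionals [FiniteDimensional ℝ E] {v : MBar p k → E}
    (h : ∀ l : E →ₗ[ℝ] ℝ, SmoothMap fun θ => l (v θ)) : SmoothMap v := by
  let b := Module.finBasis ℝ E
  have hv : v = fun θ => ∑ i, b.coord i (v θ) • b i := by
    funext θ
    exact (b.sum_repr (v θ)).symm
  have hs : ∀ s : Finset (Fin (Module.finrank ℝ E)), SmoothMap fun θ =>
      ∑ i ∈ s, b.coord i (v θ) • b i := by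
    intro s
    induction s using Finset.induction_on with
    | empty => simpa using SmoothMap.const (0 : E)
    | insert i s hi ih =>
      simp only [Finset.sum_insert hi]
      exact ((h _).smul (SmoothMap.const _)).add ih
  rw [hv]
  exact hs _

/-! ## Directional derivatives along curves -/

/-- `c` is a curve in `St_{p,k} × H⁺⁺_k` through `θ` with velocity `ξ`. -/
def IsCurve (c : ℝ → MBar p k) (θ : MBar p k) (ξ : Ambient p k) : Prop :=
  c 0 = θ ∧ HasDerivAt (fun t => (c t).1) ξ 0

/-- `d` is the derivative of `v` at `θ` in direction `ξ`. -/
def HasTDeriv (v : MBar p k → E) (θ : MBar p k) (ξ : Ambient p k) (d : E) : Prop :=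
  ∀ c : ℝ → MBar p k, IsCurve c θ ξ → HasDerivAt (fun t => v (c t)) d 0

theorem MBar.isUnit (θ : MBar p k) : IsUnit θ.1.2 := θ.2.2.isUnit

theorem IsCurve.tendsto {c : ℝ → MBar p k} {θ : MBar p k} {ξ : Ambient p k} (hc : IsCurve c θ ξ) :
    Filter.Tendsto c (𝓝 0) (𝓝 θ) := by
  rw [tendsto_subtype_rng]
  have := hc.2.continuousAt.tendsto
  rwa [hc.1] at this

/-- The differential of an extension depends on the extension, but along a curve that stays in the
manifold only the values on the manifold enter. This is how every local extension is brought into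
play. -/
theorem HasTDeriv.of_hasFDerivAt {v : MBar p k → E} {θ : MBar p k} {F : Ambient p k → E}
    {F' : Ambient p k →L[ℝ] E} (hF : HasFDerivAt F F' θ.1) (hv : ∀ᶠ θ' in 𝓝 θ, v θ' = F θ'.1)
    (ξ : Ambient p k) : HasTDeriv v θ ξ (F' ξ) := by
  intro c hc
  have h0 : (c 0).1 = θ.1 := congrArg Subtype.val hc.1
  have h1 : HasDerivAt (fun t => F (c t).1) (F' ξ) 0 := by
    refine HasFDerivAt.comp_hasDerivAt (0 : ℝ) (f := fun t => (c t).1) ?_ hc.2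
    rw [h0]; exact hF
  exact h1.congr_of_eventuallyEq (hc.tendsto.eventually hv)

theorem HasTDeriv.congr {v w : MBar p k → E} {θ : MBar p k} {ξ : Ambient p k} {d : E}
    (hv : HasTDeriv v θ ξ d) (h : ∀ᶠ θ' in 𝓝 θ, w θ' = v θ') : HasTDeriv w θ ξ d :=
  fun c hc => (hv c hc).congr_of_eventuallyEq (hc.tendsto.eventually h)

theorem hasTDeriv_val (θ : MBar p k) (ξ : Ambient p k) :
    HasTDeriv (fun θ : MBar p k => θ.1) θ ξ ξ := fun _ hc => hc.2

theorem HasTDeriv.clm {v : MBar p k → E} {θ : MBar p k} {ξ : Ambient p k} {d : E}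
    (hv : HasTDeriv v θ ξ d) (L : E →L[ℝ] E') : HasTDeriv (fun θ => L (v θ)) θ ξ (L d) :=
  fun c hc => L.hasFDerivAt.comp_hasDerivAt (0 : ℝ) (hv c hc)

theorem HasTDeriv.fst {v : MBar p k → E × E'} {θ : MBar p k} {ξ : Ambient p k} {d : E × E'}
    (hv : HasTDeriv v θ ξ d) : HasTDeriv (fun θ => (v θ).1) θ ξ d.1 :=
  hv.clm (ContinuousLinearMap.fst ℝ E E')

theorem HasTDeriv.snd {v : MBar p k → E × E'} {θ : MBar p k} {ξ : Ambient p k} {d : E × E'}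
    (hv : HasTDeriv v θ ξ d) : HasTDeriv (fun θ => (v θ).2) θ ξ d.2 :=
  hv.clm (ContinuousLinearMap.snd ℝ E E')

theorem HasTDeriv.prodMk {v : MBar p k → E} {w : MBar p k → E'} {θ : MBar p k} {ξ : Ambient p k}
    {d : E} {e : E'} (hv : HasTDeriv v θ ξ d) (hw : HasTDeriv w θ ξ e) :
    HasTDeriv (fun θ => (v θ, w θ)) θ ξ (d, e) :=
  fun c hc => (hv c hc).prodMk (hw c hc)

theorem hasTDeriv_const (e : E) (θ : MBar p k) (ξ : Ambient p k) :
    HasTDeriv (fun _ : MBar p k => e) θ ξ 0 := fun _ _ => hasDerivAt_const _ _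

theorem HasTDeriv.add {v w : MBar p k → E} {θ : MBar p k} {ξ : Ambient p k} {d e : E}
    (hv : HasTDeriv v θ ξ d) (hw : HasTDeriv w θ ξ e) :
    HasTDeriv (fun θ => v θ + w θ) θ ξ (d + e) := fun c hc => (hv c hc).add (hw c hc)

theorem HasTDeriv.sub {v w : MBar p k → E} {θ : MBar p k} {ξ : Ambient p k} {d e : E}
    (hv : HasTDeriv v θ ξ d) (hw : HasTDeriv w θ ξ e) :
    HasTDeriv (fun θ => v θ - w θ) θ ξ (d - e) := fun c hc => (hv c hc).sub (hw c hc)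

theorem HasTDeriv.rmul {v w : MBar p k → ℝ} {θ : MBar p k} {ξ : Ambient p k} {d e : ℝ}
    (hv : HasTDeriv v θ ξ d) (hw : HasTDeriv w θ ξ e) :
    HasTDeriv (fun θ => v θ * w θ) θ ξ (d * w θ + v θ * e) := fun c hc => by
  have := (hv c hc).mul (hw c hc)
  rwa [hc.1] at this

theorem HasTDeriv.smul {h : MBar p k → ℝ} {v : MBar p k → E} {θ : MBar p k} {ξ : Ambient p k}
    {a : ℝ} {d : E} (hh : HasTDeriv h θ ξ a) (hv : HasTDeriv v θ ξ d) :
    HasTDeriv (fun θ => h θ • v θ) θ ξ (a • v θ + h θ • d) := fun c hc => by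
  have := (hh c hc).smul (hv c hc)
  rw [hc.1, add_comm] at this
  exact this

theorem HasTDeriv.rsmul (a : ℝ) {v : MBar p k → E} {θ : MBar p k} {ξ : Ambient p k}
    {d : E} (hv : HasTDeriv v θ ξ d) : HasTDeriv (fun θ => a • v θ) θ ξ (a • d) :=
  fun c hc => (hv c hc).const_smul a

theorem HasTDeriv.mul {l m n : ℕ} {v : MBar p k → Matrix (Fin l) (Fin m) ℂ}
    {w : MBar p k → Matrix (Fin m) (Fin n) ℂ} {θ : MBar p k} {ξ : Ambient p k} {d e}
    (hv : HasTDeriv v θ ξ d) (hw : HasTDeriv w θ ξ e) :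
    HasTDeriv (fun θ => v θ * w θ) θ ξ (d * w θ + v θ * e) := fun c hc => by
  have := (hv c hc).matmul (hw c hc)
  rwa [hc.1] at this

theorem HasTDeriv.ct {m n : ℕ} {v : MBar p k → Matrix (Fin m) (Fin n) ℂ} {θ : MBar p k}
    {ξ : Ambient p k} {d} (hv : HasTDeriv v θ ξ d) : HasTDeriv (fun θ => (v θ)ᴴ) θ ξ dᴴ :=
  fun c hc => (hv c hc).matct

theorem HasTDeriv.reTrace {n : ℕ} {v : MBar p k → Matrix (Fin n) (Fin n) ℂ} {θ : MBar p k}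
    {ξ : Ambient p k} {d} (hv : HasTDeriv v θ ξ d) :
    HasTDeriv (fun θ => reTr n (v θ)) θ ξ (reTr n d) :=
  fun c hc => (hv c hc).reTrace

theorem HasTDeriv.inv {n : ℕ} {v : MBar p k → Matrix (Fin n) (Fin n) ℂ} {θ : MBar p k}
    {ξ : Ambient p k} {d} (hv : HasTDeriv v θ ξ d) (hu : ∀ θ, IsUnit (v θ)) :
    HasTDeriv (fun θ => (v θ)⁻¹) θ ξ (-((v θ)⁻¹ * d * (v θ)⁻¹)) := fun c hc => by
  have := (hv c hc).matinv fun s => hu (c s)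
  rwa [hc.1] at this

/-- One continuous linear map serves all directions; linearity of derivatives in the direction is
read off from it. -/
theorem SmoothMap.exists_hasTDeriv {v : MBar p k → E} (hv : SmoothMap v) (θ : MBar p k) :
    ∃ F' : Ambient p k →L[ℝ] E, ∀ ξ, HasTDeriv v θ ξ (F' ξ) := by
  obtain ⟨F, W, hW, hθ, hF, hFv⟩ := hv θ
  have hd : DifferentiableAt ℝ F θ.1 :=
    (hF.contDiffAt (hW.mem_nhds hθ)).differentiableAt (by simp)
  refine ⟨_, fun ξ => HasTDeriv.of_hasFDerivAt hd.hasFDerivAt ?_ ξ⟩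
  filter_upwards [(hW.preimage continuous_subtype_val).mem_nhds hθ] with θ' h using hFv θ' h

end Smooth

/-- Tangent vectors of the Stiefel manifold are given by skew-Hermitian matrices. -/
theorem exists_skew_mul_eq {U X : Matrix (Fin p) (Fin k) ℂ} (hU : Uᴴ * U = 1)
    (hX : Uᴴ * X + Xᴴ * U = 0) : ∃ A : Matrix (Fin p) (Fin p) ℂ, Aᴴ = -A ∧ A * U = X := by
  have hX' : Xᴴ * U = -(Uᴴ * X) := eq_neg_of_add_eq_zero_right hX
  -- X Uᴴ - U Xᴴ is skew-Hermitian but sends U to X - U (Xᴴ U). The last term, skew-Hermitian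
  -- because Xᴴ U is, repairs this.
  set A : Matrix (Fin p) (Fin p) ℂ := X * Uᴴ - U * Xᴴ + U * (Xᴴ * U) * Uᴴ with hA
  have hAs : Aᴴ = -A := by
    simp only [hA, hX', Matrix.conjTranspose_add, Matrix.conjTranspose_sub,
      Matrix.conjTranspose_mul, Matrix.conjTranspose_conjTranspose, Matrix.mul_neg,
      Matrix.neg_mul, Matrix.conjTranspose_neg]
    simp only [← Matrix.mul_assoc]
    abel
  have hAU : A * U = X := by
    simp only [hA, Matrix.add_mul, Matrix.sub_mul, Matrix.mul_assoc, hU, Matrix.mul_one]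
    abel
  exact ⟨A, hAs, hAU⟩

/-- Every tangent vector is the velocity of a curve. -/
theorem exists_curve (θ : MBar p k) {ξ : Ambient p k} (hξ : ξ ∈ TBar θ.1) :
    ∃ c, IsCurve c θ ξ := by
  obtain ⟨⟨U, S⟩, hU, hS⟩ := θ
  obtain ⟨X, Y⟩ := ξ
  obtain ⟨hX, hY⟩ := hξ
  simp only at hU hS hX hY
  obtain ⟨A, hAs, hAU⟩ := exists_skew_mul_eq hU hX
  -- Chosen so that B S + S Bᴴ = Y, the velocity at 0 of exp(tB) S exp(tB)ᴴ.
  set B : Matrix (Fin k) (Fin k) ℂ := (1 / 2 : ℂ) • (Y * S⁻¹) with hB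
  have hdet : IsUnit S.det := (Matrix.isUnit_iff_isUnit_det _).1 hS.isUnit
  have hSh : Sᴴ = S := hS.isHermitian
  have hBS : B * S + S * Bᴴ = Y := by
    simp only [hB, Matrix.conjTranspose_smul, Matrix.conjTranspose_mul, hY,
      Matrix.conjTranspose_nonsing_inv, hSh, Matrix.smul_mul, Matrix.mul_smul, Matrix.mul_assoc,
      Matrix.nonsing_inv_mul _ hdet, Matrix.mul_nonsing_inv_cancel_left _ _ hdet, Matrix.mul_one]
    have : star (1 / 2 : ℂ) = 1 / 2 := by simp
    rw [this, ← add_smul]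
    norm_num
  have hE : ∀ t : ℝ, (NormedSpace.exp (t • A))ᴴ * NormedSpace.exp (t • A) = 1 := by
    intro t
    rw [← Matrix.exp_conjTranspose, Matrix.conjTranspose_smul, hAs, star_trivial, smul_neg,
      Matrix.exp_neg]
    exact Matrix.nonsing_inv_mul _ ((Matrix.isUnit_iff_isUnit_det _).1 (Matrix.isUnit_exp _))
  -- exp(tA) is unitary, so the columns stay orthonormal; congruence by the invertible exp(tB)
  -- preserves positive definiteness.
  refine ⟨fun t => ⟨(NormedSpace.exp (t • A) * U,
    NormedSpace.exp (t • B) * S * (NormedSpace.exp (t • B))ᴴ), ?_, ?_⟩, ?_, ?_⟩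
  · calc (NormedSpace.exp (t • A) * U)ᴴ * (NormedSpace.exp (t • A) * U)
        = Uᴴ * ((NormedSpace.exp (t • A))ᴴ * NormedSpace.exp (t • A)) * U := by
          simp only [Matrix.conjTranspose_mul, Matrix.mul_assoc]
      _ = 1 := by rw [hE, Matrix.mul_one, hU]
  · refine hS.mul_mul_conjTranspose_same ?_
    exact Matrix.vecMul_injective_iff_isUnit.2 (Matrix.isUnit_exp _)
  · apply Subtype.ext
    simp
  · have h1 := (hasDerivAt_exp_smul p A).matmul (hasDerivAt_const (0 : ℝ) U)
    have h2 := ((hasDerivAt_exp_smul k B).matmul (hasDerivAt_const (0 : ℝ) S)).matmul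
      (hasDerivAt_exp_smul k B).matct
    have h3 := h1.prodMk h2
    refine h3.congr_deriv ?_
    simp [hAU, hBS]

/-! ### Derivatives in tangent directions and their commutation -/

section Unique

variable {E : Type*} [NormedAddCommGroup E] [NormedSpace ℝ E]

/-- Tangency of ξ is essential: without a curve of velocity ξ, `HasTDeriv` is vacuous. -/
theorem HasTDeriv.unique {v : MBar p k → E} {θ : MBar p k} {ξ : Ambient p k} {d e : E}
    (hξ : ξ ∈ TBar θ.1) (hd : HasTDeriv v θ ξ d) (he : HasTDeriv v θ ξ e) : d = e := by
  obtain ⟨c, hc⟩ := exists_curve θ hξ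
  exact (hd c hc).unique (he c hc)

open Classical in
/-- The derivative of `v` at `θ` in the direction `ξ`. -/
def tderiv (v : MBar p k → E) (θ : MBar p k) (ξ : Ambient p k) : E :=
  if h : ∃ d, HasTDeriv v θ ξ d then Classical.choose h else 0

theorem SmoothMap.hasTDeriv {v : MBar p k → E} (hv : SmoothMap v) (θ : MBar p k)
    (ξ : Ambient p k) : HasTDeriv v θ ξ (tderiv v θ ξ) := by
  obtain ⟨F', hF'⟩ := hv.exists_hasTDeriv θ
  have h : ∃ d, HasTDeriv v θ ξ d := ⟨_, hF' ξ⟩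
  rw [tderiv, dif_pos h]
  exact Classical.choose_spec h

theorem HasTDeriv.tderiv_eq {v : MBar p k → E} {θ : MBar p k} {ξ : Ambient p k} {d : E}
    (hd : HasTDeriv v θ ξ d) (hξ : ξ ∈ TBar θ.1) : tderiv v θ ξ = d := by
  have h : ∃ d, HasTDeriv v θ ξ d := ⟨_, hd⟩
  rw [tderiv, dif_pos h]
  exact (Classical.choose_spec h).unique hξ hd

theorem SmoothMap.tderiv_linear {v : MBar p k → E} (hv : SmoothMap v) (θ : MBar p k) :
    ∃ F' : Ambient p k →L[ℝ] E, ∀ ξ ∈ TBar θ.1, tderiv v θ ξ = F' ξ := by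
  obtain ⟨F', hF'⟩ := hv.exists_hasTDeriv θ
  exact ⟨F', fun ξ hξ => (hF' ξ).tderiv_eq hξ⟩

/-- The derivative of a smooth map along a smooth field of tangent vectors is smooth. -/
theorem SmoothMap.tderiv {v : MBar p k → E} {w : MBar p k → Ambient p k} (hv : SmoothMap v)
    (hw : SmoothMap w) (hwT : ∀ θ, w θ ∈ TBar θ.1) : SmoothMap fun θ => tderiv v θ (w θ) := by
  intro θ
  obtain ⟨F, W, hW, hθ, hF, hFv⟩ := hv θ
  obtain ⟨F', W', hW', hθ', hF', hFw⟩ := hw θ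
  refine ⟨fun x => fderiv ℝ F x (F' x), W ∩ W', hW.inter hW', ⟨hθ, hθ'⟩, ?_, fun θ' h => ?_⟩
  · exact ((hF.fderiv_of_isOpen hW (by simp)).mono Set.inter_subset_left).clm_apply
      (hF'.mono Set.inter_subset_right)
  · beta_reduce
    rw [← hFw θ' h.2]
    have hd : DifferentiableAt ℝ F θ'.1 :=
      (hF.contDiffAt (hW.mem_nhds h.1)).differentiableAt (by simp)
    refine (HasTDeriv.of_hasFDerivAt hd.hasFDerivAt ?_ _).tderiv_eq (hwT θ')
    filter_upwards [(hW.preimage continuous_subtype_val).mem_nhds h.1] with x hx using hFv x hx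

theorem _root_.ContDiffAt.fderiv_apply_const {A : Type*} [NormedAddCommGroup A]
    [NormedSpace ℝ A] {m n : WithTop ℕ∞} {F : A → E} {x : A} (hF : ContDiffAt ℝ n F x)
    (hmn : m + 1 ≤ n) (a : A) : ContDiffAt ℝ m (fun y => fderiv ℝ F y a) x :=
  (hF.fderiv_right hmn).clm_apply contDiffAt_const

/-- `D2` is the second derivative, symmetric by Schwarz. The curve `y` will be a vector field
restricted to the curve `c`, so no ambient extension of that field has to be differentiated. -/
theorem _root_.ContDiffAt.exists_symm_second_deriv {A : Type*} [NormedAddCommGroup A]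
    [NormedSpace ℝ A] {F : A → E} {x : A} (hF : ContDiffAt ℝ ∞ F x) :
    ∃ D2 : A → A → E, (∀ ξ η, D2 ξ η = D2 η ξ) ∧ ∀ (c y : ℝ → A) (ξ η : A), c 0 = x →
      HasDerivAt c ξ 0 → HasDerivAt y η 0 →
      HasDerivAt (fun t => fderiv ℝ F (c t) (y t)) (D2 ξ (y 0) + fderiv ℝ F x η) 0 := by
  have hF2 : HasFDerivAt (fderiv ℝ F) (fderiv ℝ (fderiv ℝ F) x) x :=
    ((hF.fderiv_right (m := 1) (by norm_cast)).differentiableAt (by simp)).hasFDerivAt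
  have hs : IsSymmSndFDerivAt ℝ F x := hF.isSymmSndFDerivAt (by simp; norm_cast)
  refine ⟨fun ξ η => fderiv ℝ (fderiv ℝ F) x ξ η, fun ξ η => hs.eq ξ η, ?_⟩
  rintro c y ξ η rfl hc hy
  exact (hF2.comp_hasDerivAt (0 : ℝ) hc).clm_apply hy

/-- Derivatives commute up to the bracket: `V (W v) - W (V v) = D v [D W[V] - D V[W]]`. -/
theorem SmoothMap.tderiv_tderiv_sub {v : MBar p k → E} {V W : MBar p k → Ambient p k}
    (hv : SmoothMap v) (hV : SmoothMap V) (hW : SmoothMap W) (hVT : ∀ θ, V θ ∈ TBar θ.1)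
    (hWT : ∀ θ, W θ ∈ TBar θ.1) (θ : MBar p k) :
    ∃ F' : Ambient p k →L[ℝ] E, (∀ ξ, HasTDeriv v θ ξ (F' ξ)) ∧
      FixedRank.tderiv (fun θ => FixedRank.tderiv v θ (W θ)) θ (V θ)
        - FixedRank.tderiv (fun θ => FixedRank.tderiv v θ (V θ)) θ (W θ)
      = F' (FixedRank.tderiv W θ (V θ) - FixedRank.tderiv V θ (W θ)) := by
  obtain ⟨F, O, hO, hθ, hF, hFv⟩ := hv θ
  have hev : ∀ θ' : MBar p k, θ'.1 ∈ O → ∀ ξ, HasTDeriv v θ' ξ (fderiv ℝ F θ'.1 ξ) := by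
    intro θ' h ξ
    have hd : DifferentiableAt ℝ F θ'.1 :=
      (hF.contDiffAt (hO.mem_nhds h)).differentiableAt (by simp)
    refine HasTDeriv.of_hasFDerivAt hd.hasFDerivAt ?_ _
    filter_upwards [(hO.preimage continuous_subtype_val).mem_nhds h] with x hx using hFv x hx
  have hFc := hF.contDiffAt (hO.mem_nhds hθ)
  obtain ⟨D2, hsymm, hD2⟩ := hFc.exists_symm_second_deriv
  -- X(Y v) = D²v[X, Y] + Dv[DY[X]]. The second-order terms cancel in the commutator.
  have key : ∀ X Y : MBar p k → Ambient p k, SmoothMap X → SmoothMap Y →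
      (∀ θ, X θ ∈ TBar θ.1) → (∀ θ, Y θ ∈ TBar θ.1) →
      FixedRank.tderiv (fun θ => FixedRank.tderiv v θ (Y θ)) θ (X θ)
        = D2 (X θ) (Y θ)
          + fderiv ℝ F θ.1 (FixedRank.tderiv Y θ (X θ)) := by
    intro X Y hX hY hXT hYT
    refine HasTDeriv.tderiv_eq ?_ (hXT θ)
    have h2 : HasTDeriv (fun θ : MBar p k => fderiv ℝ F θ.1 (Y θ)) θ (X θ)
        (D2 (X θ) (Y θ)
          + fderiv ℝ F θ.1 (FixedRank.tderiv Y θ (X θ))) := fun c hc => by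
      have := hD2 (fun t => (c t).1) (fun t => Y (c t)) _ _ (congrArg Subtype.val hc.1) hc.2
        (hY.hasTDeriv θ (X θ) c hc)
      simp only [hc.1] at this
      exact this
    refine h2.congr ?_
    filter_upwards [(hO.preimage continuous_subtype_val).mem_nhds hθ] with x hx
    exact (hev x hx _).tderiv_eq (hYT x)
  refine ⟨fderiv ℝ F θ.1, hev θ hθ, ?_⟩
  rw [key V W hV hW hVT hWT, key W V hW hV hWT hVT, hsymm (V θ) (W θ), map_sub]
  abel

end Unique

end

end FixedRank

namespace FixedRank

noncomputable section

variable {p k : ℕ}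

/-! ## Traces -/

/-- The formulas use the complex scalar 1/2, while the calculus is only ℝ-linear. -/
theorem half_smul {m n : ℕ} (A : Matrix (Fin m) (Fin n) ℂ) :
    (1 / 2 : ℂ) • A = (1 / 2 : ℝ) • A := by
  rw [← Complex.coe_smul]; norm_num

theorem herm_eq {n : ℕ} (A : Matrix (Fin n) (Fin n) ℂ) : herm A = (1 / 2 : ℝ) • (A + Aᴴ) :=
  half_smul _

theorem skewh_eq {n : ℕ} (A : Matrix (Fin n) (Fin n) ℂ) : skewh A = (1 / 2 : ℝ) • (A - Aᴴ) :=
  half_smul _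

theorem conjTranspose_herm {n : ℕ} (A : Matrix (Fin n) (Fin n) ℂ) : (herm A)ᴴ = herm A := by
  simp [herm_eq, Matrix.conjTranspose_smul, add_comm]

theorem reTr_ct {n : ℕ} (A : Matrix (Fin n) (Fin n) ℂ) : reTr n Aᴴ = reTr n A := by
  simp [Matrix.trace_conjTranspose]

theorem reTr_comm {m n : ℕ} (A : Matrix (Fin m) (Fin n) ℂ) (B : Matrix (Fin n) (Fin m) ℂ) :
    reTr m (A * B) = reTr n (B * A) := by
  simp [Matrix.trace_mul_comm A B]

/-- Passing to the conjugate transpose changes the sign of the product up to cyclic order, so its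
trace is purely imaginary. This vanishing removes the unwanted terms in both the connection and the
gradient. -/
theorem reTr_herm_mul_skew {n : ℕ} {S c : Matrix (Fin n) (Fin n) ℂ} (hS : Sᴴ = S) (hc : cᴴ = -c) :
    reTr n (S * c) = 0 := by
  have h := reTr_ct (S * c)
  rw [Matrix.conjTranspose_mul, hS, hc, reTr_comm, Matrix.mul_neg, map_neg] at h
  linarith

theorem reTr_self_nonneg {m n : ℕ} (A : Matrix (Fin m) (Fin n) ℂ) : 0 ≤ reTr n (Aᴴ * A) :=
  (Complex.nonneg_iff.1 (Matrix.posSemidef_conjTranspose_mul_self A).trace_nonneg).1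

theorem eq_zero_of_reTr_self {m n : ℕ} {A : Matrix (Fin m) (Fin n) ℂ} (h : reTr n (Aᴴ * A) = 0) :
    A = 0 := by
  have h2 := Complex.nonneg_iff.1 (Matrix.posSemidef_conjTranspose_mul_self A).trace_nonneg
  exact Matrix.trace_conjTranspose_mul_self_eq_zero_iff.1 (Complex.ext h h2.2.symm)

/-- Cauchy–Schwarz against the identity matrix. The factor n is what leads to the bound β > -α/k. -/
theorem sq_reTr_le {n : ℕ} {Y : Matrix (Fin n) (Fin n) ℂ} :
    (reTr n Y) ^ 2 ≤ n * reTr n (Yᴴ * Y) := by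
  have h1 : reTr n Y = ∑ i, (Y i i).re := by simp [Matrix.trace]
  have h2 : reTr n (Yᴴ * Y) = ∑ i, ∑ j, ((Y j i).re ^ 2 + (Y j i).im ^ 2) := by
    simp only [reTr_apply, Matrix.trace, Complex.re_sum, Matrix.diag_apply, Matrix.mul_apply,
      Matrix.conjTranspose_apply]
    refine Finset.sum_congr rfl fun i _ => Finset.sum_congr rfl fun j _ => ?_
    simp [Complex.mul_re]; ring
  rw [h1, h2]
  have h3 := sq_sum_le_card_mul_sum_sq (s := Finset.univ) (f := fun i => (Y i i).re)
  rw [Finset.card_univ, Fintype.card_fin] at h3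
  refine h3.trans (mul_le_mul_of_nonneg_left ?_ (Nat.cast_nonneg n))
  refine Finset.sum_le_sum fun i _ => ?_
  have h4 : (Y i i).re ^ 2 + (Y i i).im ^ 2 ≤ ∑ j, ((Y j i).re ^ 2 + (Y j i).im ^ 2) :=
    Finset.single_le_sum (f := fun j => (Y j i).re ^ 2 + (Y j i).im ^ 2) (s := Finset.univ)
      (fun j _ => by positivity) (Finset.mem_univ i)
  have h5 : 0 ≤ (Y i i).im ^ 2 := sq_nonneg _
  linarith

open scoped MatrixOrder in
theorem _root_.Matrix.PosDef.exists_eq_conjTranspose_mul_self {n : ℕ}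
    {S : Matrix (Fin n) (Fin n) ℂ} (hS : S.PosDef) : ∃ y : Matrix (Fin n) (Fin n) ℂ, S = yᴴ * y :=
  CStarAlgebra.nonneg_iff_eq_star_mul_self.mp hS.posSemidef.nonneg

/-! ## The metric -/

theorem metricBar_eq (α β : ℝ) (θ ξ η : Ambient p k) :
    metricBar α β θ ξ η = reTr k (ξ.1ᴴ * η.1) - 1 / 2 * reTr k (ξ.1ᴴ * θ.1 * (θ.1ᴴ * η.1))
      + α * reTr k (θ.2⁻¹ * ξ.2 * (θ.2⁻¹ * η.2))
      + β * reTr k (θ.2⁻¹ * ξ.2) * reTr k (θ.2⁻¹ * η.2) := by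
  have h : ξ.1ᴴ * (1 - (1 / 2 : ℂ) • (θ.1 * θ.1ᴴ)) * η.1
      = ξ.1ᴴ * η.1 - (1 / 2 : ℝ) • (ξ.1ᴴ * θ.1 * (θ.1ᴴ * η.1)) := by
    simp only [half_smul, Matrix.mul_sub, Matrix.sub_mul, Matrix.mul_one, Matrix.mul_smul,
      Matrix.smul_mul, Matrix.mul_assoc]
  have h' : θ.2⁻¹ * ξ.2 * θ.2⁻¹ * η.2 = θ.2⁻¹ * ξ.2 * (θ.2⁻¹ * η.2) := Matrix.mul_assoc _ _ _
  unfold metricBar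
  rw [h, h', ← reTr_apply, map_sub, map_smul, smul_eq_mul]
  rfl

theorem metricBar_symm (α β : ℝ) (θ ξ η : Ambient p k) :
    metricBar α β θ ξ η = metricBar α β θ η ξ := by
  have h1 := reTr_ct (ξ.1ᴴ * η.1)
  have h2 := reTr_ct (ξ.1ᴴ * θ.1 * (θ.1ᴴ * η.1))
  have h3 := reTr_comm (θ.2⁻¹ * ξ.2) (θ.2⁻¹ * η.2)
  simp only [Matrix.conjTranspose_mul, Matrix.conjTranspose_conjTranspose] at h1 h2
  rw [metricBar_eq, metricBar_eq, h1, h2, h3]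
  ring

theorem metricBar_add_left (α β : ℝ) (θ ξ ξ' η : Ambient p k) :
    metricBar α β θ (ξ + ξ') η = metricBar α β θ ξ η + metricBar α β θ ξ' η := by
  simp only [metricBar_eq, Prod.fst_add, Prod.snd_add, Matrix.conjTranspose_add, Matrix.add_mul,
    Matrix.mul_add, map_add]
  ring

theorem metricBar_smul_left (α β : ℝ) (θ : Ambient p k) (c : ℝ) (ξ η : Ambient p k) :
    metricBar α β θ (c • ξ) η = c * metricBar α β θ ξ η := by
  simp only [metricBar_eq, Prod.smul_fst, Prod.smul_snd, Matrix.conjTranspose_smul, star_trivial,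
    Matrix.smul_mul, Matrix.mul_smul, map_smul, smul_eq_mul]
  ring

theorem metricBar_add_right (α β : ℝ) (θ ξ η η' : Ambient p k) :
    metricBar α β θ ξ (η + η') = metricBar α β θ ξ η + metricBar α β θ ξ η' := by
  rw [metricBar_symm, metricBar_add_left, metricBar_symm, metricBar_symm α β θ η']

theorem metricBar_sub_left (α β : ℝ) (θ ξ ξ' η : Ambient p k) :
    metricBar α β θ (ξ - ξ') η = metricBar α β θ ξ η - metricBar α β θ ξ' η := by
  have := metricBar_add_left α β θ (ξ - ξ') ξ' η
  rw [sub_add_cancel] at this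
  linarith

/-- The U-part of the norm equals (|X|² + |X - U Uᴴ X|²)/2. For the Σ-part, write S⁻¹ = yᴴ y; then Z
= y Y yᴴ is Hermitian and the contribution is α |Z|² + β (tr Z)², bounded below by a positive
multiple of |Z|². -/
theorem metricBar_self_pos {α β : ℝ} (hk : 0 < k) (hα : 0 < α) (hβ : -(α / k) < β) (θ : MBar p k)
    {ξ : Ambient p k} (hξ : ξ ∈ TBar θ.1) (h0 : metricBar α β θ.1 ξ ξ = 0) : ξ = 0 := by
  obtain ⟨⟨U, S⟩, hU, hS⟩ := θ
  obtain ⟨X, Y⟩ := ξ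
  obtain ⟨hX, hY⟩ := hξ
  simp only at hU hS hX hY
  rw [metricBar_eq] at h0
  simp only at h0
  set A := X - U * (Uᴴ * X) with hA
  have hAA : Aᴴ * A = Xᴴ * X - Xᴴ * U * (Uᴴ * X) := by
    have hUr : ∀ Z : Matrix (Fin k) (Fin k) ℂ, Uᴴ * (U * Z) = Z := fun Z => by
      rw [← Matrix.mul_assoc, hU, Matrix.one_mul]
    simp only [hA, Matrix.conjTranspose_sub, Matrix.conjTranspose_mul,
      Matrix.conjTranspose_conjTranspose, Matrix.sub_mul, Matrix.mul_sub, Matrix.mul_assoc, hUr]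
    abel
  have hA0 := reTr_self_nonneg A
  have hX0 := reTr_self_nonneg X
  rw [hAA, map_sub] at hA0
  obtain ⟨y, hy⟩ := hS.inv.exists_eq_conjTranspose_mul_self
  set Z := y * Y * yᴴ with hZ
  have hZh : Zᴴ = Z := by
    simp only [hZ, Matrix.conjTranspose_mul, Matrix.conjTranspose_conjTranspose, hY,
      Matrix.mul_assoc]
  have h1 : reTr k (S⁻¹ * Y) = reTr k Z := by
    rw [hy, Matrix.mul_assoc, reTr_comm]
  have h2 : reTr k (S⁻¹ * Y * (S⁻¹ * Y)) = reTr k (Zᴴ * Z) := by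
    rw [hZh, hy, hZ, Matrix.mul_assoc, Matrix.mul_assoc, reTr_comm]
    simp only [Matrix.mul_assoc]
  have hZ0 := reTr_self_nonneg Z
  have hcs := sq_reTr_le (Y := Z)
  rw [h1, h2] at h0
  have hk' : (0 : ℝ) < k := Nat.cast_pos.2 hk
  have hβ' : 0 < α + k * β := by
    have := mul_lt_mul_of_pos_left hβ hk'
    rw [mul_neg, mul_div_cancel₀ _ hk'.ne'] at this
    linarith
  -- For β ≥ 0 the β-term can be dropped; for β ≤ 0 the inequality (tr Z)² ≤ k |Z|² leaves the
  -- constant α + kβ.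
  obtain ⟨c, hc, hcle⟩ : ∃ c : ℝ, 0 < c ∧
      c * reTr k (Zᴴ * Z) ≤ α * reTr k (Zᴴ * Z) + β * reTr k Z * reTr k Z := by
    rcases le_total 0 β with hb | hb
    · refine ⟨α, hα, ?_⟩
      have := mul_nonneg hb (mul_self_nonneg (reTr k Z))
      linarith
    · refine ⟨α + k * β, hβ', ?_⟩
      have := mul_le_mul_of_nonpos_left hcs hb
      nlinarith
  have hcZ := mul_nonneg hc.le hZ0
  have hXz : X = 0 := eq_zero_of_reTr_self (by linarith)
  have hZz : Z = 0 := by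
    refine eq_zero_of_reTr_self ?_
    have : c * reTr k (Zᴴ * Z) = 0 := by linarith
    exact (mul_eq_zero.1 this).resolve_left hc.ne'
  have hdet : IsUnit S.det := (Matrix.isUnit_iff_isUnit_det _).1 hS.isUnit
  have hYz : Y = 0 := by
    have h3 : S⁻¹ * Y * S⁻¹ = 0 := by
      calc S⁻¹ * Y * S⁻¹ = yᴴ * Z * y := by rw [hy, hZ]; simp only [Matrix.mul_assoc]
        _ = 0 := by rw [hZz]; simp
    calc Y = S * (S⁻¹ * Y * S⁻¹) * S := by
          simp only [Matrix.mul_assoc, Matrix.nonsing_inv_mul _ hdet, Matrix.mul_one,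
            Matrix.mul_nonsing_inv_cancel_left _ _ hdet]
      _ = 0 := by rw [h3]; simp
  rw [hXz, hYz]; rfl

/-! ## The Christoffel term -/

/-- The quadratic term of the Levi-Civita connection. -/
def christoffel (θ v w : Ambient p k) : Ambient p k :=
  ((1 / 2 : ℝ) • (θ.1 * (θ.1ᴴ * v.1 * (θ.1ᴴ * w.1) + θ.1ᴴ * w.1 * (θ.1ᴴ * v.1)
        + v.1ᴴ * w.1 + w.1ᴴ * v.1) - (v.1 * (θ.1ᴴ * w.1) + w.1 * (θ.1ᴴ * v.1))),
    -(1 / 2 : ℝ) • (v.2 * (θ.2⁻¹ * w.2) + w.2 * (θ.2⁻¹ * v.2)))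

theorem christoffel_symm (θ v w : Ambient p k) : christoffel θ v w = christoffel θ w v := by
  simp only [christoffel]
  congr 2
  · congr 1
    · congr 1; abel
    · abel
  · abel

theorem christoffel_add_right (θ v w w' : Ambient p k) :
    christoffel θ v (w + w') = christoffel θ v w + christoffel θ v w' := by
  refine Prod.ext ?_ ?_
  · simp only [christoffel, Prod.fst_add, Matrix.conjTranspose_add, Matrix.mul_add, Matrix.add_mul]
    module
  · simp only [christoffel, Prod.snd_add, Matrix.mul_add, Matrix.add_mul]
    module

theorem christoffel_smul_right (θ v : Ambient p k) (c : ℝ) (w : Ambient p k) :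
    christoffel θ v (c • w) = c • christoffel θ v w := by
  refine Prod.ext ?_ ?_
  · simp only [christoffel, Prod.smul_fst, Matrix.conjTranspose_smul, Matrix.mul_smul,
      Matrix.smul_mul, star_trivial, Matrix.mul_add]
    module
  · simp only [christoffel, Prod.smul_snd, Matrix.mul_smul, Matrix.smul_mul]
    module

/-- The Christoffel term corrects the derivative of a tangent field to a tangent vector. -/
theorem add_christoffel_mem {θ : MBar p k} {v w d : Ambient p k} (hv : v ∈ TBar θ.1)
    (hw : w ∈ TBar θ.1)
    (hd : v.1ᴴ * w.1 + θ.1.1ᴴ * d.1 + (d.1ᴴ * θ.1.1 + w.1ᴴ * v.1) = 0) (hd2 : d.2ᴴ = d.2) :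
    d + christoffel θ.1 v w ∈ TBar θ.1 := by
  obtain ⟨⟨U, S⟩, hU, hS⟩ := θ
  obtain ⟨hv1, hv2⟩ := hv
  obtain ⟨hw1, hw2⟩ := hw
  simp only at hU hS hv1 hv2 hw1 hw2 hd
  have hv' : v.1ᴴ * U = -(Uᴴ * v.1) := eq_neg_of_add_eq_zero_right hv1
  have hw' : w.1ᴴ * U = -(Uᴴ * w.1) := eq_neg_of_add_eq_zero_right hw1
  have hSh : Sᴴ = S := hS.isHermitian
  constructor
  -- The product of Uᴴ with the Christoffel term is half of vᴴ w + wᴴ v. Adding its conjugate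
  -- transpose yields vᴴ w + wᴴ v, the defect recorded in `hd`, which is the differentiated tangency
  -- equation.
  · simp only [christoffel, Prod.fst_add, Matrix.conjTranspose_add, Matrix.conjTranspose_smul,
      Matrix.conjTranspose_sub, Matrix.conjTranspose_mul, Matrix.conjTranspose_conjTranspose,
      star_trivial, Matrix.mul_add, Matrix.add_mul, Matrix.mul_smul, Matrix.smul_mul,
      Matrix.mul_sub, Matrix.sub_mul]
    have e1 : ∀ Z : Matrix (Fin k) (Fin k) ℂ, Uᴴ * (U * Z) = Z := fun Z => by
      rw [← Matrix.mul_assoc, hU, Matrix.one_mul]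
    simp only [Matrix.mul_assoc, e1, hU, Matrix.mul_one, hv', hw', Matrix.mul_neg]
    rw [← hd]
    module
  · simp only [christoffel, Prod.snd_add, Matrix.conjTranspose_add, Matrix.conjTranspose_smul,
      Matrix.conjTranspose_mul, star_trivial, Matrix.conjTranspose_nonsing_inv, hSh, hv2, hw2, hd2,
      Matrix.mul_assoc]
    module

/-- The derivative of the coefficients of the metric. -/
def dmetric (α β : ℝ) (θ v w z : Ambient p k) : ℝ :=
  -(1 / 2) * (reTr k (w.1ᴴ * v.1 * (θ.1ᴴ * z.1)) + reTr k (w.1ᴴ * θ.1 * (v.1ᴴ * z.1)))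
    - α * (reTr k (θ.2⁻¹ * v.2 * (θ.2⁻¹ * w.2) * (θ.2⁻¹ * z.2))
      + reTr k (θ.2⁻¹ * w.2 * (θ.2⁻¹ * v.2) * (θ.2⁻¹ * z.2)))
    - β * (reTr k (θ.2⁻¹ * v.2 * (θ.2⁻¹ * w.2)) * reTr k (θ.2⁻¹ * z.2)
      + reTr k (θ.2⁻¹ * w.2) * reTr k (θ.2⁻¹ * v.2 * (θ.2⁻¹ * z.2)))

/-- With a = Uᴴ v and b = Uᴴ w, the matrices R = ab + ba and Q = vᴴ w + wᴴ v are Hermitian, so their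
pairings with the skew-Hermitian Uᴴ z vanish. Only the terms coming from v b + w a survive in the
U-part. -/
theorem metricBar_christoffel (α β : ℝ) {θ : MBar p k} {v w z : Ambient p k} (hv : v ∈ TBar θ.1)
    (hw : w ∈ TBar θ.1) (hz : z ∈ TBar θ.1) :
    metricBar α β θ.1 (christoffel θ.1 v w) z
      = 1 / 2 * (reTr k (θ.1.1ᴴ * w.1 * (v.1ᴴ * z.1)) + reTr k (θ.1.1ᴴ * v.1 * (w.1ᴴ * z.1)))
        - α / 2 * (reTr k (θ.1.2⁻¹ * v.2 * (θ.1.2⁻¹ * w.2) * (θ.1.2⁻¹ * z.2))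
          + reTr k (θ.1.2⁻¹ * w.2 * (θ.1.2⁻¹ * v.2) * (θ.1.2⁻¹ * z.2)))
        - β * (reTr k (θ.1.2⁻¹ * v.2 * (θ.1.2⁻¹ * w.2)) * reTr k (θ.1.2⁻¹ * z.2)) := by
  obtain ⟨⟨U, S⟩, hU, hS⟩ := θ
  obtain ⟨hv1, hv2⟩ := hv
  obtain ⟨hw1, hw2⟩ := hw
  obtain ⟨hz1, hz2⟩ := hz
  simp only at hU hS hv1 hv2 hw1 hw2 hz1 hz2
  have hv' : v.1ᴴ * U = -(Uᴴ * v.1) := eq_neg_of_add_eq_zero_right hv1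
  have hw' : w.1ᴴ * U = -(Uᴴ * w.1) := eq_neg_of_add_eq_zero_right hw1
  have hz' : (Uᴴ * z.1)ᴴ = -(Uᴴ * z.1) := by
    rw [Matrix.conjTranspose_mul, Matrix.conjTranspose_conjTranspose,
      eq_neg_of_add_eq_zero_right hz1]
  set a := Uᴴ * v.1 with ha
  set b := Uᴴ * w.1 with hb
  set c := Uᴴ * z.1 with hc
  have ha' : aᴴ = -a := by
    rw [ha, Matrix.conjTranspose_mul, Matrix.conjTranspose_conjTranspose, hv']
  have hb' : bᴴ = -b := by
    rw [hb, Matrix.conjTranspose_mul, Matrix.conjTranspose_conjTranspose, hw']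
  set Q := v.1ᴴ * w.1 + w.1ᴴ * v.1 with hQ
  have hQh : Qᴴ = Q := by
    simp only [hQ, Matrix.conjTranspose_add, Matrix.conjTranspose_mul,
      Matrix.conjTranspose_conjTranspose]
    abel
  set R := a * b + b * a with hR
  have hRh : Rᴴ = R := by
    simp only [hR, Matrix.conjTranspose_add, Matrix.conjTranspose_mul, ha', hb', Matrix.neg_mul,
      Matrix.mul_neg, neg_neg]
    abel
  have hG1 : (christoffel (U, S) v w).1 = (1 / 2 : ℝ) • (U * (R + Q) - (v.1 * b + w.1 * a)) := by
    simp only [christoffel, hQ, hR, ← ha, ← hb, add_assoc]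
  have hGh : (christoffel (U, S) v w).1ᴴ
      = (1 / 2 : ℝ) • ((R + Q) * Uᴴ + b * v.1ᴴ + a * w.1ᴴ) := by
    rw [hG1]
    simp only [Matrix.conjTranspose_smul, Matrix.conjTranspose_sub, Matrix.conjTranspose_mul,
      Matrix.conjTranspose_add, hRh, hQh, ha', hb', star_trivial, Matrix.neg_mul]
    module
  have hGU : (christoffel (U, S) v w).1ᴴ * U = (1 / 2 : ℝ) • Q := by
    rw [hGh]
    simp only [Matrix.smul_mul, Matrix.add_mul, Matrix.mul_assoc, hU, Matrix.mul_one, hv', hw',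
      Matrix.mul_neg, hR]
    module
  have hG2 : S⁻¹ * (christoffel (U, S) v w).2
      = -(1 / 2 : ℝ) • (S⁻¹ * v.2 * (S⁻¹ * w.2) + S⁻¹ * w.2 * (S⁻¹ * v.2)) := by
    simp only [christoffel, Matrix.mul_smul, Matrix.mul_add, Matrix.mul_assoc]
  have hQc := reTr_herm_mul_skew hQh hz'
  have hRc := reTr_herm_mul_skew hRh hz'
  rw [metricBar_eq]
  simp only [hGU, hG2]
  rw [hGh]
  simp only [Matrix.smul_mul, Matrix.add_mul, map_add, map_smul, smul_eq_mul, Matrix.mul_assoc,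
    ← hc, hQc, hRc]
  have hcomm := reTr_comm (S⁻¹ * w.2) (S⁻¹ * v.2)
  simp only [Matrix.mul_assoc] at hcomm
  rw [hcomm]
  ring

/-- Compatibility of the Christoffel term with the metric. -/
theorem dmetric_eq (α β : ℝ) {θ : MBar p k} {v w z : Ambient p k} (hv : v ∈ TBar θ.1)
    (hw : w ∈ TBar θ.1) (hz : z ∈ TBar θ.1) :
    dmetric α β θ.1 v w z = metricBar α β θ.1 (christoffel θ.1 v w) z
      + metricBar α β θ.1 w (christoffel θ.1 v z) := by
  rw [metricBar_symm α β θ.1 w, metricBar_christoffel α β hv hw hz,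
    metricBar_christoffel α β hv hz hw, dmetric]
  obtain ⟨⟨U, S⟩, hU, hS⟩ := θ
  obtain ⟨hv1, hv2⟩ := hv
  obtain ⟨hw1, hw2⟩ := hw
  obtain ⟨hz1, hz2⟩ := hz
  simp only at hU hS hv1 hv2 hw1 hw2 hz1 hz2 ⊢
  have hw' : w.1ᴴ * U = -(Uᴴ * w.1) := eq_neg_of_add_eq_zero_right hw1
  have hct : ∀ x : Matrix (Fin p) (Fin k) ℂ, Uᴴ * x + xᴴ * U = 0 → (Uᴴ * x)ᴴ = -(Uᴴ * x) := by
    intro x hx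
    rw [Matrix.conjTranspose_mul, Matrix.conjTranspose_conjTranspose,
      eq_neg_of_add_eq_zero_right hx]
  -- Uᴴ v being skew-Hermitian, its terms are antisymmetric under exchange of w and z and cancel in
  -- the sum. The next identity turns a remaining term into one of `dmetric`.
  have h1 : reTr k (Uᴴ * v.1 * (z.1ᴴ * w.1)) = -reTr k (Uᴴ * v.1 * (w.1ᴴ * z.1)) := by
    rw [← reTr_ct, Matrix.conjTranspose_mul, hct _ hv1, Matrix.conjTranspose_mul,
      Matrix.conjTranspose_conjTranspose, reTr_comm, Matrix.neg_mul, map_neg]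
  have h2 : reTr k (Uᴴ * z.1 * (v.1ᴴ * w.1)) = -reTr k (w.1ᴴ * v.1 * (Uᴴ * z.1)) := by
    rw [← reTr_ct, Matrix.conjTranspose_mul, hct _ hz1, Matrix.conjTranspose_mul,
      Matrix.conjTranspose_conjTranspose, Matrix.mul_neg, map_neg]
  have h3 := reTr_comm (S⁻¹ * v.2 * (S⁻¹ * z.2)) (S⁻¹ * w.2)
  have h4 := reTr_comm (S⁻¹ * z.2) (S⁻¹ * v.2 * (S⁻¹ * w.2))
  rw [← Matrix.mul_assoc (S⁻¹ * w.2)] at h3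
  rw [← Matrix.mul_assoc] at h4
  rw [h1, h2, h3, h4, hw', Matrix.neg_mul, map_neg]
  ring

/-! ## The gradient -/

theorem gradFormula_mem (α β : ℝ) (θ : MBar p k) (G : Ambient p k) :
    gradFormula α β θ.1 G ∈ TBar θ.1 := by
  obtain ⟨⟨U, S⟩, hU, hS⟩ := θ
  simp only at hU hS
  have hSh : Sᴴ = S := hS.isHermitian
  constructor
  · simp only [gradFormula, Matrix.conjTranspose_sub, Matrix.conjTranspose_mul,
      Matrix.conjTranspose_conjTranspose, Matrix.mul_sub, Matrix.sub_mul]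
    simp only [← Matrix.mul_assoc, hU, Matrix.one_mul]
    simp only [Matrix.mul_assoc, hU, Matrix.mul_one]
    abel
  · simp only [gradFormula, Matrix.conjTranspose_sub, Matrix.conjTranspose_smul,
      Matrix.conjTranspose_mul, hSh, conjTranspose_herm, star_trivial, Matrix.mul_assoc]

/-- In the U-part the discrepancy is half the pairing of the Hermitian matrix Uᴴ G + Gᴴ U with the
skew-Hermitian Uᴴ η. In the Σ-part only herm(G) is seen by the Hermitian η, and the multiple of Σ
compensates the β-term. -/
theorem metricBar_gradFormula {α β : ℝ} (hk : 0 < k) (hα : 0 < α) (hβ : -(α / k) < β)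
    (θ : MBar p k) (G : Ambient p k) {η : Ambient p k} (hη : η ∈ TBar θ.1) :
    metricBar α β θ.1 (gradFormula α β θ.1 G) η = euclInner G η := by
  obtain ⟨⟨U, S⟩, hU, hS⟩ := θ
  obtain ⟨h1, h2⟩ := hη
  simp only at hU hS h1 h2 ⊢
  have hdet : IsUnit S.det := (Matrix.isUnit_iff_isUnit_det _).1 hS.isUnit
  have hk' : (0 : ℝ) < k := Nat.cast_pos.2 hk
  have hβ' : α + k * β ≠ 0 := by
    have := mul_lt_mul_of_pos_left hβ hk'
    rw [mul_neg, mul_div_cancel₀ _ hk'.ne'] at this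
    exact ne_of_gt (by linarith)
  have hc : (Uᴴ * η.1)ᴴ = -(Uᴴ * η.1) := by
    rw [Matrix.conjTranspose_mul, Matrix.conjTranspose_conjTranspose,
      eq_neg_of_add_eq_zero_right h1]
  have hs : (Uᴴ * G.1 + G.1ᴴ * U)ᴴ = Uᴴ * G.1 + G.1ᴴ * U := by
    simp only [Matrix.conjTranspose_add, Matrix.conjTranspose_mul,
      Matrix.conjTranspose_conjTranspose]
    abel
  have hsc := reTr_herm_mul_skew hs hc
  have hU1 : reTr k ((gradFormula α β (U, S) G).1ᴴ * η.1)
      - 1 / 2 * reTr k ((gradFormula α β (U, S) G).1ᴴ * U * (Uᴴ * η.1)) = reTr k (G.1ᴴ * η.1) := by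
    have e : (gradFormula α β (U, S) G).1ᴴ = G.1ᴴ - Uᴴ * G.1 * Uᴴ := by
      simp [gradFormula, Matrix.mul_assoc]
    have e' : (gradFormula α β (U, S) G).1ᴴ * U = G.1ᴴ * U - Uᴴ * G.1 := by
      rw [e, Matrix.sub_mul, Matrix.mul_assoc _ _ U, hU, Matrix.mul_one]
    rw [e', e]
    simp only [Matrix.sub_mul, Matrix.add_mul, map_sub, map_add, Matrix.mul_assoc] at hsc ⊢
    linarith
  -- The solution of c (α + kβ) = β Re tr(GΣ)/α, the condition that the coefficient of tr(Σ⁻¹ η) be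
  -- zero.
  set c := β * reTr k (G.2 * S) / (α * (α + k * β)) with hcdef
  have hg : S⁻¹ * (gradFormula α β (U, S) G).2 = (1 / α) • (herm G.2 * S) - c • 1 := by
    simp only [gradFormula, Matrix.mul_sub, Matrix.mul_smul, Matrix.nonsing_inv_mul _ hdet,
      Matrix.mul_assoc, Matrix.nonsing_inv_mul_cancel_left _ _ hdet]
    rfl
  have hhS : ∀ Z : Matrix (Fin k) (Fin k) ℂ, Zᴴ = Z → reTr k (herm G.2 * Z) = reTr k (G.2 * Z) := by
    intro Z hZ
    have : reTr k (G.2ᴴ * Z) = reTr k (G.2 * Z) := by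
      rw [← reTr_ct, Matrix.conjTranspose_mul, Matrix.conjTranspose_conjTranspose, hZ, reTr_comm]
    rw [herm_eq, Matrix.smul_mul, Matrix.add_mul, map_smul, map_add, this, smul_eq_mul]
    ring
  have hGη : reTr k (G.2ᴴ * η.2) = reTr k (G.2 * η.2) := by
    rw [← reTr_ct, Matrix.conjTranspose_mul, Matrix.conjTranspose_conjTranspose, h2, reTr_comm]
  have hE : euclInner G η = reTr k (G.1ᴴ * η.1) + reTr k (G.2ᴴ * η.2) := by
    simp [euclInner]
  have h3 : reTr k (herm G.2 * S * (S⁻¹ * η.2)) = reTr k (G.2 * η.2) := by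
    rw [Matrix.mul_assoc, Matrix.mul_nonsing_inv_cancel_left _ _ hdet, hhS _ h2]
  have h4 : reTr k (herm G.2 * S) = reTr k (G.2 * S) := hhS _ hS.isHermitian
  have h5 : reTr k (1 : Matrix (Fin k) (Fin k) ℂ) = k := by simp
  rw [metricBar_eq, hE, hGη, ← hU1]
  simp only [hg, Matrix.sub_mul, Matrix.smul_mul, map_sub, map_smul, smul_eq_mul, h3, h4, h5,
    Matrix.one_mul]
  have hβ'' : α + β * k ≠ 0 := by rwa [mul_comm]
  rw [hcdef]
  field_simp
  ring

end

end FixedRank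

/-! ### Uniqueness of gradients and of the Levi-Civita connection -/

namespace RiemannianSpace

variable {X : Type} {R : RiemannianSpace X}

/-- The properties of a Riemannian space which make its Levi-Civita connection unique: the metric is
an inner product and every tangent vector extends to a smooth vector field. -/
structure IsRegular (R : RiemannianSpace X) : Prop where
  metric_sub_left : ∀ x (u v w : R.tangent x), R.metric x (u - v) w = R.metric x u w - R.metric x v w
  metric_symm : ∀ x (u v : R.tangent x), R.metric x u v = R.metric x v u
  definite : ∀ x (v : R.tangent x), R.metric x v v = 0 → v = 0
  exists_field : ∀ x (v : R.tangent x), ∃ V : R.VectorField, V.1 x = v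

theorem IsRegular.isGradientAt_unique (hR : R.IsRegular) {f : R.smooth} {x : X}
    {v w : R.smooth → ℝ} (hv : R.IsGradientAt f x v) (hw : R.IsGradientAt f x w) : v = w := by
  obtain ⟨hv1, hv2⟩ := hv
  obtain ⟨hw1, hw2⟩ := hw
  have h : (⟨v, hv1⟩ - ⟨w, hw1⟩ : R.tangent x) = 0 := by
    refine hR.definite x _ ?_
    rw [hR.metric_sub_left, hv2, hw2, sub_self]
  exact congrArg Subtype.val (sub_eq_zero.1 h)

/-- The difference T of two such connections is symmetric in its two arguments, while ⟨T(V, W), Z⟩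
is antisymmetric in W and Z. Alternating the two symmetries brings the trilinear expression back to
its own negative. -/
theorem IsRegular.isLeviCivita_unique (hR : R.IsRegular)
    {nabla nabla' : R.VectorField → R.VectorField → R.VectorField} (h : R.IsLeviCivita nabla)
    (h' : R.IsLeviCivita nabla') (V W : R.VectorField) : nabla V W = nabla' V W := by
  refine Subtype.ext (funext fun x => ?_)
  set T : R.VectorField → R.VectorField → R.tangent x :=
    fun V W => (nabla V W).1 x - (nabla' V W).1 x with hT
  have hsymm : ∀ V W, T V W = T W V := by
    intro V W
    refine Subtype.ext (funext fun f => ?_)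
    have e := congrArg (fun g : R.smooth => g.1 x) (h.symmetric V W f)
    have e' := congrArg (fun g : R.smooth => g.1 x) (h'.symmetric V W f)
    have e1 : ((nabla V W).1 x).1 f - ((nabla W V).1 x).1 f
        = ((nabla' V W).1 x).1 f - ((nabla' W V).1 x).1 f := e.trans e'.symm
    change ((nabla V W).1 x).1 f - ((nabla' V W).1 x).1 f
        = ((nabla W V).1 x).1 f - ((nabla' W V).1 x).1 f
    linarith
  have hanti : ∀ V W Z : R.VectorField,
      R.metric x (T V W) (Z.1 x) = - R.metric x (T V Z) (W.1 x) := by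
    intro V W Z
    obtain ⟨g, hg, hgV⟩ := h.metric_compat V W Z
    obtain ⟨g', hg', hgV'⟩ := h'.metric_compat V W Z
    -- Both compatibility statements differentiate the same function ⟨W, Z⟩, so their right-hand
    -- sides agree.
    have hgg : g = g' := Subtype.ext (funext fun y => (hg y).trans (hg' y).symm)
    subst hgg
    have e := (hgV x).symm.trans (hgV' x)
    rw [hR.metric_symm x (W.1 x), hR.metric_symm x (W.1 x)] at e
    simp only [hT, hR.metric_sub_left]
    linarith
  -- Testing with a field whose value at x is T(V, W) itself makes definiteness applicable.
  obtain ⟨Z, hZ⟩ := hR.exists_field x (T V W)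
  have e : R.metric x (T V W) (Z.1 x) = - R.metric x (T V W) (Z.1 x) := by
    calc R.metric x (T V W) (Z.1 x) = - R.metric x (T V Z) (W.1 x) := hanti _ _ _
      _ = - R.metric x (T Z V) (W.1 x) := by rw [hsymm]
      _ = R.metric x (T Z W) (V.1 x) := by rw [hanti Z V W, neg_neg]
      _ = R.metric x (T W Z) (V.1 x) := by rw [hsymm]
      _ = - R.metric x (T W V) (Z.1 x) := hanti _ _ _
      _ = - R.metric x (T V W) (Z.1 x) := by rw [hsymm]
  rw [hZ] at e
  exact sub_eq_zero.1 (hR.definite x _ (by linarith))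

end RiemannianSpace

namespace FixedRank

noncomputable section

variable {p k : ℕ}

/-! ## Tangent vectors and vector fields of the product -/

/-- Links the derivative of the arbitrarily chosen extension to the intrinsic derivative along
curves; independence of the choice follows from `HasTDeriv.unique`. -/
theorem hasTDeriv_dirDeriv (f : smoothBar p k) (θ : MBar p k) (ξ : Ambient p k) :
    HasTDeriv f.1 θ ξ (dirDeriv θ ξ f) := by
  obtain ⟨W, hW, hθ, hF, hFf⟩ := Classical.choose_spec (f.2 θ)
  have hd : DifferentiableAt ℝ (Classical.choose (f.2 θ)) θ.1 :=
    (hF.contDiffAt (hW.mem_nhds hθ)).differentiableAt (by simp)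
  refine HasTDeriv.of_hasFDerivAt hd.hasFDerivAt ?_ ξ
  filter_upwards [(hW.preimage continuous_subtype_val).mem_nhds hθ] with θ' h using hFf θ' h

theorem dirDeriv_eq {f : smoothBar p k} {θ : MBar p k} {ξ : Ambient p k} {d : ℝ}
    (hξ : ξ ∈ TBar θ.1) (h : HasTDeriv f.1 θ ξ d) : dirDeriv θ ξ f = d :=
  (hasTDeriv_dirDeriv f θ ξ).unique hξ h

theorem dirDeriv_eq_tderiv (f : smoothBar p k) {θ : MBar p k} {ξ : Ambient p k}
    (hξ : ξ ∈ TBar θ.1) : dirDeriv θ ξ f = tderiv f.1 θ ξ :=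
  ((hasTDeriv_dirDeriv f θ ξ).tderiv_eq hξ).symm

/-- The restriction of a linear functional. -/
def functional (l : Ambient p k →ₗ[ℝ] ℝ) : smoothBar p k :=
  ⟨fun θ => l θ.1, SmoothMap.val.clm (LinearMap.toContinuousLinearMap l)⟩

theorem dirDeriv_functional (l : Ambient p k →ₗ[ℝ] ℝ) {θ : MBar p k} {ξ : Ambient p k}
    (hξ : ξ ∈ TBar θ.1) : dirDeriv θ ξ (functional l) = l ξ :=
  dirDeriv_eq hξ ((hasTDeriv_val θ ξ).clm (LinearMap.toContinuousLinearMap l))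

/-- Restrictions of linear functionals are smooth functions and already separate tangent vectors. A
tangent vector is therefore represented by a single pair of matrices. -/
theorem dirDeriv_injOn {θ : MBar p k} {ξ η : Ambient p k} (hξ : ξ ∈ TBar θ.1) (hη : η ∈ TBar θ.1)
    (h : dirDeriv θ ξ = dirDeriv θ η) : ξ = η := by
  rw [← sub_eq_zero, ← Module.forall_dual_apply_eq_zero_iff ℝ]
  intro l
  rw [map_sub, ← dirDeriv_functional l hξ, ← dirDeriv_functional l hη, h, sub_self]

variable {α β : ℝ}

theorem exists_rep {θ : MBar p k} (v : (riemBar p k α β).tangent θ) :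
    ∃ ξ, ξ ∈ TBar θ.1 ∧ dirDeriv θ ξ = v.1 :=
  Submodule.mem_map.1 (show v.1 ∈ (TBar θ.1).map (dirDeriv θ) from v.2)

/-- The pair of matrices which represents a tangent vector. -/
def rep {θ : MBar p k} (v : (riemBar p k α β).tangent θ) : Ambient p k :=
  Classical.choose (exists_rep v)

theorem rep_mem {θ : MBar p k} (v : (riemBar p k α β).tangent θ) : rep v ∈ TBar θ.1 :=
  (Classical.choose_spec (exists_rep v)).1

theorem dirDeriv_rep {θ : MBar p k} (v : (riemBar p k α β).tangent θ) : dirDeriv θ (rep v) = v.1 :=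
  (Classical.choose_spec (exists_rep v)).2

theorem rep_eq {θ : MBar p k} {v : (riemBar p k α β).tangent θ} {ξ : Ambient p k}
    (hξ : ξ ∈ TBar θ.1) (h : dirDeriv θ ξ = v.1) : rep v = ξ :=
  dirDeriv_injOn (rep_mem v) hξ ((dirDeriv_rep v).trans h.symm)

theorem rep_add {θ : MBar p k} (v w : (riemBar p k α β).tangent θ) : rep (v + w) = rep v + rep w :=
  rep_eq (add_mem (rep_mem v) (rep_mem w))  <| by
    have h : dirDeriv θ (rep v + rep w) = dirDeriv θ (rep v) + dirDeriv θ (rep w) := map_add _ _ _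
    rw [h, dirDeriv_rep, dirDeriv_rep]
    rfl

theorem rep_sub {θ : MBar p k} (v w : (riemBar p k α β).tangent θ) : rep (v - w) = rep v - rep w :=
  rep_eq (sub_mem (rep_mem v) (rep_mem w))  <| by
    have h : dirDeriv θ (rep v - rep w) = dirDeriv θ (rep v) - dirDeriv θ (rep w) := map_sub _ _ _
    rw [h, dirDeriv_rep, dirDeriv_rep]
    rfl

theorem rep_smul {θ : MBar p k} (c : ℝ) (v : (riemBar p k α β).tangent θ) :
    rep (c • v) = c • rep v :=
  rep_eq (Submodule.smul_mem _ c (rep_mem v))  <| by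
    have h : dirDeriv θ (c • rep v) = c • dirDeriv θ (rep v) := map_smul _ _ _
    rw [h, dirDeriv_rep]
    rfl

theorem metric_riemBar {θ : MBar p k} (v w : (riemBar p k α β).tangent θ) :
    (riemBar p k α β).metric θ v w = metricBar α β θ.1 (rep v) (rep w) := rfl

/-- The tangent vector represented by a pair of matrices. -/
def mkTangent (α β : ℝ) {θ : MBar p k} (ξ : Ambient p k) (hξ : ξ ∈ TBar θ.1) :
    (riemBar p k α β).tangent θ := ⟨dirDeriv θ ξ, ξ, hξ, rfl⟩

theorem rep_mkTangent {θ : MBar p k} {ξ : Ambient p k} (hξ : ξ ∈ TBar θ.1) :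
    rep (mkTangent α β ξ hξ) = ξ := rep_eq hξ rfl

/-- The matrix-valued map which represents a vector field. -/
def repField (V : (riemBar p k α β).VectorField) (θ : MBar p k) : Ambient p k := rep (V.1 θ)

theorem repField_mem (V : (riemBar p k α β).VectorField) (θ : MBar p k) :
    repField V θ ∈ TBar θ.1 := rep_mem _

theorem dirDeriv_repField (V : (riemBar p k α β).VectorField) (θ : MBar p k) :
    dirDeriv θ (repField V θ) = (V.1 θ).1 := dirDeriv_rep _

/-- The components of the representing map are obtained by applying the field to the restrictions of
linear functionals, and such values are smooth by the definition of a vector field. -/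
theorem smooth_repField (V : (riemBar p k α β).VectorField) : SmoothMap (repField V) := by
  refine SmoothMap.of_functionals fun l => ?_
  have h := V.2 (functional l)
  have e : (fun θ => l (repField V θ)) = fun θ => (V.1 θ).1 (functional l) := by
    funext θ
    rw [← dirDeriv_functional l (repField_mem V θ), dirDeriv_repField]
  rw [e]
  exact h

/-- The vector field represented by a smooth matrix-valued map. -/
def mkField (α β : ℝ) (v : MBar p k → Ambient p k) (hv : SmoothMap v)
    (hvT : ∀ θ, v θ ∈ TBar θ.1) : (riemBar p k α β).VectorField :=
  ⟨fun θ => mkTangent α β (v θ) (hvT θ), fun f => by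
    have h : SmoothMap fun θ => tderiv f.1 θ (v θ) := SmoothMap.tderiv f.2 hv hvT
    have e : (fun θ => (mkTangent α β (v θ) (hvT θ)).1 f) = fun θ => tderiv f.1 θ (v θ) :=
      funext fun θ => dirDeriv_eq_tderiv f (hvT θ)
    rw [e]
    exact h⟩

theorem repField_mkField (v : MBar p k → Ambient p k) (hv : SmoothMap v)
    (hvT : ∀ θ : MBar p k, v θ ∈ TBar θ.1) (θ : MBar p k) :
    repField (mkField α β v hv hvT) θ = v θ := by
  have h : (mkField α β v hv hvT).1 θ = mkTangent α β (v θ) (hvT θ) := rfl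
  rw [repField, h, rep_mkTangent]

theorem field_ext {V W : (riemBar p k α β).VectorField}
    (h : ∀ θ, repField V θ = repField W θ) : V = W := by
  refine Subtype.ext (funext fun θ => Subtype.ext ?_)
  rw [← dirDeriv_repField, ← dirDeriv_repField, h]

theorem repField_add (V W : (riemBar p k α β).VectorField) (θ : MBar p k) :
    repField (V + W) θ = repField V θ + repField W θ := rep_add _ _

theorem repField_fsmul (h : (riemBar p k α β).smooth) (V : (riemBar p k α β).VectorField)
    (θ : MBar p k) : repField (RiemannianSpace.fsmul h V) θ = h.1 θ • repField V θ := rep_smul _ _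

theorem applyField_apply (V : (riemBar p k α β).VectorField) (f : (riemBar p k α β).smooth)
    (θ : MBar p k) : (RiemannianSpace.applyField V f).1 θ = tderiv f.1 θ (repField V θ) := by
  have h := dirDeriv_eq_tderiv (f : smoothBar p k) (repField_mem V θ)
  rw [dirDeriv_repField] at h
  exact h

/-! ## Smoothness of the metric and of the Christoffel term -/

theorem smooth_invSigma : SmoothMap fun θ : MBar p k => θ.1.2⁻¹ :=
  SmoothMap.inv SmoothMap.val.snd MBar.isUnit

theorem smooth_metricBar (α β : ℝ) {v w : MBar p k → Ambient p k} (hv : SmoothMap v)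
    (hw : SmoothMap w) : SmoothMap fun θ => metricBar α β θ.1 (v θ) (w θ) := by
  simp only [metricBar_eq]
  have hU : SmoothMap fun θ : MBar p k => θ.1.1 := SmoothMap.val.fst
  have hS := smooth_invSigma (p := p) (k := k)
  exact (((hv.fst.ct.mul hw.fst).clm (reTr k)).sub
    ((SmoothMap.const _).smul (((hv.fst.ct.mul hU).mul (hU.ct.mul hw.fst)).clm (reTr k)))).add
    ((SmoothMap.const α).smul (((hS.mul hv.snd).mul (hS.mul hw.snd)).clm (reTr k))) |>.add
    (((SmoothMap.const β).smul ((hS.mul hv.snd).clm (reTr k))).smul ((hS.mul hw.snd).clm (reTr k)))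

theorem smooth_christoffel {v w : MBar p k → Ambient p k} (hv : SmoothMap v)
    (hw : SmoothMap w) : SmoothMap fun θ => christoffel θ.1 (v θ) (w θ) := by
  have hU : SmoothMap fun θ : MBar p k => θ.1.1 := SmoothMap.val.fst
  have hS := smooth_invSigma (p := p) (k := k)
  have ha := hU.ct.mul hv.fst
  have hb := hU.ct.mul hw.fst
  exact (((hU.mul ((((ha.mul hb).add (hb.mul ha)).add (hv.fst.ct.mul hw.fst)).add
    (hw.fst.ct.mul hv.fst))).sub ((hv.fst.mul hb).add (hw.fst.mul ha))).rsmul _).prodMk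
    (((hv.snd.mul (hS.mul hw.snd)).add (hw.snd.mul (hS.mul hv.snd))).rsmul _)

theorem hasTDeriv_metricBar (α β : ℝ) {w z : MBar p k → Ambient p k} {θ : MBar p k}
    {v dw dz : Ambient p k} (hw : HasTDeriv w θ v dw) (hz : HasTDeriv z θ v dz) :
    HasTDeriv (fun θ => metricBar α β θ.1 (w θ) (z θ)) θ v
      (dmetric α β θ.1 v (w θ) (z θ) + metricBar α β θ.1 dw (z θ)
        + metricBar α β θ.1 (w θ) dz) := by
  simp only [metricBar_eq]
  have hU : HasTDeriv (fun θ : MBar p k => θ.1.1) θ v v.1 := (hasTDeriv_val θ v).fst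
  have hS := (hasTDeriv_val θ v).snd.inv MBar.isUnit
  have hSw := hS.mul hw.snd
  have hSz := hS.mul hz.snd
  have h := (((hw.fst.ct.mul hz.fst).reTrace).sub
    ((((hw.fst.ct.mul hU).mul (hU.ct.mul hz.fst)).reTrace).rsmul (1 / 2))).add
    (((hSw.mul hSz).reTrace).rsmul α) |>.add
    (((hSw.reTrace).rsmul β).rmul (hSz.reTrace))
  -- The differentiation rules produce scalings by `•` where the expanded metric has `*`; spelling
  -- out the function lets the two be identified by unfolding.
  have e : ∀ {d d' : ℝ}, d = d' → HasTDeriv (fun θ : MBar p k => reTr k ((w θ).1ᴴ * (z θ).1)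
      - 1 / 2 * reTr k ((w θ).1ᴴ * θ.1.1 * (θ.1.1ᴴ * (z θ).1))
      + α * reTr k (θ.1.2⁻¹ * (w θ).2 * (θ.1.2⁻¹ * (z θ).2))
      + β * reTr k (θ.1.2⁻¹ * (w θ).2) * reTr k (θ.1.2⁻¹ * (z θ).2)) θ v d → HasTDeriv _ θ v d' :=
    fun h1 h2 => h1 ▸ h2
  refine e ?_ h
  simp only [dmetric, Matrix.add_mul, Matrix.mul_add, Matrix.neg_mul, Matrix.mul_neg, map_add,
    map_neg, smul_eq_mul, Matrix.mul_assoc]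
  ring

/-! ## The Levi-Civita connection of the product -/

/-- Differentiating the equations satisfied by a tangent field along V gives exactly the hypotheses
of `add_christoffel_mem`. -/
theorem tderiv_field_mem {V W : MBar p k → Ambient p k} (hW : SmoothMap W)
    (hVT : ∀ θ, V θ ∈ TBar θ.1) (hWT : ∀ θ, W θ ∈ TBar θ.1) (θ : MBar p k) :
    tderiv W θ (V θ) + christoffel θ.1 (V θ) (W θ) ∈ TBar θ.1 := by
  have hd := hW.hasTDeriv θ (V θ)
  have hU : HasTDeriv (fun θ : MBar p k => θ.1.1) θ (V θ) (V θ).1 := (hasTDeriv_val θ (V θ)).fst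
  refine add_christoffel_mem (hVT θ) (hWT θ) ?_ ?_
  · have h1 := (hU.ct.mul hd.fst).add (hd.fst.ct.mul hU)
    have h2 := (hasTDeriv_const (0 : Matrix (Fin k) (Fin k) ℂ) θ (V θ)).congr
      (w := fun θ : MBar p k => θ.1.1ᴴ * (W θ).1 + (W θ).1ᴴ * θ.1.1)
      (Filter.Eventually.of_forall fun θ' => (hWT θ').1)
    exact h1.unique (hVT θ) h2
  · have h1 : HasTDeriv (fun θ => (W θ).2) θ (V θ) ((tderiv W θ (V θ)).2)ᴴ :=
      hd.snd.ct.congr (Filter.Eventually.of_forall fun θ' => (hWT θ').2.symm)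
    exact h1.unique (hVT θ) hd.snd

/-- The Levi-Civita connection of the product. -/
def nablaBar (V W : (riemBar p k α β).VectorField) : (riemBar p k α β).VectorField :=
  mkField α β (fun θ => tderiv (repField W) θ (repField V θ)
      + christoffel θ.1 (repField V θ) (repField W θ))
    (((smooth_repField W).tderiv (smooth_repField V) (repField_mem V)).add
      (smooth_christoffel (smooth_repField V) (smooth_repField W)))
    (tderiv_field_mem (smooth_repField W) (repField_mem V) (repField_mem W))

theorem repField_nablaBar (V W : (riemBar p k α β).VectorField) (θ : MBar p k) :
    repField (nablaBar V W) θ = tderiv (repField W) θ (repField V θ)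
      + christoffel θ.1 (repField V θ) (repField W θ) := repField_mkField _ _ _ θ

theorem christoffel_add_left (θ v v' w : Ambient p k) :
    christoffel θ (v + v') w = christoffel θ v w + christoffel θ v' w := by
  rw [christoffel_symm, christoffel_add_right, christoffel_symm, christoffel_symm θ w v']

theorem christoffel_smul_left (θ : Ambient p k) (c : ℝ) (v w : Ambient p k) :
    christoffel θ (c • v) w = c • christoffel θ v w := by
  rw [christoffel_symm, christoffel_smul_right, christoffel_symm]

/-- Torsion vanishes because the Christoffel term is symmetric and second derivatives commute up to
the bracket. Metric compatibility is the product rule for the metric combined with `dmetric_eq`. -/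
theorem isLeviCivita_nablaBar : (riemBar p k α β).IsLeviCivita nablaBar where
  add_left V V' W := by
    refine field_ext fun θ => ?_
    obtain ⟨L, hL⟩ := (smooth_repField W).tderiv_linear θ
    rw [repField_add, repField_nablaBar, repField_nablaBar, repField_nablaBar, repField_add,
      hL _ (add_mem (repField_mem V θ) (repField_mem V' θ)), hL _ (repField_mem V θ),
      hL _ (repField_mem V' θ), map_add, christoffel_add_left]
    abel
  fsmul_left h V W := by
    refine field_ext fun θ => ?_
    obtain ⟨L, hL⟩ := (smooth_repField W).tderiv_linear θ
    rw [repField_fsmul, repField_nablaBar, repField_nablaBar, repField_fsmul,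
      hL _ (Submodule.smul_mem _ _ (repField_mem V θ)), hL _ (repField_mem V θ), map_smul,
      christoffel_smul_left, smul_add]
  add_right V W W' := by
    refine field_ext fun θ => ?_
    have h : tderiv (repField (W + W')) θ (repField V θ) = tderiv (repField W) θ (repField V θ)
        + tderiv (repField W') θ (repField V θ) := by
      refine HasTDeriv.tderiv_eq ?_ (repField_mem V θ)
      exact (((smooth_repField W).hasTDeriv θ _).add ((smooth_repField W').hasTDeriv θ _)).congr
        (Filter.Eventually.of_forall fun θ' => repField_add W W' θ')
    rw [repField_add, repField_nablaBar, repField_nablaBar, repField_nablaBar, repField_add, h,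
      christoffel_add_right]
    abel
  leibniz h V W := by
    refine field_ext fun θ => ?_
    have e : tderiv (repField (RiemannianSpace.fsmul h W)) θ (repField V θ)
        = tderiv h.1 θ (repField V θ) • repField W θ
          + h.1 θ • tderiv (repField W) θ (repField V θ) := by
      refine HasTDeriv.tderiv_eq ?_ (repField_mem V θ)
      exact ((SmoothMap.hasTDeriv (v := h.1) h.2 θ _).smul
        ((smooth_repField W).hasTDeriv θ _)).congr
        (Filter.Eventually.of_forall fun θ' => repField_fsmul h W θ')
    rw [repField_add, repField_fsmul, repField_fsmul, repField_nablaBar, repField_nablaBar,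
      repField_fsmul, e, christoffel_smul_right, applyField_apply, smul_add, add_assoc]
  symmetric V W f := by
    refine Subtype.ext (funext fun θ => ?_)
    have hf : SmoothMap f.1 := f.2
    obtain ⟨L, hL, hbr⟩ := hf.tderiv_tderiv_sub (smooth_repField V) (smooth_repField W)
      (repField_mem V) (repField_mem W) θ
    have e1 : (RiemannianSpace.applyField (nablaBar V W) f).1 θ = L (repField (nablaBar V W) θ) := by
      rw [applyField_apply]
      exact (hL _).tderiv_eq (repField_mem _ θ)
    have e2 : (RiemannianSpace.applyField (nablaBar W V) f).1 θ = L (repField (nablaBar W V) θ) := by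
      rw [applyField_apply]
      exact (hL _).tderiv_eq (repField_mem _ θ)
    have e3 : ∀ V W : (riemBar p k α β).VectorField,
        (RiemannianSpace.applyField V (RiemannianSpace.applyField W f)).1 θ
          = tderiv (fun θ => tderiv f.1 θ (repField W θ)) θ (repField V θ) := by
      intro V W
      rw [applyField_apply]
      congr 1
      exact funext fun θ' => applyField_apply W f θ'
    change (RiemannianSpace.applyField (nablaBar V W) f).1 θ
        - (RiemannianSpace.applyField (nablaBar W V) f).1 θ
      = (RiemannianSpace.applyField V (RiemannianSpace.applyField W f)).1 θ
        - (RiemannianSpace.applyField W (RiemannianSpace.applyField V f)).1 θ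
    rw [e1, e2, e3, e3, hbr, ← map_sub, repField_nablaBar, repField_nablaBar,
      christoffel_symm θ.1 (repField W θ)]
    congr 1
    abel
  metric_compat V W Z := by
    refine ⟨⟨fun θ => metricBar α β θ.1 (repField W θ) (repField Z θ),
      smooth_metricBar α β (smooth_repField W) (smooth_repField Z)⟩, fun θ => rfl, fun θ => ?_⟩
    have h := hasTDeriv_metricBar α β ((smooth_repField W).hasTDeriv θ (repField V θ))
      ((smooth_repField Z).hasTDeriv θ (repField V θ))
    rw [metric_riemBar, metric_riemBar]
    change _ = metricBar α β θ.1 (repField (nablaBar V W) θ) (repField Z θ)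
      + metricBar α β θ.1 (repField W θ) (repField (nablaBar V Z) θ)
    rw [← dirDeriv_repField, repField_nablaBar, repField_nablaBar]
    refine (dirDeriv_eq (repField_mem V θ) h).trans ?_
    rw [dmetric_eq α β (repField_mem V θ) (repField_mem W θ) (repField_mem Z θ),
      metricBar_add_left, metricBar_add_right]
    ring

/-! ## Invariant vector fields -/

/-- The vector field `(A U, Uᴴ B U)`. -/
def linField (A B : Matrix (Fin p) (Fin p) ℂ) (θ : MBar p k) : Ambient p k :=
  (A * θ.1.1, θ.1.1ᴴ * B * θ.1.1)

theorem linField_mem {A B : Matrix (Fin p) (Fin p) ℂ} (hA : Aᴴ = -A) (hB : Bᴴ = B)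
    (θ : MBar p k) : linField A B θ ∈ TBar θ.1 := by
  constructor
  · simp [linField, Matrix.conjTranspose_mul, hA, Matrix.mul_assoc]
  · simp [linField, Matrix.conjTranspose_mul, hB, Matrix.mul_assoc]

theorem smooth_linField (A B : Matrix (Fin p) (Fin p) ℂ) :
    SmoothMap (linField A B : MBar p k → Ambient p k) := by
  have hU : SmoothMap fun θ : MBar p k => θ.1.1 := SmoothMap.val.fst
  exact ((SmoothMap.const A).mul hU).prodMk ((hU.ct.mul (SmoothMap.const B)).mul hU)

/-- B = U ξ_Σ Uᴴ recovers ξ_Σ since Uᴴ U = 1. Fields of this form are smooth and also equivariant,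
so the same family extends tangent vectors on the product and on the quotient. -/
theorem exists_linField_eq {θ : MBar p k} {ξ : Ambient p k} (hξ : ξ ∈ TBar θ.1) :
    ∃ A B : Matrix (Fin p) (Fin p) ℂ, Aᴴ = -A ∧ Bᴴ = B ∧ linField A B θ = ξ := by
  obtain ⟨A, hA, hAU⟩ := exists_skew_mul_eq θ.2.1 hξ.1
  refine ⟨A, θ.1.1 * ξ.2 * θ.1.1ᴴ, hA, ?_, Prod.ext hAU ?_⟩
  · simp [Matrix.conjTranspose_mul, hξ.2, Matrix.mul_assoc]
  · calc θ.1.1ᴴ * (θ.1.1 * ξ.2 * θ.1.1ᴴ) * θ.1.1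
        = (θ.1.1ᴴ * θ.1.1) * ξ.2 * (θ.1.1ᴴ * θ.1.1) := by simp only [Matrix.mul_assoc]
      _ = ξ.2 := by rw [θ.2.1, Matrix.one_mul, Matrix.mul_one]

theorem exists_field_eq (α β : ℝ) {θ : MBar p k} {ξ : Ambient p k} (hξ : ξ ∈ TBar θ.1) :
    ∃ V : (riemBar p k α β).VectorField, repField V θ = ξ := by
  obtain ⟨A, B, hA, hB, h⟩ := exists_linField_eq hξ
  exact ⟨mkField α β _ (smooth_linField A B) (linField_mem hA hB),
    (repField_mkField _ _ _ θ).trans h⟩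

theorem isRegular_riemBar (hk : 0 < k) (hα : 0 < α) (hβ : -(α / k) < β) :
    (riemBar p k α β).IsRegular where
  metric_sub_left θ u v w := by
    rw [metric_riemBar, rep_sub, metricBar_sub_left]; rfl
  metric_symm θ u v := metricBar_symm _ _ _ _ _
  definite θ v h := by
    have h0 := metricBar_self_pos hk hα hβ θ (rep_mem v) h
    refine Subtype.ext ?_
    rw [← dirDeriv_rep v, h0, map_zero]
    rfl
  exists_field θ v := by
    obtain ⟨V, hV⟩ := exists_field_eq α β (rep_mem v)
    refine ⟨V, Subtype.ext ?_⟩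
    rw [← dirDeriv_repField, hV, dirDeriv_rep]

end

end FixedRank

namespace FixedRank

noncomputable section

variable {p k : ℕ} {α β : ℝ}

/-! ## Smoothness of the Euclidean gradient -/

theorem euclInner_symm (ξ η : Ambient p k) : euclInner ξ η = euclInner η ξ := by
  have h1 := reTr_ct (ξ.1ᴴ * η.1)
  have h2 := reTr_ct (ξ.2ᴴ * η.2)
  simp only [Matrix.conjTranspose_mul, Matrix.conjTranspose_conjTranspose, reTr_apply] at h1 h2
  simp only [euclInner, Complex.add_re, h1, h2]

theorem exists_eq_euclInner (l : Ambient p k →ₗ[ℝ] ℝ) : ∃ g, ∀ ξ, l ξ = euclInner ξ g := by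
  -- A linear functional is its own derivative, so its Euclidean gradient at any point represents
  -- it.
  refine ⟨euclGrad l 0, fun ξ => ?_⟩
  have h : HasFDerivAt (fun ξ => l ξ) (LinearMap.toContinuousLinearMap l) (0 : Ambient p k) :=
    (LinearMap.toContinuousLinearMap l).hasFDerivAt
  rw [euclInner_symm, euclInner_euclGrad, h.fderiv]
  rfl

/-- Every linear functional of the gradient is a directional derivative of F in a fixed direction,
hence loses only one order of differentiability. -/
theorem contDiffAt_euclGrad {m n : WithTop ℕ∞} {F : Ambient p k → ℝ} {θ : Ambient p k}
    (hF : ContDiffAt ℝ n F θ) (hmn : m + 1 ≤ n) : ContDiffAt ℝ m (euclGrad F) θ := by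
  refine contDiffWithinAt_of_functionals (s := Set.univ) fun l => ?_
  obtain ⟨g, hg⟩ := exists_eq_euclInner l
  simp only [hg, euclInner_euclGrad]
  exact hF.fderiv_apply_const hmn g

theorem gradFormula_eq (α β : ℝ) (θ G : Ambient p k) : gradFormula α β θ G =
    (G.1 - θ.1 * G.1ᴴ * θ.1, (1 / α) • (θ.2 * ((1 / 2 : ℝ) • (G.2 + G.2ᴴ)) * θ.2)
      - (β / (α * (α + k * β))) • reTr k (G.2 * θ.2) • θ.2) := by
  rw [gradFormula, herm_eq, smul_smul, div_mul_eq_mul_div]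
  rfl

theorem contDiff_gradFormula (α β : ℝ) :
    ContDiff ℝ ∞ fun q : Ambient p k × Ambient p k => gradFormula α β q.1 q.2 := by
  simp only [gradFormula_eq]
  have hU : ContDiff ℝ ∞ fun q : Ambient p k × Ambient p k => q.1.1 := contDiff_fst.fst
  have hS : ContDiff ℝ ∞ fun q : Ambient p k × Ambient p k => q.1.2 := contDiff_fst.snd
  have hG : ContDiff ℝ ∞ fun q : Ambient p k × Ambient p k => q.2.1 := contDiff_snd.fst
  have hH : ContDiff ℝ ∞ fun q : Ambient p k × Ambient p k => q.2.2 := contDiff_snd.snd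
  exact (hG.sub ((hU.matmul hG.matct).matmul hU)).prodMk
    ((((hS.matmul ((hH.add hH.matct).const_smul _)).matmul hS).const_smul _).sub
      ((((reTr k).contDiff.comp (hH.matmul hS)).smul hS).const_smul _))

/-! ## The gradient on the product -/

theorem metricBar_grad (hk : 0 < k) (hα : 0 < α) (hβ : -(α / k) < β) {f : smoothBar p k}
    {θ : MBar p k} {F : Ambient p k → ℝ} (hF : DifferentiableAt ℝ F θ.1)
    (hFf : ∀ᶠ θ' : MBar p k in 𝓝 θ, f.1 θ' = F θ'.1) {η : Ambient p k} (hη : η ∈ TBar θ.1) :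
    metricBar α β θ.1 (gradFormula α β θ.1 (euclGrad F θ.1)) η = dirDeriv θ η f := by
  rw [metricBar_gradFormula hk hα hβ θ _ hη, euclInner_euclGrad]
  exact (dirDeriv_eq hη (HasTDeriv.of_hasFDerivAt hF.hasFDerivAt hFf η)).symm

theorem eq_of_metricBar_eq (hk : 0 < k) (hα : 0 < α) (hβ : -(α / k) < β) {θ : MBar p k}
    {ξ ξ' : Ambient p k} (hξ : ξ ∈ TBar θ.1) (hξ' : ξ' ∈ TBar θ.1)
    (h : ∀ η ∈ TBar θ.1, metricBar α β θ.1 ξ η = metricBar α β θ.1 ξ' η) : ξ = ξ' := by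
  have hs := sub_mem hξ hξ'
  refine sub_eq_zero.1 (metricBar_self_pos hk hα hβ θ hs ?_)
  rw [metricBar_sub_left, h _ hs, sub_self]

/-- The representative of the gradient of a smooth function. -/
def gradVec (α β : ℝ) (f : smoothBar p k) (θ : MBar p k) : Ambient p k :=
  gradFormula α β θ.1 (euclGrad (Classical.choose (f.2 θ)) θ.1)

theorem gradVec_mem (f : smoothBar p k) (θ : MBar p k) : gradVec α β f θ ∈ TBar θ.1 :=
  gradFormula_mem _ _ _ _

theorem metricBar_gradVec (hk : 0 < k) (hα : 0 < α) (hβ : -(α / k) < β) (f : smoothBar p k)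
    (θ : MBar p k) {η : Ambient p k} (hη : η ∈ TBar θ.1) :
    metricBar α β θ.1 (gradVec α β f θ) η = dirDeriv θ η f := by
  obtain ⟨W, hW, hθ, hF, hFf⟩ := Classical.choose_spec (f.2 θ)
  refine metricBar_grad hk hα hβ ((hF.contDiffAt (hW.mem_nhds hθ)).differentiableAt (by simp)) ?_ hη
  filter_upwards [(hW.preimage continuous_subtype_val).mem_nhds hθ] with θ' h using hFf θ' h

/-- `gradVec` uses a separately chosen extension at each point. All extensions give the same
pairings with tangent vectors, so by definiteness the formula takes the same value for any of them.
-/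
theorem gradVec_eq (hk : 0 < k) (hα : 0 < α) (hβ : -(α / k) < β) {f : smoothBar p k}
    {θ : MBar p k} {F : Ambient p k → ℝ} (hF : DifferentiableAt ℝ F θ.1)
    (hFf : ∀ᶠ θ' : MBar p k in 𝓝 θ, f.1 θ' = F θ'.1) :
    gradVec α β f θ = gradFormula α β θ.1 (euclGrad F θ.1) :=
  eq_of_metricBar_eq hk hα hβ (gradVec_mem f θ) (gradFormula_mem _ _ _ _) fun η hη => by
    rw [metricBar_gradVec hk hα hβ f θ hη, metricBar_grad hk hα hβ hF hFf hη]

/-- Near a given point a single extension can replace the pointwise choices, and the formula is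
smooth in the point and in the Euclidean gradient. -/
theorem smooth_gradVec (hk : 0 < k) (hα : 0 < α) (hβ : -(α / k) < β) (f : smoothBar p k) :
    SmoothMap (gradVec α β f) := by
  intro θ
  obtain ⟨F, W, hW, hθ, hF, hFf⟩ := f.2 θ
  refine ⟨fun x => gradFormula α β x (euclGrad F x), W, hW, hθ, fun x hx => ?_, fun θ' h => ?_⟩
  · have hG : ContDiffAt ℝ ∞ (euclGrad F) x :=
      contDiffAt_euclGrad (hF.contDiffAt (hW.mem_nhds hx)) (by simp)
    have hc := (contDiff_gradFormula (p := p) (k := k) α β).contDiffAt.comp x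
      (contDiffAt_id.prodMk hG)
    exact hc.contDiffWithinAt
  · refine gradVec_eq hk hα hβ ((hF.contDiffAt (hW.mem_nhds h)).differentiableAt (by simp)) ?_
    filter_upwards [(hW.preimage continuous_subtype_val).mem_nhds h] with x hx using hFf x hx

theorem isGradientAt_riemBar (hk : 0 < k) (hα : 0 < α) (hβ : -(α / k) < β) (f : smoothBar p k)
    (θ : MBar p k) (v : smoothBar p k → ℝ) :
    (riemBar p k α β).IsGradientAt f θ v ↔ v = dirDeriv θ (gradVec α β f θ) := by
  have h : (riemBar p k α β).IsGradientAt f θ (dirDeriv θ (gradVec α β f θ)) := by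
    refine ⟨(mkTangent α β _ (gradVec_mem f θ)).2, fun w => ?_⟩
    change metricBar α β θ.1 (rep (mkTangent α β _ (gradVec_mem f θ))) (rep w) = _
    rw [rep_mkTangent, metricBar_gradVec hk hα hβ f θ (rep_mem w), dirDeriv_rep]
  refine ⟨fun hv => (isRegular_riemBar hk hα hβ).isGradientAt_unique hv h, ?_⟩
  rintro rfl
  exact h

/-! ## The Hessian on the product -/

theorem hasTDeriv_gradFormula (α β : ℝ) {G : MBar p k → Ambient p k} {θ : MBar p k}
    {ξ H : Ambient p k} (hG : HasTDeriv G θ ξ H) :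
    HasTDeriv (fun θ => gradFormula α β θ.1 (G θ)) θ ξ
      (H.1 - ((ξ.1 * (G θ).1ᴴ + θ.1.1 * H.1ᴴ) * θ.1.1 + θ.1.1 * (G θ).1ᴴ * ξ.1),
        (1 / α) • ((ξ.2 * herm (G θ).2 + θ.1.2 * herm H.2) * θ.1.2 + θ.1.2 * herm (G θ).2 * ξ.2)
          - (β / (α * (α + k * β))) • (reTr k (H.2 * θ.1.2 + (G θ).2 * ξ.2) • θ.1.2
            + reTr k ((G θ).2 * θ.1.2) • ξ.2)) := by
  simp only [gradFormula_eq, herm_eq]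
  have hU : HasTDeriv (fun θ : MBar p k => θ.1.1) θ ξ ξ.1 := (hasTDeriv_val θ ξ).fst
  have hS : HasTDeriv (fun θ : MBar p k => θ.1.2) θ ξ ξ.2 := (hasTDeriv_val θ ξ).snd
  exact (hG.fst.sub ((hU.mul hG.fst.ct).mul hU)).prodMk
    ((((hS.mul ((hG.snd.add hG.snd.ct).rsmul _)).mul hS).rsmul _).sub
      (((hG.snd.mul hS).reTrace.smul hS).rsmul _))

/-- In the Σ-part the Christoffel term removes half of ξ herm(G) Σ + Σ herm(G) ξ, and it cancels the
multiple of ξ produced by differentiating the factor Σ of the trace term. The U-part reduces by Uᴴ U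
= 1 and ξᴴ U = -Uᴴ ξ. -/
theorem hessFormula_eq (α β : ℝ) {θ : MBar p k} {ξ : Ambient p k} (hξ : ξ ∈ TBar θ.1)
    (G H : Ambient p k) :
    (H.1 - ((ξ.1 * G.1ᴴ + θ.1.1 * H.1ᴴ) * θ.1.1 + θ.1.1 * G.1ᴴ * ξ.1),
        (1 / α) • ((ξ.2 * herm G.2 + θ.1.2 * herm H.2) * θ.1.2 + θ.1.2 * herm G.2 * ξ.2)
          - (β / (α * (α + k * β))) • (reTr k (H.2 * θ.1.2 + G.2 * ξ.2) • θ.1.2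
            + reTr k (G.2 * θ.1.2) • ξ.2)) + christoffel θ.1 ξ (gradFormula α β θ.1 G)
      = hessFormula α β θ.1 ξ G H := by
  obtain ⟨⟨U, S⟩, hU, hS⟩ := θ
  obtain ⟨h1, h2⟩ := hξ
  simp only at hU hS h1 h2
  have h1' : ξ.1ᴴ * U = -(Uᴴ * ξ.1) := eq_neg_of_add_eq_zero_right h1
  have hSh : Sᴴ = S := hS.isHermitian
  have hdet : IsUnit S.det := (Matrix.isUnit_iff_isUnit_det _).1 hS.isUnit
  refine Prod.ext ?_ ?_
  · have e1 : ∀ Z : Matrix (Fin k) (Fin k) ℂ, Uᴴ * (U * Z) = Z := fun Z => by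
      rw [← Matrix.mul_assoc, hU, Matrix.one_mul]
    have e2 : ∀ Z : Matrix (Fin k) (Fin k) ℂ, ξ.1ᴴ * (U * Z) = -(Uᴴ * (ξ.1 * Z)) := fun Z => by
      rw [← Matrix.mul_assoc, h1', Matrix.neg_mul, Matrix.mul_assoc]
    simp only [Prod.fst_add, christoffel, gradFormula, hessFormula, skewh_eq, half_smul,
      Matrix.conjTranspose_mul, Matrix.conjTranspose_conjTranspose, Matrix.conjTranspose_sub,
      Matrix.mul_add, Matrix.add_mul, Matrix.mul_sub, Matrix.sub_mul, Matrix.mul_smul,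
      Matrix.smul_mul, Matrix.mul_assoc, Matrix.one_mul, e1, e2, h1', Matrix.mul_neg]
    module
  · have e3 : β * ((H.2 * S + G.2 * ξ.2).trace).re / (α * (α + k * β))
        = (β / (α * (α + k * β))) * reTr k (H.2 * S + G.2 * ξ.2) :=
      (div_mul_eq_mul_div _ _ _).symm
    have e4 : herm (S * (herm G.2 * ξ.2))
        = (1 / 2 : ℝ) • (S * (herm G.2 * ξ.2) + ξ.2 * (herm G.2 * S)) := by
      rw [herm_eq, Matrix.conjTranspose_mul, Matrix.conjTranspose_mul, conjTranspose_herm, hSh, h2,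
        Matrix.mul_assoc ξ.2]
    have e5 : ∀ Z : Matrix (Fin k) (Fin k) ℂ, S⁻¹ * (S * Z) = Z := fun Z =>
      Matrix.nonsing_inv_mul_cancel_left _ _ hdet
    have e6 : ∀ Z : Matrix (Fin k) (Fin k) ℂ, S * (S⁻¹ * Z) = Z := fun Z =>
      Matrix.mul_nonsing_inv_cancel_left _ _ hdet
    have e7 : β * ((G.2 * S).trace).re / (α * (α + k * β))
        = (β / (α * (α + k * β))) * reTr k (G.2 * S) := (div_mul_eq_mul_div _ _ _).symm
    simp only [Prod.snd_add, christoffel, gradFormula, hessFormula, e3, e4, e7, Matrix.mul_sub,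
      Matrix.sub_mul, Matrix.mul_smul, Matrix.smul_mul, Matrix.add_mul, Matrix.mul_assoc, e5, e6,
      Matrix.nonsing_inv_mul _ hdet, Matrix.mul_one]
    module

/-- Although the gradient field is smooth for other reasons, its derivative at θ may be computed
with any extension that is C² at θ: the gradient formula for that one extension holds throughout a
neighbourhood. -/
theorem repField_nablaBar_grad (hk : 0 < k) (hα : 0 < α) (hβ : -(α / k) < β) {f : smoothBar p k}
    {θ : MBar p k} {F : Ambient p k → ℝ} (hF : ContDiffAt ℝ 2 F θ.1)
    (hFf : ∀ᶠ θ' : MBar p k in 𝓝 θ, f.1 θ' = F θ'.1) {V G : (riemBar p k α β).VectorField}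
    (hG : ∀ θ, repField G θ = gradVec α β f θ) :
    repField (nablaBar V G) θ = hessFormula α β θ.1 (repField V θ) (euclGrad F θ.1)
      (euclHess F θ.1 (repField V θ)) := by
  have hd : DifferentiableAt ℝ (euclGrad F) θ.1 :=
    (contDiffAt_euclGrad (m := 1) hF (by norm_num)).differentiableAt (by simp)
  have hev : ∀ᶠ θ' : MBar p k in 𝓝 θ,
      repField G θ' = gradFormula α β θ'.1 (euclGrad F θ'.1) := by
    -- Being C² at a point is an open condition, so `gradVec_eq` applies at all nearby points.
    have h1 : ∀ᶠ θ' : MBar p k in 𝓝 θ, ContDiffAt ℝ 2 F θ'.1 :=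
      continuous_subtype_val.continuousAt.eventually (hF.eventually (by simp))
    filter_upwards [h1, eventually_eventually_nhds.2 hFf] with θ' h h'
    rw [hG]
    exact gradVec_eq hk hα hβ (h.differentiableAt (by simp)) h'
  have hT : HasTDeriv (fun θ : MBar p k => euclGrad F θ.1) θ (repField V θ)
      (euclHess F θ.1 (repField V θ)) :=
    HasTDeriv.of_hasFDerivAt hd.hasFDerivAt (Filter.Eventually.of_forall fun _ => rfl) _
  rw [repField_nablaBar, ((hasTDeriv_gradFormula α β hT).congr hev).tderiv_eq (repField_mem V θ),
    hev.self_of_nhds]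
  exact hessFormula_eq α β (repField_mem V θ) _ _

/-- The gradient of a smooth function as a vector field. -/
def gradField (hk : 0 < k) (hα : 0 < α) (hβ : -(α / k) < β) (f : smoothBar p k) :
    (riemBar p k α β).VectorField :=
  mkField α β (gradVec α β f) (smooth_gradVec hk hα hβ f) (gradVec_mem f)

theorem repField_gradField (hk : 0 < k) (hα : 0 < α) (hβ : -(α / k) < β) (f : smoothBar p k)
    (θ : MBar p k) : repField (gradField hk hα hβ f) θ = gradVec α β f θ :=
  repField_mkField _ _ _ θ

/-- The formula is the value of the vector field ∇_V grad f, so tangency needs no matrix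
computation. -/
theorem hessFormula_mem (hk : 0 < k) (hα : 0 < α) (hβ : -(α / k) < β) (f : smoothBar p k)
    {θ : MBar p k} {F : Ambient p k → ℝ} (hF : ContDiffAt ℝ 2 F θ.1)
    (hFf : ∀ᶠ θ' : MBar p k in 𝓝 θ, f.1 θ' = F θ'.1) {ξ : Ambient p k} (hξ : ξ ∈ TBar θ.1) :
    hessFormula α β θ.1 ξ (euclGrad F θ.1) (euclHess F θ.1 ξ) ∈ TBar θ.1 := by
  obtain ⟨V, rfl⟩ := exists_field_eq α β hξ
  rw [← repField_nablaBar_grad hk hα hβ hF hFf (repField_gradField hk hα hβ f)]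
  exact repField_mem _ _

/-- Uniqueness of the connection and of the gradient forces the value, whatever fields realize
`IsHessianAt`; conversely `nablaBar`, the gradient field and an extension of ξ realize it. -/
theorem isHessianAt_riemBar (hk : 0 < k) (hα : 0 < α) (hβ : -(α / k) < β) (f : smoothBar p k)
    {θ : MBar p k} {F : Ambient p k → ℝ} (hF : ContDiffAt ℝ 2 F θ.1)
    (hFf : ∀ᶠ θ' : MBar p k in 𝓝 θ, f.1 θ' = F θ'.1) {ξ : Ambient p k} (hξ : ξ ∈ TBar θ.1)
    (ζ : smoothBar p k → ℝ) : (riemBar p k α β).IsHessianAt f θ (dirDeriv θ ξ) ζ ↔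
      ζ = dirDeriv θ (hessFormula α β θ.1 ξ (euclGrad F θ.1) (euclHess F θ.1 ξ)) := by
  constructor
  · rintro ⟨nabla, V, G, hLC, hG, hV, rfl⟩
    have hV' : repField V θ = ξ := rep_eq hξ hV.symm
    subst hV'
    have hG' : ∀ θ, repField G θ = gradVec α β f θ := fun θ' =>
      rep_eq (gradVec_mem f θ') ((isGradientAt_riemBar hk hα hβ f θ' _).1 (hG θ')).symm
    rw [(isRegular_riemBar hk hα hβ).isLeviCivita_unique hLC isLeviCivita_nablaBar,
      ← dirDeriv_repField, repField_nablaBar_grad hk hα hβ hF hFf hG']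
  · rintro rfl
    obtain ⟨V, rfl⟩ := exists_field_eq α β hξ
    refine ⟨nablaBar, V, gradField hk hα hβ f, isLeviCivita_nablaBar, fun θ' => ?_,
      (dirDeriv_repField V θ).symm, ?_⟩
    · rw [← dirDeriv_repField, repField_gradField]
      exact (isGradientAt_riemBar hk hα hβ f θ' _).2 rfl
    · rw [← dirDeriv_repField,
        repField_nablaBar_grad hk hα hβ hF hFf (repField_gradField hk hα hβ f)]

end

end FixedRank

namespace FixedRank

noncomputable section

variable {p k : ℕ} {α β : ℝ}

/-! ## The action of the unitary group -/

/-- The linear action of the unitary group on the ambient space. -/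
def actL (O : Matrix.unitaryGroup (Fin k) ℂ) : Ambient p k →ₗ[ℝ] Ambient p k where
  toFun ξ := (ξ.1 * O.1, O.1ᴴ * ξ.2 * O.1)
  map_add' ξ η := by
    simp only [Prod.fst_add, Prod.snd_add, Matrix.add_mul, Matrix.mul_add]; rfl
  map_smul' c ξ := by
    simp only [Prod.smul_fst, Prod.smul_snd, Matrix.smul_mul, Matrix.mul_smul]; rfl

theorem actL_apply (O : Matrix.unitaryGroup (Fin k) ℂ) (ξ : Ambient p k) :
    actL O ξ = (ξ.1 * O.1, O.1ᴴ * ξ.2 * O.1) := rfl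

theorem val_act (O : Matrix.unitaryGroup (Fin k) ℂ) (θ : MBar p k) :
    (act O θ).1 = actL O θ.1 := rfl

theorem unitary_ct_mul (O : Matrix.unitaryGroup (Fin k) ℂ) : O.1ᴴ * O.1 = 1 :=
  Matrix.mem_unitaryGroup_iff'.1 O.2

theorem unitary_mul_ct (O : Matrix.unitaryGroup (Fin k) ℂ) : O.1 * O.1ᴴ = 1 :=
  Matrix.mem_unitaryGroup_iff.1 O.2

theorem unitary_mul_ct_mul (O : Matrix.unitaryGroup (Fin k) ℂ) {n : ℕ}
    (Z : Matrix (Fin k) (Fin n) ℂ) : O.1 * (O.1ᴴ * Z) = Z := by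
  rw [← Matrix.mul_assoc, unitary_mul_ct, Matrix.one_mul]

theorem actL_inv_actL (O : Matrix.unitaryGroup (Fin k) ℂ) (ξ : Ambient p k) :
    actL O⁻¹ (actL O ξ) = ξ := by
  have hi : (O⁻¹).1 = O.1ᴴ := rfl
  refine Prod.ext ?_ ?_ <;>
  simp only [actL_apply, hi, Matrix.conjTranspose_conjTranspose, Matrix.mul_assoc, unitary_mul_ct,
    Matrix.mul_one, unitary_mul_ct_mul]

theorem actL_actL_inv (O : Matrix.unitaryGroup (Fin k) ℂ) (ξ : Ambient p k) :
    actL O (actL O⁻¹ ξ) = ξ := by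
  have := actL_inv_actL O⁻¹ ξ
  rwa [inv_inv] at this

theorem actL_mem (O : Matrix.unitaryGroup (Fin k) ℂ) {θ ξ : Ambient p k} (hξ : ξ ∈ TBar θ) :
    actL O ξ ∈ TBar (actL O θ) := by
  constructor
  · calc (θ.1 * O.1)ᴴ * (ξ.1 * O.1) + (ξ.1 * O.1)ᴴ * (θ.1 * O.1)
        = O.1ᴴ * (θ.1ᴴ * ξ.1 + ξ.1ᴴ * θ.1) * O.1 := by
          simp only [Matrix.conjTranspose_mul, Matrix.mul_assoc, Matrix.mul_add, Matrix.add_mul]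
      _ = 0 := by rw [hξ.1, Matrix.mul_zero, Matrix.zero_mul]
  · simp only [actL_apply, Matrix.conjTranspose_mul, Matrix.conjTranspose_conjTranspose, hξ.2,
      Matrix.mul_assoc]

theorem actL_inv_mem (O : Matrix.unitaryGroup (Fin k) ℂ) {θ : MBar p k} {ξ : Ambient p k}
    (hξ : ξ ∈ TBar (act O θ).1) : actL O⁻¹ ξ ∈ TBar θ.1 := by
  have := actL_mem O⁻¹ hξ
  rwa [val_act, actL_inv_actL] at this

theorem actL_invSigma (O : Matrix.unitaryGroup (Fin k) ℂ) (θ : MBar p k) :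
    (actL O θ.1).2⁻¹ = O.1ᴴ * θ.1.2⁻¹ * O.1 := by
  have hdet : IsUnit θ.1.2.det := (Matrix.isUnit_iff_isUnit_det _).1 (MBar.isUnit θ)
  refine Matrix.inv_eq_right_inv ?_
  simp only [actL_apply, Matrix.mul_assoc, unitary_mul_ct_mul,
    Matrix.mul_nonsing_inv_cancel_left _ _ hdet, unitary_ct_mul]

theorem metricBar_actL (α β : ℝ) (O : Matrix.unitaryGroup (Fin k) ℂ) (θ : MBar p k)
    (ξ η : Ambient p k) :
    metricBar α β (act O θ).1 (actL O ξ) (actL O η) = metricBar α β θ.1 ξ η := by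
  have hc : ∀ Z : Matrix (Fin k) (Fin k) ℂ, reTr k (O.1ᴴ * (Z * O.1)) = reTr k Z := fun Z => by
    rw [reTr_comm, Matrix.mul_assoc, unitary_mul_ct, Matrix.mul_one]
  have h1 : (actL O ξ).1ᴴ * (actL O η).1 = O.1ᴴ * (ξ.1ᴴ * η.1 * O.1) := by
    simp only [actL_apply, Matrix.conjTranspose_mul, Matrix.mul_assoc]
  have h2 : (actL O ξ).1ᴴ * (actL O θ.1).1 * ((actL O θ.1).1ᴴ * (actL O η).1)
      = O.1ᴴ * (ξ.1ᴴ * θ.1.1 * (θ.1.1ᴴ * η.1) * O.1) := by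
    simp only [actL_apply, Matrix.conjTranspose_mul, Matrix.mul_assoc, unitary_mul_ct_mul]
  have h3 : ∀ ζ : Ambient p k, (actL O θ.1).2⁻¹ * (actL O ζ).2
      = O.1ᴴ * (θ.1.2⁻¹ * ζ.2 * O.1) := fun ζ => by
    rw [actL_invSigma]
    simp only [actL_apply, Matrix.mul_assoc, unitary_mul_ct_mul]
  have h4 : O.1ᴴ * (θ.1.2⁻¹ * ξ.2 * O.1) * (O.1ᴴ * (θ.1.2⁻¹ * η.2 * O.1))
      = O.1ᴴ * (θ.1.2⁻¹ * ξ.2 * (θ.1.2⁻¹ * η.2) * O.1) := by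
    simp only [Matrix.mul_assoc, unitary_mul_ct_mul]
  rw [metricBar_eq, metricBar_eq, val_act, h1, h2, h3, h3, h4, hc, hc, hc, hc, hc]

theorem christoffel_actL (O : Matrix.unitaryGroup (Fin k) ℂ) (θ : MBar p k) (ξ η : Ambient p k) :
    christoffel (act O θ).1 (actL O ξ) (actL O η) = actL O (christoffel θ.1 ξ η) := by
  have h := actL_invSigma O θ
  rw [val_act]
  refine Prod.ext ?_ ?_
  · simp only [christoffel, actL_apply, Matrix.conjTranspose_mul, Matrix.mul_assoc, Matrix.mul_add,
      Matrix.add_mul, unitary_mul_ct_mul, Matrix.smul_mul, Matrix.sub_mul]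
  · rw [christoffel, h]
    simp only [christoffel, actL_apply, Matrix.mul_assoc, Matrix.mul_add,
      Matrix.add_mul, unitary_mul_ct_mul, Matrix.smul_mul, Matrix.mul_smul]

theorem IsCurve.act {c : ℝ → MBar p k} {θ : MBar p k} {ξ : Ambient p k} (hc : IsCurve c θ ξ)
    (O : Matrix.unitaryGroup (Fin k) ℂ) :
    IsCurve (fun t => FixedRank.act O (c t)) (FixedRank.act O θ) (actL O ξ) :=
  ⟨congrArg (FixedRank.act O) hc.1,
    (LinearMap.toContinuousLinearMap (actL O)).hasFDerivAt.comp_hasDerivAt (0 : ℝ) hc.2⟩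

/-- The action carries a curve of velocity ξ to one of velocity `actL O ξ`, along which v takes the
same values. -/
theorem tderiv_invariant {E : Type*} [NormedAddCommGroup E] [NormedSpace ℝ E] {v : MBar p k → E}
    (hv : SmoothMap v) (O : Matrix.unitaryGroup (Fin k) ℂ) (h : ∀ θ, v (act O θ) = v θ)
    {θ : MBar p k} {ξ : Ambient p k} (hξ : ξ ∈ TBar θ.1) :
    tderiv v (act O θ) (actL O ξ) = tderiv v θ ξ := by
  have h1 : HasTDeriv v θ ξ (tderiv v (act O θ) (actL O ξ)) := fun c hc => by
    have := hv.hasTDeriv (act O θ) (actL O ξ) _ (hc.act O)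
    simpa only [h] using this
  exact (h1.tderiv_eq hξ).symm

theorem tderiv_equivariant {v : MBar p k → Ambient p k} (hv : SmoothMap v)
    (O : Matrix.unitaryGroup (Fin k) ℂ) (h : ∀ θ, v (act O θ) = actL O (v θ))
    {θ : MBar p k} {ξ : Ambient p k} (hξ : ξ ∈ TBar θ.1) :
    tderiv v (act O θ) (actL O ξ) = actL O (tderiv v θ ξ) := by
  have h1 : HasTDeriv (fun θ => actL O (v θ)) θ ξ (tderiv v (act O θ) (actL O ξ)) := fun c hc => by
    have := hv.hasTDeriv (act O θ) (actL O ξ) _ (hc.act O)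
    simpa only [h] using this
  have h2 : HasTDeriv (fun θ => actL O (v θ)) θ ξ (actL O (tderiv v θ ξ)) :=
    (hv.hasTDeriv θ ξ).clm (LinearMap.toContinuousLinearMap (actL O))
  exact h1.unique hξ h2

/-! ## Vertical and horizontal vectors -/

/-- The vertical vector `(U Ω, Σ Ω - Ω Σ)`. -/
def vert (θ : Ambient p k) (Ω : Matrix (Fin k) (Fin k) ℂ) : Ambient p k :=
  (θ.1 * Ω, θ.2 * Ω - Ω * θ.2)

theorem vert_mem_VBar (θ : Ambient p k) {Ω : Matrix (Fin k) (Fin k) ℂ} (hΩ : Ωᴴ = -Ω) :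
    vert θ Ω ∈ VBar θ := ⟨Ω, hΩ, rfl⟩

theorem vert_mem (θ : MBar p k) {Ω : Matrix (Fin k) (Fin k) ℂ} (hΩ : Ωᴴ = -Ω) :
    vert θ.1 Ω ∈ TBar θ.1 := by
  have hSh : θ.1.2ᴴ = θ.1.2 := θ.2.2.isHermitian
  constructor
  · simp only [vert, Matrix.conjTranspose_mul, hΩ, Matrix.neg_mul, Matrix.mul_assoc, θ.2.1,
      Matrix.mul_one]
    rw [← Matrix.mul_assoc, θ.2.1, Matrix.one_mul]
    abel
  · simp only [vert, Matrix.conjTranspose_sub, Matrix.conjTranspose_mul, hΩ, hSh, Matrix.neg_mul,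
      Matrix.mul_neg]
    abel

/-- Conjugation by O preserves skew-Hermitian matrices, so the action carries vertical spaces to
vertical spaces. -/
theorem actL_vert (O : Matrix.unitaryGroup (Fin k) ℂ) (θ : Ambient p k)
    (Ω : Matrix (Fin k) (Fin k) ℂ) :
    actL O⁻¹ (vert (actL O θ) Ω) = vert θ (O.1 * Ω * O.1ᴴ) := by
  have hi : (O⁻¹).1 = O.1ᴴ := rfl
  refine Prod.ext ?_ ?_ <;>
  simp only [vert, actL_apply, hi, Matrix.conjTranspose_conjTranspose, Matrix.mul_assoc,
    Matrix.mul_sub, Matrix.sub_mul, unitary_mul_ct_mul, unitary_mul_ct, Matrix.mul_one]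

theorem HBar.sub {θ ξ η : Ambient p k} (hξ : ξ ∈ HBar α β θ) (hη : η ∈ HBar α β θ) :
    ξ - η ∈ HBar α β θ :=
  ⟨sub_mem hξ.1 hη.1, fun ζ hζ => by rw [metricBar_sub_left, hξ.2 ζ hζ, hη.2 ζ hζ, sub_zero]⟩

theorem HBar.add {θ ξ η : Ambient p k} (hξ : ξ ∈ HBar α β θ) (hη : η ∈ HBar α β θ) :
    ξ + η ∈ HBar α β θ :=
  ⟨add_mem hξ.1 hη.1, fun ζ hζ => by rw [metricBar_add_left, hξ.2 ζ hζ, hη.2 ζ hζ, add_zero]⟩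

theorem HBar.smul {θ ξ : Ambient p k} (c : ℝ) (hξ : ξ ∈ HBar α β θ) : c • ξ ∈ HBar α β θ :=
  ⟨Submodule.smul_mem _ c hξ.1, fun ζ hζ => by rw [metricBar_smul_left, hξ.2 ζ hζ, mul_zero]⟩

theorem HBar.actL (O : Matrix.unitaryGroup (Fin k) ℂ) {θ : MBar p k} {ξ : Ambient p k}
    (hξ : ξ ∈ HBar α β θ.1) : FixedRank.actL O ξ ∈ HBar α β (act O θ).1 := by
  refine ⟨actL_mem O hξ.1, ?_⟩
  rintro η ⟨Ω, hΩ, rfl⟩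
  have h : vert (act O θ).1 Ω = FixedRank.actL O (vert θ.1 (O.1 * Ω * O.1ᴴ)) := by
    rw [← actL_vert, actL_actL_inv, val_act]
  change metricBar α β (act O θ).1 (FixedRank.actL O ξ) (vert (act O θ).1 Ω) = 0
  rw [h, metricBar_actL]
  refine hξ.2 _ (vert_mem_VBar _ ?_)
  simp only [Matrix.conjTranspose_mul, Matrix.conjTranspose_conjTranspose, hΩ, Matrix.neg_mul,
    Matrix.mul_neg, Matrix.mul_assoc]

/-- A horizontal vertical vector vanishes. -/
theorem eq_zero_of_mem_HBar_of_mem_VBar (hk : 0 < k) (hα : 0 < α) (hβ : -(α / k) < β)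
    {θ : MBar p k} {ξ : Ambient p k} (h : ξ ∈ HBar α β θ.1) (hv : ξ ∈ VBar θ.1) : ξ = 0 :=
  metricBar_self_pos hk hα hβ θ h.1 (h.2 ξ hv)

/-- The defect of horizontality. -/
def horDefect (α : ℝ) (θ ξ : Ambient p k) : Matrix (Fin k) (Fin k) ℂ :=
  (1 / 2 : ℝ) • (θ.1ᴴ * ξ.1) - α • (θ.2⁻¹ * ξ.2 - ξ.2 * θ.2⁻¹)

theorem conjTranspose_horDefect (α : ℝ) {θ : MBar p k} {ξ : Ambient p k} (hξ : ξ ∈ TBar θ.1) :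
    (horDefect α θ.1 ξ)ᴴ = -horDefect α θ.1 ξ := by
  have hSh : θ.1.2ᴴ = θ.1.2 := θ.2.2.isHermitian
  have h1 : ξ.1ᴴ * θ.1.1 = -(θ.1.1ᴴ * ξ.1) := eq_neg_of_add_eq_zero_right hξ.1
  simp only [horDefect, Matrix.conjTranspose_sub, Matrix.conjTranspose_smul,
    Matrix.conjTranspose_mul, Matrix.conjTranspose_conjTranspose, Matrix.conjTranspose_nonsing_inv,
    hSh, hξ.2, h1, star_trivial]
  module

/-- The β-term disappears because Σ⁻¹(ΣΩ - ΩΣ) has trace zero; cyclicity of the trace collects the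
rest into one matrix paired with Ω. Thus a vanishing defect implies horizontality. -/
theorem metricBar_vert (α β : ℝ) {θ : MBar p k} {ξ : Ambient p k} (hξ : ξ ∈ TBar θ.1)
    (Ω : Matrix (Fin k) (Fin k) ℂ) :
    metricBar α β θ.1 ξ (vert θ.1 Ω) = -reTr k (horDefect α θ.1 ξ * Ω) := by
  obtain ⟨⟨U, S⟩, hU, hS⟩ := θ
  obtain ⟨h1, h2⟩ := hξ
  simp only at hU hS h1 h2
  have h1' : ξ.1ᴴ * U = -(Uᴴ * ξ.1) := eq_neg_of_add_eq_zero_right h1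
  have hdet : IsUnit S.det := (Matrix.isUnit_iff_isUnit_det _).1 hS.isUnit
  have e0 : S⁻¹ * (S * Ω - Ω * S) = Ω - S⁻¹ * (Ω * S) := by
    rw [Matrix.mul_sub, Matrix.nonsing_inv_mul_cancel_left _ _ hdet]
  have e1 : reTr k (S⁻¹ * (Ω * S)) = reTr k Ω := by
    rw [reTr_comm, Matrix.mul_assoc, Matrix.mul_nonsing_inv _ hdet, Matrix.mul_one]
  have e2 : reTr k (S⁻¹ * ξ.2 * (S⁻¹ * (Ω * S))) = reTr k (ξ.2 * S⁻¹ * Ω) := by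
    have : S⁻¹ * ξ.2 * (S⁻¹ * (Ω * S)) = S⁻¹ * (ξ.2 * S⁻¹ * Ω * S) := by
      simp only [Matrix.mul_assoc]
    rw [this, reTr_comm, Matrix.mul_assoc, Matrix.mul_nonsing_inv _ hdet, Matrix.mul_one]
  have e3 : ξ.1ᴴ * (U * Ω) = -(Uᴴ * ξ.1 * Ω) := by
    rw [← Matrix.mul_assoc, h1', Matrix.neg_mul]
  have e4 : Uᴴ * (U * Ω) = Ω := by rw [← Matrix.mul_assoc, hU, Matrix.one_mul]
  rw [metricBar_eq]
  simp only [vert, horDefect, e0, e3, e4, h1', Matrix.sub_mul, Matrix.mul_sub, Matrix.smul_mul,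
    map_sub, map_neg, map_smul, e1, e2, Matrix.neg_mul, smul_eq_mul]
  ring

theorem mem_HBar_of_horDefect {θ : MBar p k} {ξ : Ambient p k} (hξ : ξ ∈ TBar θ.1)
    (h : horDefect α θ.1 ξ = 0) : ξ ∈ HBar α β θ.1 := by
  refine ⟨hξ, ?_⟩
  rintro η ⟨Ω, hΩ, rfl⟩
  have := metricBar_vert α β hξ Ω
  rwa [h, Matrix.zero_mul, map_zero, neg_zero] at this

/-- The linear operator `Ω ↦ horDefect (vert Ω)`. -/
def vertOp (α : ℝ) (θ : Ambient p k) :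
    Matrix (Fin k) (Fin k) ℂ →ₗ[ℂ] Matrix (Fin k) (Fin k) ℂ where
  toFun Ω := (1 / 2 : ℂ) • Ω - (α : ℂ) • ((2 : ℂ) • Ω - θ.2⁻¹ * (Ω * θ.2) - θ.2 * (Ω * θ.2⁻¹))
  map_add' A B := by
    simp only [Matrix.add_mul, Matrix.mul_add]
    module
  map_smul' c A := by
    simp only [Matrix.smul_mul, Matrix.mul_smul, RingHom.id_apply]
    module

theorem horDefect_vert (α : ℝ) (θ : MBar p k) (Ω : Matrix (Fin k) (Fin k) ℂ) :
    horDefect α θ.1 (vert θ.1 Ω) = vertOp α θ.1 Ω := by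
  have hdet : IsUnit θ.1.2.det := (Matrix.isUnit_iff_isUnit_det _).1 (MBar.isUnit θ)
  have e : θ.1.1ᴴ * (θ.1.1 * Ω) = Ω := by rw [← Matrix.mul_assoc, θ.2.1, Matrix.one_mul]
  change _ = (1 / 2 : ℂ) • Ω
    - (α : ℂ) • ((2 : ℂ) • Ω - θ.1.2⁻¹ * (Ω * θ.1.2) - θ.1.2 * (Ω * θ.1.2⁻¹))
  rw [half_smul, Complex.coe_smul]
  simp only [horDefect, vert, e, Matrix.mul_sub, Matrix.sub_mul, Matrix.mul_assoc,
    Matrix.nonsing_inv_mul_cancel_left _ _ hdet, Matrix.mul_nonsing_inv _ hdet, Matrix.mul_one]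
  congr 2
  module

theorem vertOp_conjTranspose (α : ℝ) (θ : MBar p k) (Ω : Matrix (Fin k) (Fin k) ℂ) :
    vertOp α θ.1 Ωᴴ = (vertOp α θ.1 Ω)ᴴ := by
  have hSh : θ.1.2ᴴ = θ.1.2 := θ.2.2.isHermitian
  have h1 : star (1 / 2 : ℂ) = 1 / 2 := by simp
  have h2 : star (α : ℂ) = α := Complex.conj_ofReal α
  have h3 : star (2 : ℂ) = 2 := by simp
  simp only [vertOp, LinearMap.coe_mk, AddHom.coe_mk, Matrix.conjTranspose_sub,
    Matrix.conjTranspose_smul, Matrix.conjTranspose_mul, Matrix.conjTranspose_nonsing_inv, hSh,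
    h1, h2, h3, Matrix.mul_assoc]
  congr 2
  abel

/-- For skew-Hermitian Ω in the kernel, `vert Ω` is both vertical and horizontal, hence zero, and Uᴴ
U = 1 gives Ω = 0. The operator is ℂ-linear and commutes with conjugate transposition, so a general
Ω reduces to the skew-Hermitian matrices Ω - Ωᴴ and i(Ω + Ωᴴ). -/
theorem vertOp_injective (hk : 0 < k) (hα : 0 < α) (hβ : -(α / k) < β) (θ : MBar p k) :
    Function.Injective (vertOp α θ.1) := by
  have hskew : ∀ Ω : Matrix (Fin k) (Fin k) ℂ, Ωᴴ = -Ω → vertOp α θ.1 Ω = 0 → Ω = 0 := by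
    intro Ω hΩ h
    rw [← horDefect_vert] at h
    have h0 := eq_zero_of_mem_HBar_of_mem_VBar hk hα hβ
      (mem_HBar_of_horDefect (β := β) (vert_mem θ hΩ) h) (vert_mem_VBar _ hΩ)
    have h1 : θ.1.1 * Ω = 0 := congrArg Prod.fst h0
    have h2 := congrArg (θ.1.1ᴴ * ·) h1
    simpa only [← Matrix.mul_assoc, θ.2.1, Matrix.one_mul, Matrix.mul_zero] using h2
  rw [injective_iff_map_eq_zero]
  intro Ω hΩ
  have hH : vertOp α θ.1 Ωᴴ = 0 := by
    rw [vertOp_conjTranspose, hΩ, Matrix.conjTranspose_zero]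
  have h1 : Ω - Ωᴴ = 0 := by
    refine hskew _ ?_ (by rw [map_sub, hΩ, hH, sub_zero])
    simp
  have h2 : Complex.I • (Ω + Ωᴴ) = 0 := by
    refine hskew _ ?_ (by rw [map_smul, map_add, hΩ, hH, add_zero, smul_zero])
    simp [Matrix.conjTranspose_smul, add_comm]
  have h3 : Ω + Ωᴴ = 0 := (smul_eq_zero.1 h2).resolve_left Complex.I_ne_zero
  have h4 : (2 : ℂ) • Ω = 0 := by
    rw [two_smul]
    calc Ω + Ω = (Ω - Ωᴴ) + (Ω + Ωᴴ) := by abel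
      _ = 0 := by rw [h1, h3, add_zero]
  exact (smul_eq_zero.1 h4).resolve_left two_ne_zero

/-- The skew-Hermitian matrix which defines the vertical part of a vector. -/
def vertCoord (α : ℝ) (θ ξ : Ambient p k) : Matrix (Fin k) (Fin k) ℂ :=
  Function.invFun (vertOp α θ) (horDefect α θ ξ)

/-- An injective endomorphism of a finite-dimensional space is surjective, so the inverse function
really solves the equation. -/
theorem vertOp_vertCoord (hk : 0 < k) (hα : 0 < α) (hβ : -(α / k) < β) (θ : MBar p k)
    (ξ : Ambient p k) : vertOp α θ.1 (vertCoord α θ.1 ξ) = horDefect α θ.1 ξ :=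
  Function.invFun_eq (LinearMap.injective_iff_surjective.1 (vertOp_injective hk hα hβ θ) _)

/-- The right-hand side is skew-Hermitian and the operator commutes with conjugate transposition, so
uniqueness makes the solution skew-Hermitian. -/
theorem conjTranspose_vertCoord (hk : 0 < k) (hα : 0 < α) (hβ : -(α / k) < β) {θ : MBar p k}
    {ξ : Ambient p k} (hξ : ξ ∈ TBar θ.1) : (vertCoord α θ.1 ξ)ᴴ = -vertCoord α θ.1 ξ := by
  refine vertOp_injective hk hα hβ θ ?_
  rw [vertOp_conjTranspose, map_neg, vertOp_vertCoord hk hα hβ, conjTranspose_horDefect α hξ]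

/-- The horizontal part of a vector. -/
def horPart (α : ℝ) (θ ξ : Ambient p k) : Ambient p k := ξ - vert θ (vertCoord α θ ξ)

theorem horPart_mem (hk : 0 < k) (hα : 0 < α) (hβ : -(α / k) < β) {θ : MBar p k}
    {ξ : Ambient p k} (hξ : ξ ∈ TBar θ.1) : horPart α θ.1 ξ ∈ HBar α β θ.1 := by
  refine mem_HBar_of_horDefect
    (sub_mem hξ (vert_mem θ (conjTranspose_vertCoord hk hα hβ hξ))) ?_
  have h : ∀ η : Ambient p k, horDefect α θ.1 (ξ - η) = horDefect α θ.1 ξ - horDefect α θ.1 η := by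
    intro η
    simp only [horDefect, Prod.fst_sub, Prod.snd_sub, Matrix.mul_sub, Matrix.sub_mul]
    module
  rw [horPart, h, horDefect_vert, vertOp_vertCoord hk hα hβ, sub_self]

/-- The explicit horizontal part has the property by which the projection is chosen, and
definiteness leaves no other candidate. -/
theorem horProj_eq (hk : 0 < k) (hα : 0 < α) (hβ : -(α / k) < β) {θ : MBar p k}
    {ξ : Ambient p k} (hξ : ξ ∈ TBar θ.1) : horProj α β θ.1 ξ = horPart α θ.1 ξ := by
  have hP := horPart_mem hk hα hβ hξ
  have hs := conjTranspose_vertCoord hk hα hβ hξ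
  have hex : ∀ η ∈ HBar α β θ.1, metricBar α β θ.1 (ξ - horPart α θ.1 ξ) η = 0 := by
    intro η hη
    rw [horPart, sub_sub_cancel, metricBar_symm]
    exact hη.2 _ (vert_mem_VBar _ hs)
  have h : ∃ ζ ∈ HBar α β θ.1, ∀ η ∈ HBar α β θ.1, metricBar α β θ.1 (ξ - ζ) η = 0 :=
    ⟨_, hP, hex⟩
  rw [horProj, dif_pos h]
  obtain ⟨h1, h2⟩ := Classical.choose_spec h
  have hd := HBar.sub h1 hP
  refine sub_eq_zero.1 (metricBar_self_pos hk hα hβ θ hd.1 ?_)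
  have a1 := hex _ hd
  have a2 := h2 _ hd
  rw [metricBar_sub_left] at a1 a2 ⊢
  linarith

/-! ## Smoothness of the horizontal part -/

/-- Solutions of smooth families of uniquely solvable linear equations are smooth. -/
theorem SmoothMap.of_linear_equation {E : Type*} [NormedAddCommGroup E] [NormedSpace ℝ E]
    [FiniteDimensional ℝ E] {L : MBar p k → E →ₗ[ℝ] E} (hL : ∀ e, SmoothMap fun θ => L θ e)
    (hinj : ∀ θ, Function.Injective (L θ)) {x y : MBar p k → E} (hy : SmoothMap y)
    (hxy : ∀ θ, L θ (x θ) = y θ) : SmoothMap x := by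
  have hc : CompleteSpace E := FiniteDimensional.complete ℝ E
  let b := Module.finBasis ℝ E
  -- Writing the operator as a sum of rank-one operators over a basis upgrades smoothness of each L
  -- θ e to smoothness of θ ↦ L θ as a map into operators.
  have hs : ∀ s : Finset (Fin (Module.finrank ℝ E)), SmoothMap fun θ =>
      ∑ i ∈ s, (LinearMap.toContinuousLinearMap (b.coord i)).smulRight (L θ (b i)) := by
    intro s
    induction s using Finset.induction_on with
    | empty => simpa using SmoothMap.const (0 : E →L[ℝ] E)
    | insert i s hi ih =>
      simp only [Finset.sum_insert hi]
      exact ((hL (b i)).clm (ContinuousLinearMap.smulRightL ℝ E E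
        (LinearMap.toContinuousLinearMap (b.coord i)))).add ih
  have he : (fun θ => LinearMap.toContinuousLinearMap (L θ)) = fun θ =>
      ∑ i, (LinearMap.toContinuousLinearMap (b.coord i)).smulRight (L θ (b i)) := by
    funext θ
    ext e
    simp only [sum_apply, ContinuousLinearMap.smulRight_apply]
    change L θ e = ∑ i, b.coord i e • L θ (b i)
    conv_lhs => rw [← b.sum_repr e, map_sum]
    simp
  have hLs : SmoothMap fun θ => LinearMap.toContinuousLinearMap (L θ) := by
    rw [he]; exact hs _
  let eq : MBar p k → (E ≃L[ℝ] E) := fun θ =>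
    (LinearEquiv.ofInjectiveEndo (L θ) (hinj θ)).toContinuousLinearEquiv
  have heq : ∀ θ, ((eq θ : E ≃L[ℝ] E) : E →L[ℝ] E) = LinearMap.toContinuousLinearMap (L θ) := by
    intro θ; ext e; rfl
  -- Operator inversion is smooth on the open set of invertible operators, and x θ is the inverse
  -- applied to y θ.
  have hinv := hLs.comp_on (g := ContinuousLinearMap.inverse)
    (O := Set.range ((↑) : (E ≃L[ℝ] E) → E →L[ℝ] E)) ContinuousLinearEquiv.isOpen (by
      rintro _ ⟨e, rfl⟩
      exact (contDiffAt_map_inverse e).contDiffWithinAt) fun θ => ⟨eq θ, heq θ⟩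
  have hx : x = fun θ => ContinuousLinearMap.inverse (LinearMap.toContinuousLinearMap (L θ)) (y θ) := by
    funext θ
    rw [← heq, ContinuousLinearMap.inverse_equiv, ← hxy]
    exact ((eq θ).symm_apply_apply (x θ)).symm
  rw [hx]
  exact SmoothMap.bilin (ContinuousLinearMap.id ℝ (E →L[ℝ] E)) hinv hy

/-- The matrix Ω of the vertical part solves a linear equation whose coefficients and right-hand
side are smooth in θ. -/
theorem smooth_horPart (hk : 0 < k) (hα : 0 < α) (hβ : -(α / k) < β)
    {v : MBar p k → Ambient p k} (hv : SmoothMap v) :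
    SmoothMap fun θ => horPart α θ.1 (v θ) := by
  have hU : SmoothMap fun θ : MBar p k => θ.1.1 := SmoothMap.val.fst
  have hS : SmoothMap fun θ : MBar p k => θ.1.2 := SmoothMap.val.snd
  have hI := smooth_invSigma (p := p) (k := k)
  have hN : SmoothMap fun θ => horDefect α θ.1 (v θ) :=
    ((hU.ct.mul hv.fst).rsmul _).sub (((hI.mul hv.snd).sub (hv.snd.mul hI)).rsmul _)
  have hL : ∀ e, SmoothMap fun θ : MBar p k => ((vertOp α θ.1).restrictScalars ℝ) e := by
    intro e
    have he := SmoothMap.const (p := p) (k := k) e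
    have h : SmoothMap fun θ : MBar p k => (1 / 2 : ℝ) • e
        - α • ((2 : ℝ) • e - θ.1.2⁻¹ * (e * θ.1.2) - θ.1.2 * (e * θ.1.2⁻¹)) :=
      (he.rsmul _).sub ((((he.rsmul _).sub (hI.mul (he.mul hS))).sub
        (hS.mul (he.mul hI))).rsmul _)
    have e1 : (fun θ : MBar p k => ((vertOp α θ.1).restrictScalars ℝ) e)
        = fun θ : MBar p k => (1 / 2 : ℝ) • e
        - α • ((2 : ℝ) • e - θ.1.2⁻¹ * (e * θ.1.2) - θ.1.2 * (e * θ.1.2⁻¹)) := by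
      funext θ
      change (1 / 2 : ℂ) • e
        - (α : ℂ) • ((2 : ℂ) • e - θ.1.2⁻¹ * (e * θ.1.2) - θ.1.2 * (e * θ.1.2⁻¹)) = _
      rw [half_smul, Complex.coe_smul, two_smul, two_smul]
    rw [e1]
    exact h
  have hΩ : SmoothMap fun θ => vertCoord α θ.1 (v θ) :=
    SmoothMap.of_linear_equation hL (fun θ => vertOp_injective hk hα hβ θ) hN
      fun θ => vertOp_vertCoord hk hα hβ θ (v θ)
  exact hv.sub ((hU.mul hΩ).prodMk ((hS.mul hΩ).sub (hΩ.mul hS)))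

end

end FixedRank

namespace FixedRank

noncomputable section

variable {p k : ℕ} {α β : ℝ}

/-! ## The differential of the projection -/

theorem proj_act (O : Matrix.unitaryGroup (Fin k) ℂ) (θ : MBar p k) : proj (act O θ) = proj θ :=
  (Quotient.sound (s := orbitSetoid p k) ⟨O, rfl⟩).symm

theorem exists_act_of_proj_eq {θ θ' : MBar p k} (h : proj θ' = proj θ) : ∃ O, θ' = act O θ :=
  Quotient.exact (s := orbitSetoid p k) h.symm

theorem proj_out (x : MQuot p k) : proj (Quotient.out x) = x := Quotient.out_eq x

/-- The pull-back of a smooth function on the quotient. -/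
def pull (f : smoothQuot p k) : smoothBar p k := ⟨f.1 ∘ proj, f.2⟩

theorem smooth_pull (f : smoothQuot p k) : SmoothMap (pull f).1 := f.2

theorem dproj_apply (θ : MBar p k) (ξ : Ambient p k) (f : smoothQuot p k) :
    dproj θ ξ f = dirDeriv θ ξ (pull f) := rfl

theorem pull_act (f : smoothQuot p k) (O : Matrix.unitaryGroup (Fin k) ℂ) (θ : MBar p k) :
    (pull f).1 (act O θ) = (pull f).1 θ := congrArg f.1 (proj_act O θ)

theorem actL_mem_TBar_act (O : Matrix.unitaryGroup (Fin k) ℂ) {θ : MBar p k} {ξ : Ambient p k}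
    (hξ : ξ ∈ TBar θ.1) : actL O ξ ∈ TBar (act O θ).1 := by
  rw [val_act]
  exact actL_mem O hξ

theorem dirDeriv_actL (O : Matrix.unitaryGroup (Fin k) ℂ) (f : smoothBar p k)
    (hf : ∀ θ : MBar p k, f.1 (act O θ) = f.1 θ) {θ : MBar p k} {ξ : Ambient p k}
    (hξ : ξ ∈ TBar θ.1) : dirDeriv (act O θ) (actL O ξ) f = dirDeriv θ ξ f := by
  have hs : SmoothMap f.1 := f.2
  rw [dirDeriv_eq_tderiv f (actL_mem_TBar_act O hξ), dirDeriv_eq_tderiv f hξ,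
    tderiv_invariant hs O hf hξ]

theorem dproj_actL (O : Matrix.unitaryGroup (Fin k) ℂ) {θ : MBar p k} {ξ : Ambient p k}
    (hξ : ξ ∈ TBar θ.1) : dproj (act O θ) (actL O ξ) = dproj θ ξ :=
  funext fun f => dirDeriv_actL O (pull f) (pull_act f O) hξ

theorem exp_smul_mem_unitaryGroup {Ω : Matrix (Fin k) (Fin k) ℂ} (hΩ : Ωᴴ = -Ω) (t : ℝ) :
    NormedSpace.exp (t • Ω) ∈ Matrix.unitaryGroup (Fin k) ℂ := by
  rw [Matrix.mem_unitaryGroup_iff', Matrix.star_eq_conjTranspose, ← Matrix.exp_conjTranspose,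
    Matrix.conjTranspose_smul, hΩ, star_trivial, smul_neg, Matrix.exp_neg]
  exact Matrix.nonsing_inv_mul _ ((Matrix.isUnit_iff_isUnit_det _).1 (Matrix.isUnit_exp _))

theorem hasDerivAt_vertical (θ : Ambient p k) {Ω : Matrix (Fin k) (Fin k) ℂ} (hΩ : Ωᴴ = -Ω) :
    HasDerivAt (fun t : ℝ => ((θ.1 * NormedSpace.exp (t • Ω),
      (NormedSpace.exp (t • Ω))ᴴ * θ.2 * NormedSpace.exp (t • Ω)) : Ambient p k)) (vert θ Ω) 0 := by
  have h := hasDerivAt_exp_smul k Ω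
  have h1 := (hasDerivAt_const (0 : ℝ) θ.1).matmul h
  have h2 := (h.matct.matmul (hasDerivAt_const (0 : ℝ) θ.2)).matmul h
  refine (h1.prodMk h2).congr_deriv ?_
  simp only [vert, zero_smul, NormedSpace.exp_zero, Matrix.conjTranspose_one, Matrix.one_mul,
    Matrix.mul_one, hΩ, Matrix.neg_mul, Matrix.mul_zero, zero_add, add_zero]
  refine Prod.ext ?_ ?_
  · simp
  change -(Ω * θ.2) + θ.2 * Ω = θ.2 * Ω - Ω * θ.2
  abel

theorem exists_vertical_curve (θ : MBar p k) {Ω : Matrix (Fin k) (Fin k) ℂ} (hΩ : Ωᴴ = -Ω) :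
    ∃ c : ℝ → MBar p k, IsCurve c θ (vert θ.1 Ω) ∧ ∀ t, proj (c t) = proj θ := by
  refine ⟨fun t => act ⟨_, exp_smul_mem_unitaryGroup hΩ t⟩ θ, ⟨?_, ?_⟩, fun t => proj_act _ θ⟩
  · apply Subtype.ext
    simp [act]
  · exact hasDerivAt_vertical θ.1 hΩ

/-- A function pulled back from the quotient is constant along the orbit curve t ↦ θ · exp(tΩ). -/
theorem dproj_vert (θ : MBar p k) {Ω : Matrix (Fin k) (Fin k) ℂ} (hΩ : Ωᴴ = -Ω) :
    dproj θ (vert θ.1 Ω) = 0 := by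
  funext f
  obtain ⟨c, hc, hcp⟩ := exists_vertical_curve θ hΩ
  have h1 := hasTDeriv_dirDeriv (pull f) θ (vert θ.1 Ω) c hc
  have h2 : (fun t => (pull f).1 (c t)) = fun _ => f.1 (proj θ) :=
    funext fun t => congrArg f.1 (hcp t)
  rw [h2] at h1
  exact h1.unique (hasDerivAt_const (0 : ℝ) _)

/-- The invariant pair `(U Uᴴ, U Σ Uᴴ)`. -/
def invPair (θ : MBar p k) : Ambient p p := (θ.1.1 * θ.1.1ᴴ, θ.1.1 * θ.1.2 * θ.1.1ᴴ)

theorem invPair_act (O : Matrix.unitaryGroup (Fin k) ℂ) (θ : MBar p k) :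
    invPair (act O θ) = invPair θ := by
  refine Prod.ext ?_ ?_ <;>
  simp only [invPair, val_act, actL_apply, Matrix.conjTranspose_mul, Matrix.mul_assoc,
    unitary_mul_ct_mul]

theorem smooth_invPair : SmoothMap (invPair : MBar p k → Ambient p p) := by
  have hU : SmoothMap fun θ : MBar p k => θ.1.1 := SmoothMap.val.fst
  have hS : SmoothMap fun θ : MBar p k => θ.1.2 := SmoothMap.val.snd
  exact (hU.mul hU.ct).prodMk ((hU.mul hS).mul hU.ct)

/-- The differential of `invPair`. -/
def dinvPair (θ ξ : Ambient p k) : Ambient p p :=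
  (ξ.1 * θ.1ᴴ + θ.1 * ξ.1ᴴ, (ξ.1 * θ.2 + θ.1 * ξ.2) * θ.1ᴴ + θ.1 * θ.2 * ξ.1ᴴ)

theorem hasTDeriv_invPair (θ : MBar p k) (ξ : Ambient p k) :
    HasTDeriv invPair θ ξ (dinvPair θ.1 ξ) := by
  have hU : HasTDeriv (fun θ : MBar p k => θ.1.1) θ ξ ξ.1 := (hasTDeriv_val θ ξ).fst
  have hS : HasTDeriv (fun θ : MBar p k => θ.1.2) θ ξ ξ.2 := (hasTDeriv_val θ ξ).snd
  exact (hU.mul hU.ct).prodMk ((hU.mul hS).mul hU.ct)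

/-- The smooth function on the quotient given by a linear functional of `invPair`. -/
def quotFunctional (l : Ambient p p →ₗ[ℝ] ℝ) : smoothQuot p k :=
  ⟨induced (fun θ => l (invPair θ)) fun O θ => by rw [invPair_act],
    smooth_invPair.clm (LinearMap.toContinuousLinearMap l)⟩

theorem dproj_quotFunctional (l : Ambient p p →ₗ[ℝ] ℝ) {θ : MBar p k} {ξ : Ambient p k}
    (hξ : ξ ∈ TBar θ.1) : dproj θ ξ (quotFunctional l) = l (dinvPair θ.1 ξ) :=
  dirDeriv_eq hξ ((hasTDeriv_invPair θ ξ).clm (LinearMap.toContinuousLinearMap l))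

theorem conjTranspose_ct_mul {θ : MBar p k} {ξ : Ambient p k} (hξ : ξ ∈ TBar θ.1) :
    (θ.1.1ᴴ * ξ.1)ᴴ = -(θ.1.1ᴴ * ξ.1) := by
  rw [Matrix.conjTranspose_mul, Matrix.conjTranspose_conjTranspose,
    eq_neg_of_add_eq_zero_right hξ.1]

/-- Up to a vertical vector, a tangent vector is determined by its image under `dinvPair`. -/
theorem sub_vert_eq {θ : MBar p k} {ξ : Ambient p k} (hξ : ξ ∈ TBar θ.1) :
    ξ - vert θ.1 (θ.1.1ᴴ * ξ.1) = ((dinvPair θ.1 ξ).1 * θ.1.1,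
      θ.1.1ᴴ * (dinvPair θ.1 ξ).2 * θ.1.1) := by
  have h1 : ξ.1ᴴ * θ.1.1 = -(θ.1.1ᴴ * ξ.1) := eq_neg_of_add_eq_zero_right hξ.1
  have e : ∀ Z : Matrix (Fin k) (Fin k) ℂ, θ.1.1ᴴ * (θ.1.1 * Z) = Z := fun Z => by
    rw [← Matrix.mul_assoc, θ.2.1, Matrix.one_mul]
  refine Prod.ext ?_ ?_
  · simp only [Prod.fst_sub, vert, dinvPair, Matrix.add_mul, Matrix.mul_assoc, θ.2.1, h1,
      Matrix.mul_one, Matrix.mul_neg]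
    abel
  · simp only [Prod.snd_sub, vert, dinvPair, Matrix.add_mul, Matrix.mul_add, Matrix.mul_assoc,
      θ.2.1, h1, Matrix.mul_one, Matrix.mul_neg, e]
    abel

/-- The linear functionals of (U Uᴴ, U Σ Uᴴ) are smooth functions on the quotient. If they all have
zero derivative along ξ, then `sub_vert_eq` leaves only the vertical vector with Ω = Uᴴ ξ_U. -/
theorem mem_VBar_of_dproj_eq_zero {θ : MBar p k} {ξ : Ambient p k} (hξ : ξ ∈ TBar θ.1)
    (h : dproj θ ξ = 0) : ξ ∈ VBar θ.1 := by
  have h0 : dinvPair θ.1 ξ = 0 := by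
    rw [← Module.forall_dual_apply_eq_zero_iff ℝ]
    intro l
    rw [← dproj_quotFunctional l hξ, h]
    rfl
  have h1 := sub_vert_eq hξ
  rw [h0] at h1
  have h2 : ξ = vert θ.1 (θ.1.1ᴴ * ξ.1) := by
    refine sub_eq_zero.1 (h1.trans (Prod.ext ?_ ?_)) <;> simp
  rw [h2]
  exact vert_mem_VBar _ (conjTranspose_ct_mul hξ)

theorem dproj_horPart (hk : 0 < k) (hα : 0 < α) (hβ : -(α / k) < β) {θ : MBar p k}
    {ξ : Ambient p k} (hξ : ξ ∈ TBar θ.1) : dproj θ (horPart α θ.1 ξ) = dproj θ ξ := by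
  rw [horPart, map_sub, dproj_vert θ (conjTranspose_vertCoord hk hα hβ hξ), sub_zero]

theorem dproj_injOn (hk : 0 < k) (hα : 0 < α) (hβ : -(α / k) < β) {θ : MBar p k}
    {ξ η : Ambient p k} (hξ : ξ ∈ HBar α β θ.1) (hη : η ∈ HBar α β θ.1)
    (h : dproj θ ξ = dproj θ η) : ξ = η := by
  have hd := HBar.sub hξ hη
  refine sub_eq_zero.1 (eq_zero_of_mem_HBar_of_mem_VBar hk hα hβ hd
    (mem_VBar_of_dproj_eq_zero hd.1 ?_))
  rw [map_sub, h, sub_self]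

theorem horLift_eq (hk : 0 < k) (hα : 0 < α) (hβ : -(α / k) < β) {θ : MBar p k}
    {ξ : Ambient p k} (hξ : ξ ∈ HBar α β θ.1) {v : smoothQuot p k → ℝ} (h : dproj θ ξ = v) :
    horLift α β θ v = ξ := by
  have hex : ∃ ξ ∈ HBar α β θ.1, dproj θ ξ = v := ⟨ξ, hξ, h⟩
  rw [horLift, dif_pos hex]
  obtain ⟨h1, h2⟩ := Classical.choose_spec hex
  exact dproj_injOn hk hα hβ h1 hξ (h2.trans h.symm)

/-! ## Tangent vectors of the quotient -/

/-- Points of one fibre differ by the action, under which Dπ is invariant. All members of the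
supremum therefore coincide. -/
theorem tangent_riemQuot (θ : MBar p k) :
    (riemQuot p k α β).tangent (proj θ) = (TBar θ.1).map (dproj θ) := by
  change (⨆ θ' : {θ' : MBar p k // proj θ' = proj θ}, (TBar θ'.1.1).map (dproj θ'.1)) = _
  refine le_antisymm (iSup_le ?_) (le_iSup_of_le ⟨θ, rfl⟩ le_rfl)
  rintro ⟨θ', h⟩
  obtain ⟨O, rfl⟩ := exists_act_of_proj_eq h
  rintro _ ⟨ξ, hξ, rfl⟩
  refine ⟨actL O⁻¹ ξ, actL_inv_mem O hξ, ?_⟩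
  rw [← dproj_actL O (actL_inv_mem O hξ), actL_actL_inv]

theorem dproj_mem_tangent {θ : MBar p k} {ξ : Ambient p k} (hξ : ξ ∈ TBar θ.1) :
    dproj θ ξ ∈ (riemQuot p k α β).tangent (proj θ) := by
  rw [tangent_riemQuot]
  exact ⟨ξ, hξ, rfl⟩

theorem horLift_spec (hk : 0 < k) (hα : 0 < α) (hβ : -(α / k) < β)
    {x : MQuot p k} (v : (riemQuot p k α β).tangent x) {θ : MBar p k}
    (h : proj θ = x) : horLift α β θ v.1 ∈ HBar α β θ.1 ∧ dproj θ (horLift α β θ v.1) = v.1 := by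
  subst h
  obtain ⟨v, hv⟩ := v
  rw [tangent_riemQuot] at hv
  obtain ⟨ξ, hξ, rfl⟩ := hv
  have h1 := horPart_mem hk hα hβ hξ
  have h2 := dproj_horPart hk hα hβ hξ
  rw [horLift_eq hk hα hβ h1 h2]
  exact ⟨h1, h2⟩

theorem horLift_act (hk : 0 < k) (hα : 0 < α) (hβ : -(α / k) < β)
    {x : MQuot p k} (v : (riemQuot p k α β).tangent x) {θ : MBar p k}
    (h : proj θ = x) (O : Matrix.unitaryGroup (Fin k) ℂ) :
    horLift α β (act O θ) v.1 = actL O (horLift α β θ v.1) := by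
  obtain ⟨h1, h2⟩ := horLift_spec hk hα hβ v h
  exact horLift_eq hk hα hβ (HBar.actL O h1) ((dproj_actL O h1.1).trans h2)

/-- Frees the metric from the chosen representative `Quotient.out`: horizontal lifts are equivariant
and the action is isometric. -/
theorem metric_riemQuot (hk : 0 < k) (hα : 0 < α) (hβ : -(α / k) < β)
    {θ : MBar p k} (v w : (riemQuot p k α β).tangent (proj θ)) :
    (riemQuot p k α β).metric (proj θ) v w
      = metricBar α β θ.1 (horLift α β θ v.1) (horLift α β θ w.1) := by
  change metricBar α β (Quotient.out (proj θ)).1 (horLift α β (Quotient.out (proj θ)) v.1)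
    (horLift α β (Quotient.out (proj θ)) w.1) = _
  obtain ⟨O, hO⟩ := exists_act_of_proj_eq (proj_out (proj θ))
  rw [hO, horLift_act hk hα hβ v rfl, horLift_act hk hα hβ w rfl, metricBar_actL]

/-! ## Vector fields of the quotient -/

/-- The vector field of the quotient given by an equivariant field. -/
def mkFieldQuot (α β : ℝ) (v : MBar p k → Ambient p k) (hv : SmoothMap v)
    (hvT : ∀ θ : MBar p k, v θ ∈ TBar θ.1) (hvO : ∀ O θ, v (act O θ) = actL O (v θ)) :
    (riemQuot p k α β).VectorField :=
  ⟨fun x => ⟨dproj (Quotient.out x) (v (Quotient.out x)), by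
    have h := dproj_mem_tangent (α := α) (β := β) (hvT (Quotient.out x))
    rwa [proj_out] at h⟩, fun f => by
    have h : SmoothMap fun θ => tderiv (pull f).1 θ (v θ) := (smooth_pull f).tderiv hv hvT
    have e : (fun x => dproj (Quotient.out x) (v (Quotient.out x)) f) ∘ proj
        = fun θ => tderiv (pull f).1 θ (v θ) := by
      funext θ
      obtain ⟨O, hO⟩ := exists_act_of_proj_eq (proj_out (proj θ))
      change dproj (Quotient.out (proj θ)) (v (Quotient.out (proj θ))) f = _
      rw [hO, hvO, dproj_actL O (hvT θ)]
      exact dirDeriv_eq_tderiv (pull f) (hvT θ)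
    change ((fun x => dproj (Quotient.out x) (v (Quotient.out x)) f) ∘ proj) ∈ smoothBar p k
    rw [e]
    exact h⟩

theorem mkFieldQuot_proj (v : MBar p k → Ambient p k) (hv : SmoothMap v)
    (hvT : ∀ θ : MBar p k, v θ ∈ TBar θ.1) (hvO : ∀ O θ, v (act O θ) = actL O (v θ))
    (θ : MBar p k) : ((mkFieldQuot α β v hv hvT hvO).1 (proj θ)).1 = dproj θ (v θ) := by
  obtain ⟨O, hO⟩ := exists_act_of_proj_eq (proj_out (proj θ))
  change dproj (Quotient.out (proj θ)) (v (Quotient.out (proj θ))) = _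
  rw [hO, hvO, dproj_actL O (hvT θ)]

theorem fieldQuot_ext {V W : (riemQuot p k α β).VectorField}
    (h : ∀ θ, (V.1 (proj θ)).1 = (W.1 (proj θ)).1) : V = W := by
  refine Subtype.ext (funext fun x => Subtype.ext ?_)
  rw [← proj_out x]
  exact h _

/-- The horizontal lift of a vector field. -/
def liftVec (V : (riemQuot p k α β).VectorField) (θ : MBar p k) : Ambient p k :=
  horLift α β θ (V.1 (proj θ)).1

theorem liftVec_mem (hk : 0 < k) (hα : 0 < α) (hβ : -(α / k) < β)
    (V : (riemQuot p k α β).VectorField) (θ : MBar p k) :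
    liftVec V θ ∈ HBar α β θ.1 := (horLift_spec hk hα hβ (V.1 (proj θ)) rfl).1

theorem dproj_liftVec (hk : 0 < k) (hα : 0 < α) (hβ : -(α / k) < β)
    (V : (riemQuot p k α β).VectorField) (θ : MBar p k) :
    dproj θ (liftVec V θ) = (V.1 (proj θ)).1 := (horLift_spec hk hα hβ (V.1 (proj θ)) rfl).2

theorem liftVec_act (hk : 0 < k) (hα : 0 < α) (hβ : -(α / k) < β)
    (V : (riemQuot p k α β).VectorField) (O : Matrix.unitaryGroup (Fin k) ℂ)
    (θ : MBar p k) : liftVec V (act O θ) = actL O (liftVec V θ) := by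
  rw [liftVec, proj_act, horLift_act hk hα hβ _ rfl]
  rfl

/-- A field on the quotient is known only through its action on functions. Acting on the functionals
of (U Uᴴ, U Σ Uᴴ), it makes `dinvPair` of the lift smooth; this determines the lift up to a vertical
vector, and the smooth horizontal part of that reconstruction is the lift. -/
theorem smooth_liftVec (hk : 0 < k) (hα : 0 < α) (hβ : -(α / k) < β)
    (V : (riemQuot p k α β).VectorField) : SmoothMap (liftVec V) := by
  have hY : SmoothMap fun θ => dinvPair θ.1 (liftVec V θ) := by
    refine SmoothMap.of_functionals fun l => ?_
    have h : (fun x => (V.1 x).1 (quotFunctional l)) ∘ proj ∈ smoothBar p k := V.2 (quotFunctional l)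
    have e : (fun x => (V.1 x).1 (quotFunctional l)) ∘ proj
        = fun θ => l (dinvPair θ.1 (liftVec V θ)) := by
      funext θ
      change (V.1 (proj θ)).1 (quotFunctional l) = _
      rw [← dproj_liftVec hk hα hβ, dproj_quotFunctional l (liftVec_mem hk hα hβ V θ).1]
    rw [e] at h
    exact h
  have hU : SmoothMap fun θ : MBar p k => θ.1.1 := SmoothMap.val.fst
  have hsub : SmoothMap fun θ : MBar p k =>
      liftVec V θ - vert θ.1 (θ.1.1ᴴ * (liftVec V θ).1) := by
    have e : (fun θ : MBar p k => liftVec V θ - vert θ.1 (θ.1.1ᴴ * (liftVec V θ).1))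
        = fun θ : MBar p k => ((dinvPair θ.1 (liftVec V θ)).1 * θ.1.1,
          θ.1.1ᴴ * (dinvPair θ.1 (liftVec V θ)).2 * θ.1.1) :=
      funext fun θ => sub_vert_eq (liftVec_mem hk hα hβ V θ).1
    rw [e]
    exact (hY.fst.mul hU).prodMk ((hU.ct.mul hY.snd).mul hU)
  have e : liftVec V = fun θ => horPart α θ.1
      (liftVec V θ - vert θ.1 (θ.1.1ᴴ * (liftVec V θ).1)) := by
    funext θ
    have hT := (liftVec_mem hk hα hβ V θ).1
    have hs := conjTranspose_ct_mul hT
    have hT' := sub_mem hT (vert_mem θ hs)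
    refine dproj_injOn hk hα hβ (liftVec_mem hk hα hβ V θ) (horPart_mem hk hα hβ hT') ?_
    rw [dproj_horPart hk hα hβ hT', map_sub, dproj_vert θ hs, sub_zero]
  rw [e]
  exact smooth_horPart hk hα hβ hsub

/-- The horizontal lift of a vector field as a vector field of the product. -/
def liftField (hk : 0 < k) (hα : 0 < α) (hβ : -(α / k) < β)
    (V : (riemQuot p k α β).VectorField) : (riemBar p k α β).VectorField :=
  mkField α β (liftVec V) (smooth_liftVec hk hα hβ V) fun θ => (liftVec_mem hk hα hβ V θ).1

theorem repField_liftField (hk : 0 < k) (hα : 0 < α) (hβ : -(α / k) < β)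
    (V : (riemQuot p k α β).VectorField) (θ : MBar p k) :
    repField (liftField hk hα hβ V) θ = liftVec V θ := repField_mkField _ _ _ θ

/-- The pull-back of a smooth function, between the algebras of the two Riemannian spaces. -/
def liftFun (f : (riemQuot p k α β).smooth) : (riemBar p k α β).smooth := pull f

/-- The lift is π-related to the field, so iterated derivatives, hence brackets, of lifts act on
pulled-back functions as they do below. -/
theorem applyField_liftField (hk : 0 < k) (hα : 0 < α) (hβ : -(α / k) < β)
    (V : (riemQuot p k α β).VectorField)
    (f : (riemQuot p k α β).smooth) :
    RiemannianSpace.applyField (liftField hk hα hβ V) (liftFun f)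
      = liftFun (RiemannianSpace.applyField V f) := by
  refine Subtype.ext (funext fun θ => ?_)
  change ((liftField hk hα hβ V).1 θ).1 (pull f) = (V.1 (proj θ)).1 f
  rw [← dirDeriv_repField, repField_liftField, ← dproj_liftVec hk hα hβ]
  rfl

theorem liftField_add (hk : 0 < k) (hα : 0 < α) (hβ : -(α / k) < β)
    (V W : (riemQuot p k α β).VectorField) :
    liftField hk hα hβ (V + W) = liftField hk hα hβ V + liftField hk hα hβ W := by
  refine field_ext fun θ => ?_
  rw [repField_add, repField_liftField, repField_liftField, repField_liftField]
  refine horLift_eq hk hα hβ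
    (HBar.add (liftVec_mem hk hα hβ V θ) (liftVec_mem hk hα hβ W θ)) ?_
  rw [map_add, dproj_liftVec hk hα hβ, dproj_liftVec hk hα hβ]
  rfl

theorem liftField_fsmul (hk : 0 < k) (hα : 0 < α) (hβ : -(α / k) < β)
    (h : (riemQuot p k α β).smooth) (V : (riemQuot p k α β).VectorField) :
    liftField hk hα hβ (RiemannianSpace.fsmul h V)
      = RiemannianSpace.fsmul (liftFun h) (liftField hk hα hβ V) := by
  refine field_ext fun θ => ?_
  rw [repField_fsmul, repField_liftField, repField_liftField]
  refine horLift_eq hk hα hβ (HBar.smul _ (liftVec_mem hk hα hβ V θ)) ?_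
  rw [map_smul, dproj_liftVec hk hα hβ]
  rfl

theorem repField_nablaBar_act (hk : 0 < k) (hα : 0 < α) (hβ : -(α / k) < β)
    (V W : (riemQuot p k α β).VectorField)
    (O : Matrix.unitaryGroup (Fin k) ℂ) (θ : MBar p k) :
    repField (nablaBar (liftField hk hα hβ V) (liftField hk hα hβ W)) (act O θ)
      = actL O (repField (nablaBar (liftField hk hα hβ V) (liftField hk hα hβ W)) θ) := by
  have h : ∀ (V : (riemQuot p k α β).VectorField) (θ : MBar p k),
      repField (liftField hk hα hβ V) (act O θ) = actL O (repField (liftField hk hα hβ V) θ) := by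
    intro V θ
    rw [repField_liftField, repField_liftField, liftVec_act hk hα hβ]
  rw [repField_nablaBar, repField_nablaBar, h V, h W,
    tderiv_equivariant (smooth_repField _) O (h W) (repField_mem _ θ), christoffel_actL, map_add]

/-! ## The Levi-Civita connection of the quotient -/

/-- The Levi-Civita connection of the quotient. -/
def nablaQuot (hk : 0 < k) (hα : 0 < α) (hβ : -(α / k) < β)
    (V W : (riemQuot p k α β).VectorField) : (riemQuot p k α β).VectorField :=
  mkFieldQuot α β (repField (nablaBar (liftField hk hα hβ V) (liftField hk hα hβ W)))
    (smooth_repField _) (repField_mem _) (repField_nablaBar_act hk hα hβ V W)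

theorem nablaQuot_proj (hk : 0 < k) (hα : 0 < α) (hβ : -(α / k) < β)
    (V W : (riemQuot p k α β).VectorField) (θ : MBar p k) :
    ((nablaQuot hk hα hβ V W).1 (proj θ)).1
      = dproj θ (repField (nablaBar (liftField hk hα hβ V) (liftField hk hα hβ W)) θ) :=
  mkFieldQuot_proj _ _ _ _ θ

theorem applyField_nablaQuot (hk : 0 < k) (hα : 0 < α) (hβ : -(α / k) < β)
    (V W : (riemQuot p k α β).VectorField)
    (f : (riemQuot p k α β).smooth) (θ : MBar p k) :
    (RiemannianSpace.applyField (nablaQuot hk hα hβ V W) f).1 (proj θ)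
      = (RiemannianSpace.applyField (nablaBar (liftField hk hα hβ V) (liftField hk hα hβ W))
          (pull f)).1 θ := by
  change ((nablaQuot hk hα hβ V W).1 (proj θ)).1 f
    = ((nablaBar (liftField hk hα hβ V) (liftField hk hα hβ W)).1 θ).1 (pull f)
  rw [nablaQuot_proj, ← dirDeriv_repField]
  rfl

/-- Only one of the two vectors has to be horizontal, since it is orthogonal to the vertical part of
the other. This permits the unprojected covariant derivative in metric compatibility. -/
theorem metric_riemQuot_dproj (hk : 0 < k) (hα : 0 < α) (hβ : -(α / k) < β)
    {θ : MBar p k} {ξ η : Ambient p k} (hξ : ξ ∈ TBar θ.1)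
    (hη : η ∈ HBar α β θ.1) {v w : (riemQuot p k α β).tangent (proj θ)} (hv : v.1 = dproj θ ξ)
    (hw : w.1 = dproj θ η) : (riemQuot p k α β).metric (proj θ) v w = metricBar α β θ.1 ξ η := by
  have hs := conjTranspose_vertCoord hk hα hβ hξ
  rw [metric_riemQuot hk hα hβ, horLift_eq hk hα hβ hη hw.symm,
    horLift_eq hk hα hβ (horPart_mem hk hα hβ hξ) ((dproj_horPart hk hα hβ hξ).trans hv.symm),
    horPart, metricBar_sub_left, metricBar_symm α β θ.1 (vert _ _),
    hη.2 _ (vert_mem_VBar _ hs), sub_zero]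

theorem metric_riemQuot_symm {x : MQuot p k} (v w : (riemQuot p k α β).tangent x) :
    (riemQuot p k α β).metric x v w = (riemQuot p k α β).metric x w v := metricBar_symm _ _ _ _ _

/-- Each axiom is the image under Dπ of the same axiom for the lifts. The connection above need not
be projected first: Dπ ignores its vertical part, and in metric compatibility the other argument is
a horizontal lift. -/
theorem isLeviCivita_nablaQuot (hk : 0 < k) (hα : 0 < α) (hβ : -(α / k) < β) :
    (riemQuot p k α β).IsLeviCivita (nablaQuot hk hα hβ) where
  add_left V V' W := by
    refine fieldQuot_ext fun θ => ?_
    rw [nablaQuot_proj, liftField_add, isLeviCivita_nablaBar.add_left, repField_add, map_add,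
      ← nablaQuot_proj, ← nablaQuot_proj]
    rfl
  fsmul_left h V W := by
    refine fieldQuot_ext fun θ => ?_
    rw [nablaQuot_proj, liftField_fsmul, isLeviCivita_nablaBar.fsmul_left, repField_fsmul, map_smul,
      ← nablaQuot_proj]
    rfl
  add_right V W W' := by
    refine fieldQuot_ext fun θ => ?_
    rw [nablaQuot_proj, liftField_add, isLeviCivita_nablaBar.add_right, repField_add, map_add,
      ← nablaQuot_proj, ← nablaQuot_proj]
    rfl
  leibniz h V W := by
    refine fieldQuot_ext fun θ => ?_
    rw [nablaQuot_proj, liftField_fsmul, isLeviCivita_nablaBar.leibniz, repField_add,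
      repField_fsmul, repField_fsmul, map_add, map_smul, map_smul, ← nablaQuot_proj,
      repField_liftField, dproj_liftVec hk hα hβ, applyField_liftField]
    rfl
  symmetric V W f := by
    refine Subtype.ext (funext fun x => ?_)
    rw [← proj_out x]
    set θ := Quotient.out x
    have h := congrArg (fun g : smoothBar p k => g.1 θ) (isLeviCivita_nablaBar.symmetric
      (liftField hk hα hβ V) (liftField hk hα hβ W) (liftFun f))
    rw [applyField_liftField, applyField_liftField, applyField_liftField,
      applyField_liftField] at h
    change (RiemannianSpace.applyField (nablaQuot hk hα hβ V W) f).1 (proj θ)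
      - (RiemannianSpace.applyField (nablaQuot hk hα hβ W V) f).1 (proj θ) = _
    rw [applyField_nablaQuot, applyField_nablaQuot]
    exact h
  metric_compat V W Z := by
    obtain ⟨g, hg, hgV⟩ := isLeviCivita_nablaBar.metric_compat (liftField hk hα hβ V)
      (liftField hk hα hβ W) (liftField hk hα hβ Z)
    have e : (fun x => (riemQuot p k α β).metric x (W.1 x) (Z.1 x)) ∘ proj = g.1 := by
      funext θ
      rw [hg]
      change (riemQuot p k α β).metric (proj θ) (W.1 (proj θ)) (Z.1 (proj θ))
        = metricBar α β θ.1 (repField (liftField hk hα hβ W) θ)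
          (repField (liftField hk hα hβ Z) θ)
      rw [metric_riemQuot hk hα hβ, repField_liftField, repField_liftField]
      rfl
    have hmem : (fun x => (riemQuot p k α β).metric x (W.1 x) (Z.1 x)) ∘ proj ∈ smoothBar p k := by
      rw [e]; exact g.2
    refine ⟨⟨fun x => (riemQuot p k α β).metric x (W.1 x) (Z.1 x), hmem⟩, fun x => rfl,
      fun x => ?_⟩
    rw [← proj_out x]
    set θ := Quotient.out x
    -- The metric of two fields below pulls back to the metric of their lifts, so its derivative
    -- along the lift of V is the one computed on the product.
    have hpull : pull (⟨fun x => (riemQuot p k α β).metric x (W.1 x) (Z.1 x), hmem⟩ :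
      smoothQuot p k) = g := Subtype.ext e
    have h := hgV θ
    rw [metric_riemBar, metric_riemBar] at h
    rw [metric_riemQuot_dproj hk hα hβ (repField_mem _ θ) (liftVec_mem hk hα hβ Z θ)
        (nablaQuot_proj hk hα hβ V W θ) (dproj_liftVec hk hα hβ Z θ).symm,
      metric_riemQuot_symm, metric_riemQuot_dproj hk hα hβ (repField_mem _ θ)
        (liftVec_mem hk hα hβ W θ) (nablaQuot_proj hk hα hβ V Z θ)
        (dproj_liftVec hk hα hβ W θ).symm, ← dproj_liftVec hk hα hβ, metricBar_symm α β θ.1 _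
        (liftVec W θ), ← repField_liftField hk hα hβ, ← repField_liftField hk hα hβ,
        ← repField_liftField hk hα hβ]
    have hl : dproj θ (repField (liftField hk hα hβ V) θ)
        ⟨fun x => (riemQuot p k α β).metric x (W.1 x) (Z.1 x), hmem⟩
          = dirDeriv θ (repField (liftField hk hα hβ V) θ) g :=
      congrArg (dirDeriv θ (repField (liftField hk hα hβ V) θ)) hpull
    exact (hl.trans (congrFun (dirDeriv_repField (liftField hk hα hβ V) θ) g)).trans h

theorem linField_act (A B : Matrix (Fin p) (Fin p) ℂ) (O : Matrix.unitaryGroup (Fin k) ℂ)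
    (θ : MBar p k) : linField A B (act O θ) = actL O (linField A B θ) := by
  refine Prod.ext ?_ ?_ <;>
  simp only [linField, val_act, actL_apply, Matrix.conjTranspose_mul, Matrix.mul_assoc]

theorem exists_fieldQuot_eq (α β : ℝ) {θ : MBar p k} {ξ : Ambient p k} (hξ : ξ ∈ TBar θ.1) :
    ∃ V : (riemQuot p k α β).VectorField, (V.1 (proj θ)).1 = dproj θ ξ := by
  obtain ⟨A, B, hA, hB, h⟩ := exists_linField_eq hξ
  refine ⟨mkFieldQuot α β _ (smooth_linField A B) (linField_mem hA hB) (linField_act A B), ?_⟩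
  rw [mkFieldQuot_proj, h]

theorem isRegular_riemQuot (hk : 0 < k) (hα : 0 < α) (hβ : -(α / k) < β)
    : (riemQuot p k α β).IsRegular where
  metric_sub_left x u v w := by
    obtain ⟨θ, rfl⟩ : ∃ θ, proj θ = x := ⟨_, proj_out x⟩
    obtain ⟨h1, h2⟩ := horLift_spec hk hα hβ u rfl
    obtain ⟨h3, h4⟩ := horLift_spec hk hα hβ v rfl
    have h : horLift α β θ (u - v).1 = horLift α β θ u.1 - horLift α β θ v.1 := by
      refine horLift_eq hk hα hβ (HBar.sub h1 h3) ?_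
      rw [map_sub, h2, h4]
      rfl
    rw [metric_riemQuot hk hα hβ, metric_riemQuot hk hα hβ, metric_riemQuot hk hα hβ, h,
      metricBar_sub_left]
  metric_symm x u v := metric_riemQuot_symm u v
  definite x v h := by
    obtain ⟨θ, rfl⟩ : ∃ θ, proj θ = x := ⟨_, proj_out x⟩
    obtain ⟨h1, h2⟩ := horLift_spec hk hα hβ v rfl
    rw [metric_riemQuot hk hα hβ] at h
    have h0 := metricBar_self_pos hk hα hβ θ h1.1 h
    refine Subtype.ext ?_
    rw [← h2, h0, map_zero]
    rfl
  exists_field x v := by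
    obtain ⟨θ, rfl⟩ : ∃ θ, proj θ = x := ⟨_, proj_out x⟩
    obtain ⟨h1, h2⟩ := horLift_spec hk hα hβ v rfl
    obtain ⟨V, hV⟩ := exists_fieldQuot_eq α β h1.1
    exact ⟨V, Subtype.ext (hV.trans h2)⟩

/-! ## The gradient and the Hessian of the quotient -/

/-- Pairing the gradient with a vertical vector differentiates a function that is constant on
orbits. -/
theorem gradVec_mem_HBar (hk : 0 < k) (hα : 0 < α) (hβ : -(α / k) < β)
    (f : smoothQuot p k) (θ : MBar p k) :
    gradVec α β (pull f) θ ∈ HBar α β θ.1 := by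
  refine ⟨gradVec_mem _ θ, ?_⟩
  rintro η ⟨Ω, hΩ, rfl⟩
  have h := metricBar_gradVec hk hα hβ (pull f) θ (vert_mem θ hΩ)
  rw [← dproj_apply, dproj_vert θ hΩ] at h
  exact h

/-- The action preserves both the function and the metric, and the gradient is determined by these.
-/
theorem gradVec_act (hk : 0 < k) (hα : 0 < α) (hβ : -(α / k) < β)
    (f : smoothQuot p k) (O : Matrix.unitaryGroup (Fin k) ℂ) (θ : MBar p k) :
    gradVec α β (pull f) (act O θ) = actL O (gradVec α β (pull f) θ) := by
  refine eq_of_metricBar_eq hk hα hβ (gradVec_mem _ _)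
    (actL_mem_TBar_act O (gradVec_mem _ _)) ?_
  intro η hη
  have hη' := actL_inv_mem O hη
  rw [metricBar_gradVec hk hα hβ _ _ hη]
  conv_rhs => rw [← actL_actL_inv O η]
  rw [metricBar_actL, metricBar_gradVec hk hα hβ _ _ hη', ← dproj_apply, ← dproj_apply,
    ← dproj_actL O hη', actL_actL_inv]

theorem isGradientAt_riemQuot (hk : 0 < k) (hα : 0 < α) (hβ : -(α / k) < β)
    (f : smoothQuot p k) (θ : MBar p k) (v : smoothQuot p k → ℝ) :
    (riemQuot p k α β).IsGradientAt f (proj θ) v ↔ v = dproj θ (gradVec α β (pull f) θ) := by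
  have h : (riemQuot p k α β).IsGradientAt f (proj θ) (dproj θ (gradVec α β (pull f) θ)) := by
    refine ⟨dproj_mem_tangent (gradVec_mem _ θ), fun w => ?_⟩
    obtain ⟨h1, h2⟩ := horLift_spec hk hα hβ w rfl
    rw [metric_riemQuot_dproj hk hα hβ (gradVec_mem (pull f) θ) h1 rfl h2.symm,
      metricBar_gradVec hk hα hβ _ _ h1.1, ← dproj_apply, h2]
  refine ⟨fun hv => (isRegular_riemQuot hk hα hβ).isGradientAt_unique hv h, ?_⟩
  rintro rfl
  exact h

/-- The horizontal lift of the gradient below is the gradient of the pulled-back function, and that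
of the direction is ξ. Hence Dπ of the Hessian computed on the product is the Hessian of the
quotient. -/
theorem isHessianAt_riemQuot (hk : 0 < k) (hα : 0 < α) (hβ : -(α / k) < β)
    (f : smoothQuot p k) {θ : MBar p k} {F : Ambient p k → ℝ}
    (hF : ContDiffAt ℝ 2 F θ.1) (hFf : ∀ᶠ θ' : MBar p k in 𝓝 θ, (pull f).1 θ' = F θ'.1)
    {ξ : Ambient p k} (hξ : ξ ∈ HBar α β θ.1) (ζ : smoothQuot p k → ℝ) :
    (riemQuot p k α β).IsHessianAt f (proj θ) (dproj θ ξ) ζ ↔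
      ζ = dproj θ (hessFormula α β θ.1 ξ (euclGrad F θ.1) (euclHess F θ.1 ξ)) := by
  have key : ∀ V G : (riemQuot p k α β).VectorField,
      (∀ x, (riemQuot p k α β).IsGradientAt f x (G.1 x).1) → (V.1 (proj θ)).1 = dproj θ ξ →
      ((nablaQuot hk hα hβ V G).1 (proj θ)).1
        = dproj θ (hessFormula α β θ.1 ξ (euclGrad F θ.1) (euclHess F θ.1 ξ)) := by
    intro V G hG hV
    have hV' : repField (liftField hk hα hβ V) θ = ξ := by
      rw [repField_liftField]
      exact horLift_eq hk hα hβ hξ hV.symm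
    have hG' : ∀ θ, repField (liftField hk hα hβ G) θ = gradVec α β (pull f) θ := fun θ' => by
      rw [repField_liftField]
      exact horLift_eq hk hα hβ (gradVec_mem_HBar hk hα hβ f θ')
        ((isGradientAt_riemQuot hk hα hβ f θ' _).1 (hG (proj θ'))).symm
    rw [nablaQuot_proj, repField_nablaBar_grad hk hα hβ hF hFf hG', hV']
  constructor
  · rintro ⟨nabla, V, G, hLC, hG, hV, rfl⟩
    rw [(isRegular_riemQuot hk hα hβ).isLeviCivita_unique hLC (isLeviCivita_nablaQuot hk hα hβ)]
    exact key V G hG hV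
  · rintro rfl
    obtain ⟨V, hV⟩ := exists_fieldQuot_eq α β hξ.1
    have hG : ∀ x, (riemQuot p k α β).IsGradientAt f x ((mkFieldQuot α β _
        (smooth_gradVec hk hα hβ (pull f)) (gradVec_mem (pull f))
        (gradVec_act hk hα hβ f)).1 x).1 := by
      intro x
      obtain ⟨θ', rfl⟩ : ∃ θ, proj θ = x := ⟨_, proj_out x⟩
      rw [mkFieldQuot_proj]
      exact (isGradientAt_riemQuot hk hα hβ f θ' _).2 rfl
    exact ⟨nablaQuot hk hα hβ, V, _, isLeviCivita_nablaQuot hk hα hβ, hG, hV, key _ _ hG hV⟩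

end

end FixedRank

/-! ### The gradient and Hessian formulas -/

theorem mainTheorem4 (p k : ℕ) (hk : 0 < k) (α β : ℝ) (hα : 0 < α) (hβ : -(α / k) < β)
    (f : FixedRank.MBar p k → ℝ) (hf : f ∈ FixedRank.smoothBar p k)
    (hinv : ∀ (O : Matrix.unitaryGroup (Fin k) ℂ) (θ : FixedRank.MBar p k),
      f (FixedRank.act O θ) = f θ)
    (θ : FixedRank.MBar p k)
    (F : FixedRank.Ambient p k → ℝ) (hF : ContDiffAt ℝ 2 F θ.1)
    (hFf : ∀ᶠ θ' : FixedRank.MBar p k in 𝓝 θ, f θ' = F θ'.1) :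
    -- the Riemannian gradient on the product is horizontal and given by the formula
    (FixedRank.gradFormula α β θ.1 (FixedRank.euclGrad F θ.1) ∈ FixedRank.HBar α β θ.1 ∧
      ∀ v, (FixedRank.riemBar p k α β).IsGradientAt ⟨f, hf⟩ θ v ↔
        v = FixedRank.dirDeriv θ
          (FixedRank.gradFormula α β θ.1 (FixedRank.euclGrad F θ.1))) ∧
    -- it represents the Riemannian gradient on the quotient
    (∀ v, (FixedRank.riemQuot p k α β).IsGradientAt ⟨FixedRank.induced f hinv, hf⟩
          (FixedRank.proj θ) v ↔
        v = FixedRank.dproj θ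
          (FixedRank.gradFormula α β θ.1 (FixedRank.euclGrad F θ.1))) ∧
    -- the Riemannian Hessian on the product is given by the formula
    (∀ ξ ∈ FixedRank.TBar θ.1,
      FixedRank.hessFormula α β θ.1 ξ (FixedRank.euclGrad F θ.1) (FixedRank.euclHess F θ.1 ξ)
          ∈ FixedRank.TBar θ.1 ∧
      ∀ ζ, (FixedRank.riemBar p k α β).IsHessianAt ⟨f, hf⟩ θ (FixedRank.dirDeriv θ ξ) ζ ↔
        ζ = FixedRank.dirDeriv θ
          (FixedRank.hessFormula α β θ.1 ξ (FixedRank.euclGrad F θ.1)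
            (FixedRank.euclHess F θ.1 ξ))) ∧
    -- its horizontal projection represents the Riemannian Hessian on the quotient
    (∀ ξ ∈ FixedRank.HBar α β θ.1,
      FixedRank.horProj α β θ.1
          (FixedRank.hessFormula α β θ.1 ξ (FixedRank.euclGrad F θ.1)
            (FixedRank.euclHess F θ.1 ξ)) ∈ FixedRank.HBar α β θ.1 ∧
      ∀ ζ, (FixedRank.riemQuot p k α β).IsHessianAt ⟨FixedRank.induced f hinv, hf⟩
          (FixedRank.proj θ) (FixedRank.dproj θ ξ) ζ ↔
        ζ = FixedRank.dproj θ
          (FixedRank.horProj α β θ.1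
            (FixedRank.hessFormula α β θ.1 ξ (FixedRank.euclGrad F θ.1)
              (FixedRank.euclHess F θ.1 ξ)))) := by
  have hd : DifferentiableAt ℝ F θ.1 := hF.differentiableAt (by simp)
  have hg : FixedRank.gradVec α β ⟨f, hf⟩ θ
      = FixedRank.gradFormula α β θ.1 (FixedRank.euclGrad F θ.1) :=
    FixedRank.gradVec_eq hk hα hβ hd hFf
  -- The induced function composed with π is f by definition, so `pull f'` and f share their
  -- gradient and Hessian on the product.
  let f' : FixedRank.smoothQuot p k := ⟨FixedRank.induced f hinv, hf⟩
  refine ⟨⟨?_, fun v => ?_⟩, fun v => ?_, fun ξ hξ => ⟨?_, fun ζ => ?_⟩, fun ξ hξ => ?_⟩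
  · rw [← hg]
    exact FixedRank.gradVec_mem_HBar hk hα hβ f' θ
  · rw [← hg]
    exact FixedRank.isGradientAt_riemBar hk hα hβ ⟨f, hf⟩ θ v
  · rw [← hg]
    exact FixedRank.isGradientAt_riemQuot hk hα hβ f' θ v
  · exact FixedRank.hessFormula_mem hk hα hβ ⟨f, hf⟩ hF hFf hξ
  · exact FixedRank.isHessianAt_riemBar hk hα hβ ⟨f, hf⟩ hF hFf hξ ζ
  · have hT := FixedRank.hessFormula_mem hk hα hβ ⟨f, hf⟩ hF hFf hξ.1
    -- The projection subtracts a vertical vector, so it yields a horizontal vector with the same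
    -- image under Dπ.
    rw [FixedRank.horProj_eq hk hα hβ hT]
    refine ⟨FixedRank.horPart_mem hk hα hβ hT, fun ζ => ?_⟩
    rw [FixedRank.dproj_horPart hk hα hβ hT]
    exact FixedRank.isHessianAt_riemQuot hk hα hβ f' hF hFf hξ ζ
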